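/- Let $G=(V,E)$ be a simple digraph with $n$ vertices and (initially) $m$ edges, where each edge $e$ has a level $\ell(e)\in\{0,\dots,k\}$, and let a partition of $V$ be given. Let $M$ be the multigraph obtained from $G$ by contracting the sets of the partition and removing self-loops. For each ordered pair $(u,v)$ of distinct vertices of $M$ joined by an edge, the representative edge $(u,v)$ has as its level $\ell(u,v)$ the minimum level of the edges from $u$ to $v$. $M$ undergoes a sequence of updates of three kinds: an edge of $G$ is deleted; the level of an edge is increased; a set $V'$ of the partition is split into nonempty sets $W_1,\dots,W_p$ with $|W_i|\le\frac12|V'|$ for $i<p$, where $W_p$ keeps the identity of $V'$. After each update the new vertices and the sets of representative edges (with levels) that disappear and appear are reported. A source $s\in V(M)$ is given that is never split. Let $w_M,W_M:\{0,\dots,k\}\to\{1,2,\dots\}$ with $w_M\le W_M$, and let $\lceil x\rceil_i$ be the smallest integer that is at least $x+w_M(i)$ and divisible by $1+W_M(i)-w_M(i)$. Assume that $\lceil x\rceil_i\le\lceil x\rceil_j$ for all $x\in\mathbb N_0$ and $i\le j$. Let $w$ be the edge weight function of $M$ that is defined recursively by $w(e)=\lceil d_M(s,u)\rceil_i-d_M(s,u)$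 for an edge $e$ of level $i$ that starts in a vertex $u$ reachable from $s$, where $d_M$ is the shortest path distance in $M$ w.r.t. $w$. Let $D\in\mathbb N_0$. There is a deterministic data structure (on a word RAM with words of $O(\log(n+k+D+\sum_i W_M(i)))$ bits) that processes the reports on the updates and supports an operation UpdateDistances, which may be called at any time between updates. After each call of UpdateDistances the weight function $w$ exists, and the structure contains a shortest path tree $T$ of the current $M$ from $s$ up to distance $D$ w.r.t. $w$: arrays store for each vertex $v$ with $d_M(s,v)\le D$ the distance $d_M(s,v)$ and, if $v\ne s$, the parent of $v$ in $T$, where $T$ consists of representative edges, and for each other vertex a number larger than $D$. If $\delta_i$ is an upper bound on the number of representative edges of level $i$ incident to any vertex of $M$ during any execution of UpdateDistances ($i=0,\dots,k$), then the total time for the initialization and $N$ operations (updates and calls of UpdateDistances) is \[ O\Bigl(N+1+(m+n)\log n+Dn(k+\log n)+Dn\sum_{i=0}^k\frac{\delta_i}{1+W_M(i)-w_M(i)}\Bigr). \] The constants depend on nothing. The time that is spent on maintaining $M$ and producing the reports is not included. -/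

import Mathlib

namespace FlexES

/-! ### The machine model: structured programs on a word RAM

A program has registers and arrays that hold machine words, i.e. natural numbers below `B`.
Arithmetic wraps around modulo `B`.  Every operator of an expression, every assignment and every
test is charged, so that the time is the number of elementary operations up to a constant factor.
-/

/-- The memory: `reg r` is register `r`, and `arr a j` is the `j`-th cell of array `a`. -/
structure Store where
  reg : ℕ → ℕ
  arr : ℕ → ℕ → ℕ

/-- The memory before anything happens. -/
def Store.zero : Store := ⟨fun _ => 0, fun _ _ => 0⟩

/-- Expressions; `get a e` reads array `a` at the position given by `e`. -/
inductive Expr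
  | const (c : ℕ)
  | reg (r : ℕ)
  | get (a : ℕ) (e : Expr)
  | add (e f : Expr)
  | sub (e f : Expr)
  | mul (e f : Expr)
  | div (e f : Expr)
  | mod (e f : Expr)
  | lt (e f : Expr)
  | eq (e f : Expr)

/-- The value of an expression for words below `B`. -/
def Expr.eval (B : ℕ) (σ : Store) : Expr → ℕ
  | .const c => c % B
  | .reg r => σ.reg r
  | .get a e => σ.arr a (e.eval B σ)
  | .add e f => (e.eval B σ + f.eval B σ) % B
  | .sub e f => e.eval B σ - f.eval B σ
  | .mul e f => (e.eval B σ * f.eval B σ) % B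
  | .div e f => e.eval B σ / f.eval B σ
  | .mod e f => e.eval B σ % f.eval B σ
  | .lt e f => if e.eval B σ < f.eval B σ then 1 % B else 0
  | .eq e f => if e.eval B σ = f.eval B σ then 1 % B else 0

/-- The time for evaluating an expression: its number of nodes. -/
def Expr.cost : Expr → ℕ
  | .const _ => 1
  | .reg _ => 1
  | .get _ e => e.cost + 1
  | .add e f => e.cost + f.cost + 1
  | .sub e f => e.cost + f.cost + 1
  | .mul e f => e.cost + f.cost + 1
  | .div e f => e.cost + f.cost + 1
  | .mod e f => e.cost + f.cost + 1
  | .lt e f => e.cost + f.cost + 1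
  | .eq e f => e.cost + f.cost + 1

/-- Commands: `set r e` is the assignment `reg r := e`, and `put a e f` is `arr a e := f`.
Tests succeed if the value is nonzero. -/
inductive Cmd
  | skip
  | set (r : ℕ) (e : Expr)
  | put (a : ℕ) (e f : Expr)
  | seq (c c' : Cmd)
  | ite (e : Expr) (c c' : Cmd)
  | loop (e : Expr) (c : Cmd)

def Store.setReg (σ : Store) (r x : ℕ) : Store :=
  { σ with reg := Function.update σ.reg r x }

def Store.setArr (σ : Store) (a j x : ℕ) : Store :=
  { σ with arr := Function.update σ.arr a (Function.update (σ.arr a) j x) }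

/-- `Exec B c σ σ' t`: started in the memory `σ`, the command `c` terminates in the memory `σ'`
after time `t`. -/
inductive Exec (B : ℕ) : Cmd → Store → Store → ℕ → Prop
  | skip (σ : Store) : Exec B .skip σ σ 1
  | set (r : ℕ) (e : Expr) (σ : Store) :
      Exec B (.set r e) σ (σ.setReg r (e.eval B σ)) (e.cost + 1)
  | put (a : ℕ) (e f : Expr) (σ : Store) :
      Exec B (.put a e f) σ (σ.setArr a (e.eval B σ) (f.eval B σ)) (e.cost + f.cost + 1)
  | seq (c c' : Cmd) (σ σ' σ'' : Store) (t t' : ℕ) :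
      Exec B c σ σ' t → Exec B c' σ' σ'' t' → Exec B (.seq c c') σ σ'' (t + t')
  | ite_true (e : Expr) (c c' : Cmd) (σ σ' : Store) (t : ℕ) :
      e.eval B σ ≠ 0 → Exec B c σ σ' t → Exec B (.ite e c c') σ σ' (e.cost + 1 + t)
  | ite_false (e : Expr) (c c' : Cmd) (σ σ' : Store) (t : ℕ) :
      e.eval B σ = 0 → Exec B c' σ σ' t → Exec B (.ite e c c') σ σ' (e.cost + 1 + t)
  | loop_done (e : Expr) (c : Cmd) (σ : Store) :
      e.eval B σ = 0 → Exec B (.loop e c) σ σ (e.cost + 1)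
  | loop_next (e : Expr) (c : Cmd) (σ σ' σ'' : Store) (t t' : ℕ) :
      e.eval B σ ≠ 0 → Exec B c σ σ' t → Exec B (.loop e c) σ' σ'' t' →
      Exec B (.loop e c) σ σ'' (e.cost + 1 + t + t')

/-- The machine is deterministic: the final memory and the time are functions of the program and
of the initial memory. -/
theorem Exec.deterministic {B : ℕ} {c : Cmd} {σ σ₁ σ₂ : Store} {t₁ t₂ : ℕ}
    (h₁ : Exec B c σ σ₁ t₁) (h₂ : Exec B c σ σ₂ t₂) : σ₁ = σ₂ ∧ t₁ = t₂ := by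
  induction h₁ generalizing σ₂ t₂ with
  | skip => cases h₂; exact ⟨rfl, rfl⟩
  | set => cases h₂; exact ⟨rfl, rfl⟩
  | put => cases h₂; exact ⟨rfl, rfl⟩
  | seq c c' σ σ' σ'' t t' _ _ ih ih' =>
    cases h₂ with
    | seq _ _ _ _ _ _ _ h h' =>
      obtain ⟨rfl, rfl⟩ := ih h
      obtain ⟨rfl, rfl⟩ := ih' h'
      exact ⟨rfl, rfl⟩
  | ite_true e c c' σ σ' t he _ ih =>
    cases h₂ with
    | ite_true _ _ _ _ _ _ _ h => obtain ⟨rfl, rfl⟩ := ih h; exact ⟨rfl, rfl⟩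
    | ite_false _ _ _ _ _ _ he' => exact absurd he' he
  | ite_false e c c' σ σ' t he _ ih =>
    cases h₂ with
    | ite_true _ _ _ _ _ _ he' => exact absurd he he'
    | ite_false _ _ _ _ _ _ _ h => obtain ⟨rfl, rfl⟩ := ih h; exact ⟨rfl, rfl⟩
  | loop_done e c σ he =>
    cases h₂ with
    | loop_done => exact ⟨rfl, rfl⟩
    | loop_next _ _ _ _ _ _ _ he' => exact absurd he he'
  | loop_next e c σ σ' σ'' t t' he _ _ ih ih' =>
    cases h₂ with
    | loop_done _ _ _ he' => exact absurd he' he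
    | loop_next _ _ _ _ _ _ _ _ h h' =>
      obtain ⟨rfl, rfl⟩ := ih h
      obtain ⟨rfl, rfl⟩ := ih' h'
      exact ⟨rfl, rfl⟩

/-! ### The contracted multigraph and its updates -/

/-- A digraph on `Fin n` with edge set `E` and edge levels `lev`, and a partition of `Fin n`.
The sets of the partition are named by elements of `Fin n`: `cls v` is the name of the set that
contains `v`.  The vertices of the multigraph `M` are the sets of the partition. -/
structure MState (n k : ℕ) where
  E : Finset (Fin n × Fin n)
  lev : Fin n × Fin n → Fin (k + 1)
  cls : Fin n → Fin n

namespace MState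

variable {n k : ℕ}

/-- The (names of the) vertices of the multigraph. -/
def verts (M : MState n k) : Finset (Fin n) := Finset.univ.image M.cls

/-- The edges of the multigraph: the edge `e` leads from `cls e.1` to `cls e.2`, and self-loops are
removed. -/
def edges (M : MState n k) : Finset (Fin n × Fin n) :=
  M.E.filter fun e => M.cls e.1 ≠ M.cls e.2

/-- `e` is an edge of the multigraph of minimum level among the edges parallel to it. -/
def IsRep (M : MState n k) (e : Fin n × Fin n) : Prop :=
  e ∈ M.edges ∧
    ∀ f ∈ M.edges, M.cls f.1 = M.cls e.1 → M.cls f.2 = M.cls e.2 → M.lev e ≤ M.lev f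

open Classical in
/-- The representative edges `(u, v)` with their levels, as triples `(u, v, ℓ(u, v))`. -/
noncomputable def reps (M : MState n k) : Finset (Fin n × Fin n × Fin (k + 1)) :=
  (M.E.filter M.IsRep).image fun e => (M.cls e.1, M.cls e.2, M.lev e)

/-- The edge list `p` is a walk from `a` to `b` in the multigraph. -/
def IsWalk (M : MState n k) : Fin n → Fin n → List (Fin n × Fin n) → Prop
  | a, b, [] => a = b
  | a, b, e :: p => e ∈ M.edges ∧ M.cls e.1 = a ∧ M.IsWalk (M.cls e.2) b p

/-- The shortest path distance in the multigraph w.r.t. the edge weights `w`. -/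
noncomputable def dist (M : MState n k) (w : Fin n × Fin n → ℕ) (a b : Fin n) : ℕ∞ :=
  ⨅ (p : List (Fin n × Fin n)) (_ : M.IsWalk a b p), (((p.map w).sum : ℕ) : ℕ∞)

end MState

/-- The operations: the three kinds of updates of the multigraph, and the calls of
`UpdateDistances`.  In `split a f`, the set named `a` is split, and `f` is the new partition. -/
inductive Op (n k : ℕ)
  | delete (e : Fin n × Fin n)
  | increase (e : Fin n × Fin n) (i : Fin (k + 1))
  | split (a : Fin n) (f : Fin n → Fin n)
  | updateDistances

/-- `f` arises from the partition of `M` by splitting the set named `a` into a (nonempty) set that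
is again named `a` and sets with new names, each of at most half the size of the old set. -/
def MState.IsSplit {n k : ℕ} (M : MState n k) (a : Fin n) (f : Fin n → Fin n) : Prop :=
  a ∈ M.verts ∧
  (∀ v, M.cls v ≠ a → f v = M.cls v) ∧
  (∀ v, M.cls v = a → f v = a ∨ f v ∉ M.verts) ∧
  (∃ v, f v = a) ∧
  (∀ v, M.cls v = a → f v ≠ a →
    2 * (Finset.univ.filter fun x => f x = f v).card ≤
      (Finset.univ.filter fun x => M.cls x = a).card)

/-- `M'` arises from `M` by the given operation; the source `s` is never split. -/
def MState.Step {n k : ℕ} (s : Fin n) (M M' : MState n k) : Op n k → Prop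
  | .delete e => e ∈ M.E ∧ M' = { M with E := M.E.erase e }
  | .increase e i => e ∈ M.E ∧ M.lev e < i ∧ M' = { M with lev := Function.update M.lev e i }
  | .split a f => a ≠ s ∧ M.IsSplit a f ∧ M' = { M with cls := f }
  | .updateDistances => M' = M

/-- What is reported about an update of the multigraph: its new vertices, and the representative
edges that disappear and appear, as lists in any order. -/
structure Output (n k : ℕ) where
  new : List (Fin n)
  Eold : List (Fin n × Fin n × Fin (k + 1))
  Enew : List (Fin n × Fin n × Fin (k + 1))

/-- `o` reports the change from `M` to `M'`.  A representative edge that changes its level is in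
both edge lists, with its old and its new level. -/
def Output.IsUpdate {n k : ℕ} (o : Output n k) (M M' : MState n k) : Prop :=
  (o.new.Nodup ∧ ∀ v, v ∈ o.new ↔ v ∈ M'.verts ∧ v ∉ M.verts) ∧
  (o.Eold.Nodup ∧ ∀ r, r ∈ o.Eold ↔ r ∈ M.reps ∧ r ∉ M'.reps) ∧
  (o.Enew.Nodup ∧ ∀ r, r ∈ o.Enew ↔ r ∈ M'.reps ∧ r ∉ M.reps)

/-- `o` reports the initial multigraph `M`. -/
def Output.IsInit {n k : ℕ} (o : Output n k) (M : MState n k) : Prop :=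
  (o.new.Nodup ∧ ∀ v, v ∈ o.new ↔ v ∈ M.verts) ∧
  o.Eold = [] ∧
  (o.Enew.Nodup ∧ ∀ r, r ∈ o.Enew ↔ r ∈ M.reps)

/-! ### The flexible weight function and its shortest path trees -/

/-- `⌈x⌉_i`: the smallest integer that is at least `x + w i` and divisible by `1 + W i - w i`. -/
noncomputable def flexCeil {k : ℕ} (w W : Fin (k + 1) → ℕ) (i : Fin (k + 1)) (x : ℕ) : ℕ :=
  sInf {y : ℕ | x + w i ≤ y ∧ (1 + W i - w i) ∣ y}

/-- `ω` is a solution of the recursion `ω(u, v) = ⌈d(s, u)⌉_i - d(s, u)`, with `i = ℓ(u, v)` and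
`d` the distance w.r.t. `ω`, on all edges whose start vertex is reachable from `s`. -/
def IsFlexWeight {n k : ℕ} (w W : Fin (k + 1) → ℕ) (s : Fin n) (M : MState n k)
    (ω : Fin n × Fin n → ℕ) : Prop :=
  ∀ e ∈ M.edges, ∀ x : ℕ, M.dist ω s (M.cls e.1) = x → ω e = flexCeil w W (M.lev e) x - x

/-- The arrays `d` (distances) and `p` (parents) represent a shortest path tree of `M` rooted at `s`
up to distance `D` w.r.t. `ω`, which consists of representative edges: `d` is the distance for the
vertices at distance at most `D` and larger than `D` for the others, and the path of parent edges
from `s` to any vertex at distance at most `D` exists and is a shortest path in `M`. -/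
def IsSSSPTree {n k : ℕ} (s : Fin n) (D : ℕ) (M : MState n k) (ω : Fin n × Fin n → ℕ)
    (d p : ℕ → ℕ) : Prop :=
  ∀ v ∈ M.verts,
    (M.dist ω s v ≤ D →
      (d v : ℕ∞) = M.dist ω s v ∧
      ∃ q : List (Fin n × Fin n), M.IsWalk s v q ∧
        (∀ e ∈ q, M.IsRep e ∧ p (M.cls e.2) = M.cls e.1) ∧
        (((q.map ω).sum : ℕ) : ℕ∞) = M.dist ω s v) ∧
    ((D : ℕ∞) < M.dist ω s v → D < d v)

/-! ### Data structures -/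

/-- A data structure is given by three commands: one for the initialization, one that is
executed after every update of the multigraph, and one for `UpdateDistances`. -/
structure Program where
  init : Cmd
  updateP : Cmd
  updateDistances : Cmd

/-- Array `a` is filled with the list `l`. -/
def Store.load (σ : Store) (a : ℕ) (l : List ℕ) : Store :=
  { σ with arr := Function.update σ.arr a fun j => l.getD j 0 }

/-- An edge list as a list of numbers. -/
def flatten {n k : ℕ} (l : List (Fin n × Fin n × Fin (k + 1))) : List ℕ :=
  l.flatMap fun r => [(r.1 : ℕ), (r.2.1 : ℕ), (r.2.2 : ℕ)]

/-- The report on an update is put into the arrays 0, 3, 4, 5. Here `a` is the vertex that was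
split (and `0` for the other updates). -/
def Store.loadOutput {n k : ℕ} (σ : Store) (D : ℕ) (s : Fin n) (a : ℕ) (o : Output n k) : Store :=
  (((σ.load 0 [n, k, D, s, a, o.new.length, o.Eold.length, o.Enew.length]).load 3
    (o.new.map fun v => (v : ℕ))).load 4 (flatten o.Eold)).load 5 (flatten o.Enew)

/-- The memory at the start: the functions `w`, `W` are in the arrays 1, 2, and all else is zero
except for the report on the initial multigraph. -/
def initStore {n k : ℕ} (w W : Fin (k + 1) → ℕ) (D : ℕ) (s : Fin n) (o : Output n k) : Store :=
  ((Store.zero.load 1 (List.ofFn w)).load 2 (List.ofFn W)).loadOutput D s 0 o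

/-- The data structure handles one operation, from memory `σ` to memory `σ'` in time `t`. -/
def Program.Handles {n k : ℕ} (A : Program) (B D : ℕ) (s : Fin n) (o : Output n k)
    (σ σ' : Store) (t : ℕ) : Op n k → Prop
  | .delete _ => Exec B A.updateP (σ.loadOutput D s 0 o) σ' t
  | .increase _ _ => Exec B A.updateP (σ.loadOutput D s 0 o) σ' t
  | .split a _ => Exec B A.updateP (σ.loadOutput D s a o) σ' t
  | .updateDistances => Exec B A.updateDistances σ σ' t

/-- The array for the distances and the array for the parents, read by the queries. -/
def Store.distArray (σ : Store) : ℕ → ℕ := σ.arr 6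

def Store.parentArray (σ : Store) : ℕ → ℕ := σ.arr 7

end FlexES

namespace FlexES

/-! ### Reasoning about commands -/

/-! The data structure is an Even–Shiloach tree that stores no edge weights. Each vertex `v` has a
number `d v ≤ D + 1`, which starts at 0 and never decreases. A representative edge `(u, v)` of level
`i` has the key `⌈d u⌉_i`, cut off at `D + 1`. The invariant is feasibility: `d v` is at most the
key of every edge into `v`. As rounding is monotone and weights are positive, `d` is then a lower
bound on the distances for every solution of the weight recursion (`le_dist_of_feasible`). If in
addition each `v ≠ s` with `d v ≤ D` has a tight in-edge, i.e. one with key `d v`, then such edges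
form a tree whose paths have length exactly `d v`, and `d` is the distance up to `D`
(`isSSSPTree_of_feasible`). Existence of a solution is a separate argument with earliest arrival
times (`exists_isFlexWeight`).

Vertices that may lack a tight in-edge wait on a stack. `UpdateDistances` pops a vertex `v`. If no
in-edge is tight, all their keys exceed `d v`, so `d v` can be raised by one without losing
feasibility (`Feasible.update`). Updates of the multigraph keep feasibility as well
(`MState.Step.feasible`): deletions and level increases only weaken the constraints, and a split-off
vertex inherits the value of the vertex it comes from. In-edges are grouped by key and out-edges by
level, in array sets with constant time insertion and deletion (`IsBag`).

For the time, a raise of `d u` from `x` to `x + 1` moves the out-edges of level `i` only if their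
cut-off keys differ. Since `⌈x⌉_i` takes only multiples of `1 + W_i - w_i` as values, this happens
at most `D / (1 + W_i - w_i)` times per vertex (`card_filter_key_le`), for at most `δ_i` edges each
time. A potential that prepays all future raises and the work on the stack turns this into an
amortized bound (`Good.updateDistances`). The reports have total size `O(N + n + m log n)` after the
initial one (`sum_size_le`): whenever a split renames an endpoint of an edge, the set that contains
this endpoint has shrunk to at most half its size. -/

@[simp] theorem Store.reg_setReg (σ : Store) (r x r' : ℕ) :
    (σ.setReg r x).reg r' = if r' = r then x else σ.reg r' := by
  simp [Store.setReg, Function.update_apply]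

@[simp] theorem Store.arr_setReg (σ : Store) (r x : ℕ) : (σ.setReg r x).arr = σ.arr := rfl

@[simp] theorem Store.reg_setArr (σ : Store) (a j x : ℕ) : (σ.setArr a j x).reg = σ.reg := rfl

@[simp] theorem Store.arr_setArr (σ : Store) (a j x a' : ℕ) :
    (σ.setArr a j x).arr a' = if a' = a then Function.update (σ.arr a) j x else σ.arr a' := by
  simp [Store.setArr, Function.update_apply]

/-- Started in `σ`, the command `c` terminates, and `Q` holds for the final memory and the time. -/
def WP (B : ℕ) (c : Cmd) (σ : Store) (Q : Store → ℕ → Prop) : Prop :=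
  ∃ σ' t, Exec B c σ σ' t ∧ Q σ' t

section WP

variable {B : ℕ} {σ : Store} {Q : Store → ℕ → Prop}

theorem WP.mono {c : Cmd} {Q' : Store → ℕ → Prop} (h : WP B c σ Q) (hQ : ∀ σ' t, Q σ' t → Q' σ' t) :
    WP B c σ Q' := by
  obtain ⟨σ', t, he, hq⟩ := h
  exact ⟨σ', t, he, hQ _ _ hq⟩

theorem WP.skip (h : Q σ 1) : WP B .skip σ Q := ⟨_, _, .skip σ, h⟩

theorem WP.set {r : ℕ} {e : Expr} (x : ℕ) (hx : e.eval B σ = x)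
    (h : Q (σ.setReg r x) (e.cost + 1)) : WP B (.set r e) σ Q := by
  subst hx
  exact ⟨_, _, .set r e σ, h⟩

theorem WP.put {a : ℕ} {e f : Expr} (j x : ℕ) (hj : e.eval B σ = j) (hx : f.eval B σ = x)
    (h : Q (σ.setArr a j x) (e.cost + f.cost + 1)) : WP B (.put a e f) σ Q := by
  subst hx hj
  exact ⟨_, _, .put a e f σ, h⟩

theorem WP.seq {c c' : Cmd}
    (h : WP B c σ fun σ₁ t₁ => WP B c' σ₁ fun σ₂ t₂ => Q σ₂ (t₁ + t₂)) :
    WP B (.seq c c') σ Q := by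
  obtain ⟨σ₁, t₁, h₁, σ₂, t₂, h₂, hQ⟩ := h
  exact ⟨_, _, .seq _ _ _ _ _ _ _ h₁ h₂, hQ⟩

theorem WP.ite {e : Expr} {c c' : Cmd}
    (h : e.eval B σ ≠ 0 → WP B c σ fun σ' t => Q σ' (e.cost + 1 + t))
    (h' : e.eval B σ = 0 → WP B c' σ fun σ' t => Q σ' (e.cost + 1 + t)) :
    WP B (.ite e c c') σ Q := by
  by_cases he : e.eval B σ = 0
  · obtain ⟨σ', t, h₁, hQ⟩ := h' he
    exact ⟨_, _, .ite_false _ _ _ _ _ _ he h₁, hQ⟩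
  · obtain ⟨σ', t, h₁, hQ⟩ := h he
    exact ⟨_, _, .ite_true _ _ _ _ _ _ he h₁, hQ⟩

/-- The rule for loops with time credits: `I m σ` is an invariant of the memory `σ` and of the
number `m` of the remaining credits. -/
theorem WP.loop {e : Expr} {c : Cmd} (I : ℕ → Store → Prop)
    (step : ∀ m σ, I m σ → e.eval B σ ≠ 0 →
      WP B c σ fun σ' t => ∃ m', m' + t + (e.cost + 1) ≤ m ∧ I m' σ')
    {m : ℕ} (h : I m σ) :
    WP B (.loop e c) σ fun σ' t =>
      ∃ m', m' + t ≤ m + (e.cost + 1) ∧ I m' σ' ∧ e.eval B σ' = 0 := by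
  -- Every round uses up at least the positive cost of its test, so the credits drop strictly. This
  -- proves termination together with the time bound. The surplus `e.cost + 1` pays for the last,
  -- failing test.
  induction m using Nat.strong_induction_on generalizing σ with
  | _ m ih =>
    by_cases he : e.eval B σ = 0
    · exact ⟨_, _, .loop_done _ _ _ he, m, le_rfl, h, he⟩
    · obtain ⟨σ', t, h₁, m', hm, hI⟩ := step m σ h he
      obtain ⟨σ'', t', h₂, m'', hm', hI', he'⟩ := ih m' (by omega) hI
      exact ⟨_, _, .loop_next _ _ _ _ _ _ _ he h₁ h₂, m'', by omega, hI', he'⟩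

/-- The rule for counting loops: `J j` holds after `j` rounds, and round `j` takes time `T j`. -/
theorem WP.for {e : Expr} {c : Cmd} (J : ℕ → Store → Prop) (T : ℕ → ℕ) (b : ℕ)
    (test : ∀ j σ, j ≤ b → J j σ → (e.eval B σ ≠ 0 ↔ j < b))
    (step : ∀ j σ, j < b → J j σ → WP B c σ fun σ' t => J (j + 1) σ' ∧ t ≤ T j)
    (h : J 0 σ) :
    WP B (.loop e c) σ fun σ' t =>
      J b σ' ∧ t ≤ (∑ j ∈ Finset.range b, (T j + (e.cost + 1))) + (e.cost + 1) := by
  -- A start in round `j` is allowed for the induction; the time of the earlier rounds is added on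
  -- the left in order to avoid subtraction.
  suffices H : ∀ m j σ, j + m = b → J j σ → WP B (.loop e c) σ fun σ' t =>
      J b σ' ∧ t + (∑ j ∈ Finset.range j, (T j + (e.cost + 1))) ≤
        (∑ j ∈ Finset.range b, (T j + (e.cost + 1))) + (e.cost + 1) by
    simpa using H b 0 σ (by simp) h
  intro m
  induction m with
  | zero =>
    intro j σ hj hJ
    obtain rfl : j = b := by simpa using hj
    have := (test j σ le_rfl hJ).not.2 (by simp)
    exact ⟨_, _, .loop_done _ _ _ (not_not.1 this), hJ, by omega⟩
  | succ m ih =>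
    intro j σ hj hJ
    have he := (test j σ (by omega) hJ).2 (by omega)
    obtain ⟨σ', t, h₁, hJ', ht⟩ := step j σ (by omega) hJ
    obtain ⟨σ'', t', h₂, hJ'', ht'⟩ := ih (j + 1) σ' (by omega) hJ'
    refine ⟨_, _, .loop_next _ _ _ _ _ _ _ he h₁ h₂, hJ'', ?_⟩
    rw [Finset.sum_range_succ] at ht'
    omega

end WP

/-! ### Evaluation of expressions without overflow -/

section Eval

variable {B : ℕ} {σ : Store} {e f : Expr} {a b : ℕ}

theorem Expr.eval_const' (h : a < B) : (Expr.const a).eval B σ = a := Nat.mod_eq_of_lt h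

theorem Expr.eval_get' {l : ℕ} (he : e.eval B σ = a) (h : σ.arr l a = b) :
    (Expr.get l e).eval B σ = b := by
  rw [Expr.eval, he, h]

theorem Expr.eval_add' (he : e.eval B σ = a) (hf : f.eval B σ = b) (h : a + b < B) :
    (Expr.add e f).eval B σ = a + b := by
  rw [Expr.eval, he, hf, Nat.mod_eq_of_lt h]

theorem Expr.eval_mul' (he : e.eval B σ = a) (hf : f.eval B σ = b) (h : a * b < B) :
    (Expr.mul e f).eval B σ = a * b := by
  rw [Expr.eval, he, hf, Nat.mod_eq_of_lt h]

theorem Expr.eval_sub' (he : e.eval B σ = a) (hf : f.eval B σ = b) :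
    (Expr.sub e f).eval B σ = a - b := by
  rw [Expr.eval, he, hf]

theorem Expr.eval_div' (he : e.eval B σ = a) (hf : f.eval B σ = b) :
    (Expr.div e f).eval B σ = a / b := by
  rw [Expr.eval, he, hf]

theorem Expr.eval_mod' (he : e.eval B σ = a) (hf : f.eval B σ = b) :
    (Expr.mod e f).eval B σ = a % b := by
  rw [Expr.eval, he, hf]

theorem Expr.eval_lt' (hB : 1 < B) (he : e.eval B σ = a) (hf : f.eval B σ = b) :
    (Expr.lt e f).eval B σ ≠ 0 ↔ a < b := by
  rw [Expr.eval, he, hf, Nat.mod_eq_of_lt hB]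
  simp

theorem Expr.eval_eq' (hB : 1 < B) (he : e.eval B σ = a) (hf : f.eval B σ = b) :
    (Expr.eq e f).eval B σ ≠ 0 ↔ a = b := by
  rw [Expr.eval, he, hf, Nat.mod_eq_of_lt hB]
  simp

end Eval

/-! ### Bags: families of disjoint sets with insertion, deletion and enumeration -/

/-- Uniqueness of division with remainder. It separates cell addresses, edge items and set
identifiers alike, since all of them are numbers with two digits in a mixed base. -/
theorem mul_add_inj {c L j L' j' : ℕ} (hj : j < c) (hj' : j' < c)
    (h : L * c + j = L' * c + j') : L = L' ∧ j = j' := by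
  have hc : 0 < c := by omega
  have h₁ : (L * c + j) / c = L := by
    rw [mul_comm, Nat.mul_add_div hc, Nat.div_eq_of_lt hj, add_zero]
  have h₂ : (L' * c + j') / c = L' := by
    rw [mul_comm, Nat.mul_add_div hc, Nat.div_eq_of_lt hj', add_zero]
  have : L = L' := by rw [← h₁, ← h₂, h]
  subst this
  exact ⟨rfl, by omega⟩

/-- The arrays `len`, `cell`, `pos` represent disjoint sets of numbers below `c`: the members of
the set `L` are in the cells `L * c, …, L * c + len L - 1`, and `pos` is the inverse of `cell`. -/
structure IsBag (c : ℕ) (len cell pos : ℕ → ℕ) (mem : ℕ → ℕ → Prop) : Prop where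
  of_lt : ∀ {L j}, j < len L → mem L (cell (L * c + j)) ∧ pos (cell (L * c + j)) = j
  of_mem : ∀ {L x}, mem L x → pos x < len L ∧ cell (L * c + pos x) = x
  uniq : ∀ {L L' x}, mem L x → mem L' x → L = L'
  lt : ∀ {L x}, mem L x → x < c

namespace IsBag

variable {c : ℕ} {len cell pos : ℕ → ℕ} {mem : ℕ → ℕ → Prop}

/-- The cells of the block of `L` enumerate the set without repetition, because `pos` inverts
`cell`. -/
theorem len_eq_card (h : IsBag c len cell pos mem) (L : ℕ) (S : Finset ℕ)
    (hS : ∀ x, x ∈ S ↔ mem L x) : len L = S.card := by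
  have : S = (Finset.range (len L)).image fun j => cell (L * c + j) := by
    ext x
    simp only [hS, Finset.mem_image, Finset.mem_range]
    constructor
    · exact fun hx => ⟨pos x, h.of_mem hx⟩
    · rintro ⟨j, hj, rfl⟩
      exact (h.of_lt hj).1
  rw [this, Finset.card_image_of_injOn, Finset.card_range]
  intro j hj j' hj' e
  simp only [Finset.coe_range, Set.mem_Iio] at hj hj'
  rw [← (h.of_lt hj).2, ← (h.of_lt hj').2]
  exact congrArg pos e

theorem len_le_card (h : IsBag c len cell pos mem) (L : ℕ) (S : Finset ℕ)
    (hS : ∀ x, mem L x → x ∈ S) : len L ≤ S.card := by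
  classical
  rw [h.len_eq_card L (S.filter (mem L)) fun x => by
    rw [Finset.mem_filter]; exact ⟨fun hx => hx.2, fun hx => ⟨hS x hx, hx⟩⟩]
  exact Finset.card_filter_le _ _

theorem len_le (h : IsBag c len cell pos mem) (L : ℕ) : len L ≤ c := by
  simpa using h.len_le_card L (Finset.range c) fun x hx => by simpa using h.lt hx

/-- A number that is in no set leaves a free cell in every block, so an insertion cannot run into
the next block. -/
theorem len_lt (h : IsBag c len cell pos mem) (L : ℕ) {x : ℕ} (hx : x < c)
    (hn : ∀ L', ¬ mem L' x) : len L < c := by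
  have := h.len_le_card L ((Finset.range c).erase x) fun y hy => by
    simp only [Finset.mem_erase, Finset.mem_range]
    exact ⟨fun e => hn L (e ▸ hy), h.lt hy⟩
  rw [Finset.card_erase_of_mem (by simpa using hx), Finset.card_range] at this
  omega

/-- The sets are disjoint, so a single array `pos` serves all of them, and `hn` says that no set
relies on the entry that is overwritten. -/
theorem insert (h : IsBag c len cell pos mem) (L : ℕ) {x : ℕ} (hx : x < c)
    (hn : ∀ L', ¬ mem L' x) :
    IsBag c (Function.update len L (len L + 1)) (Function.update cell (L * c + len L) x)
      (Function.update pos x (len L)) (fun L' y => mem L' y ∨ (L' = L ∧ y = x)) := by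
  have hl := h.len_lt L hx hn
  constructor
  · intro L' j hj
    by_cases hL : L' = L
    · subst hL
      rw [Function.update_self] at hj
      by_cases e : j = len L'
      · subst e
        simp
      · have hj' : j < len L' := by omega
        rw [Function.update_of_ne (by omega)]
        obtain ⟨h₁, h₂⟩ := h.of_lt hj'
        refine ⟨.inl h₁, ?_⟩
        rw [Function.update_of_ne, h₂]
        intro e
        exact hn _ (e ▸ h₁)
    · rw [Function.update_of_ne hL] at hj
      have := h.len_le L'
      obtain ⟨h₁, h₂⟩ := h.of_lt hj
      rw [Function.update_of_ne fun e => hL (mul_add_inj (by omega) hl e).1]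
      refine ⟨.inl h₁, ?_⟩
      rw [Function.update_of_ne, h₂]
      intro e
      exact hn _ (e ▸ h₁)
  · rintro L' y (hy | ⟨rfl, rfl⟩)
    · obtain ⟨h₁, h₂⟩ := h.of_mem hy
      have hyx : y ≠ x := by rintro rfl; exact hn _ hy
      have := h.len_le L'
      rw [Function.update_of_ne hyx]
      by_cases hL : L' = L
      · subst hL
        rw [Function.update_self, Function.update_of_ne (by omega)]
        exact ⟨by omega, h₂⟩
      · rw [Function.update_of_ne hL,
          Function.update_of_ne fun e => hL (mul_add_inj (by omega) hl e).1]
        exact ⟨h₁, h₂⟩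
    · simp
  · rintro L₁ L₂ y (h₁ | ⟨rfl, rfl⟩) (h₂ | ⟨rfl, e⟩)
    · exact h.uniq h₁ h₂
    · exact absurd (e ▸ h₁) (hn _)
    · exact absurd h₂ (hn _)
    · rfl
  · rintro L' y (h₁ | ⟨rfl, rfl⟩)
    · exact h.lt h₁
    · exact hx

/-- The last member fills the hole. If the erased number is itself the last member, the two writes
change nothing and the shorter length hides its cell. -/
theorem erase (h : IsBag c len cell pos mem) {L x : ℕ} (hx : mem L x) :
    IsBag c (Function.update len L (len L - 1))
      (Function.update cell (L * c + pos x) (cell (L * c + (len L - 1))))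
      (Function.update pos (cell (L * c + (len L - 1))) (pos x))
      (fun L' y => mem L' y ∧ y ≠ x) := by
  obtain ⟨hp, hc⟩ := h.of_mem hx
  obtain ⟨hy, hq⟩ := h.of_lt (show len L - 1 < len L by omega)
  set y := cell (L * c + (len L - 1)) with hy_def
  have hl := h.len_le L
  constructor
  · intro L' j hj
    by_cases hL : L' = L
    · subst hL
      rw [Function.update_self] at hj
      by_cases e : j = pos x
      · subst e
        rw [Function.update_self]
        refine ⟨⟨hy, ?_⟩, Function.update_self ..⟩
        intro e
        rw [e] at hq
        omega
      · obtain ⟨h₁, h₂⟩ := h.of_lt (show j < len L' by omega)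
        rw [Function.update_of_ne (by omega)]
        refine ⟨⟨h₁, ?_⟩, ?_⟩
        · intro e'
          rw [e'] at h₂
          exact e h₂.symm
        · rw [Function.update_of_ne, h₂]
          intro e'
          rw [e', hq] at h₂
          omega
    · rw [Function.update_of_ne hL] at hj
      have := h.len_le L'
      obtain ⟨h₁, h₂⟩ := h.of_lt hj
      rw [Function.update_of_ne fun e => hL (mul_add_inj (by omega) (by omega) e).1]
      refine ⟨⟨h₁, ?_⟩, ?_⟩
      · intro e
        rw [e] at h₁
        exact hL (h.uniq h₁ hx)
      · rw [Function.update_of_ne, h₂]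
        intro e
        rw [e] at h₁
        exact hL (h.uniq h₁ hy)
  · rintro L' z ⟨hz, hzx⟩
    obtain ⟨h₁, h₂⟩ := h.of_mem hz
    have hl' := h.len_le L'
    by_cases hL : L' = L
    · subst hL
      rw [Function.update_self]
      by_cases e : z = y
      · subst e
        rw [Function.update_self]
        refine ⟨?_, Function.update_self ..⟩
        have : pos x ≠ len L' - 1 := by
          intro e
          rw [e] at hc
          exact hzx hc
        omega
      · rw [Function.update_of_ne e]
        have h₃ : pos z ≠ len L' - 1 := by
          intro e'
          rw [e'] at h₂
          exact e h₂.symm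
        have h₄ : pos z ≠ pos x := by
          intro e'
          rw [e', hc] at h₂
          exact hzx h₂.symm
        rw [Function.update_of_ne (by omega)]
        exact ⟨by omega, h₂⟩
    · have hzy : z ≠ y := by
        intro e
        rw [e] at hz
        exact hL (h.uniq hz hy)
      rw [Function.update_of_ne hL, Function.update_of_ne hzy,
        Function.update_of_ne fun e => hL (mul_add_inj (by omega) (by omega) e).1]
      exact ⟨h₁, h₂⟩
  · exact fun h₁ h₂ => h.uniq h₁.1 h₂.1
  · exact fun h₁ => h.lt h₁.1

end IsBag

/-! ### The program -/

/-- The input parameters, the word size, and the assumptions on them. -/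
structure Par where
  n : ℕ
  k : ℕ
  D : ℕ
  s : ℕ
  B : ℕ
  w : ℕ → ℕ
  W : ℕ → ℕ
  s_lt : s < n
  w_pos : ∀ i ≤ k, 1 ≤ w i
  w_le : ∀ i ≤ k, w i ≤ W i
  const_lt : 100 < B
  out_lt : n * (k + 1) * (n * n) < B
  bk_lt : n * (D + 2) * (n * n) < B
  W_lt : ∀ i ≤ k, D + 3 + W i < B
  len_lt : 3 * (n * n * (k + 1)) + 3 < B

/-- `⌈x⌉_i`, cut off at `D + 1`. -/
def Par.key (P : Par) (i x : ℕ) : ℕ :=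
  min ((x + P.W i) / (1 + (P.W i - P.w i)) * (1 + (P.W i - P.w i))) (P.D + 1)

namespace Code

/-- Memory layout: array 0 is the header of the report, 1 and 2 contain the weight bounds, 3 to 5
the lists of the report, 6 the distances, 7 the parents; 8 to 10 are the bag of the out-edges, 11 to
13 the bag of the in-edges (length, cells, positions); 14 marks the vertices on the stack, 15 is the
stack, and register 0 its height. -/
def numN : Expr := .get 0 (.const 0)
def numK : Expr := .get 0 (.const 1)
def numD : Expr := .get 0 (.const 2)
def src : Expr := .get 0 (.const 3)
-- The block size of the bags: all items are below `n * n`.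
def cap : Expr := .mul numN numN
def item (u v : Expr) : Expr := .add (.mul u numN) v
def outId (u i : Expr) : Expr := .add (.mul u (.add numK (.const 1))) i
def bkId (v y : Expr) : Expr := .add (.mul v (.add numD (.const 2))) y
def gap (i : Expr) : Expr := .add (.const 1) (.sub (.get 2 i) (.get 1 i))
def ceil (i x : Expr) : Expr := .mul (.div (.add x (.get 2 i)) (gap i)) (gap i)
-- By truncated subtraction, `c - (c - (D + 1))` is the minimum of `c` and `D + 1`.
def key (i x : Expr) : Expr :=
  .sub (ceil i x) (.sub (ceil i x) (.add numD (.const 1)))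

/-- Insertion of the number in register 4 into the set in register `r` of the bag in the arrays
`a`, `a + 1`, `a + 2`. -/
def insert (a r : ℕ) : Cmd :=
  .seq (.put (a + 2) (.reg 4) (.get a (.reg r)))
  (.seq (.put (a + 1) (.add (.mul (.reg r) cap) (.get a (.reg r))) (.reg 4))
  (.put a (.reg r) (.add (.get a (.reg r)) (.const 1))))

/-- Deletion of the number in register 4 from the set in register `r` of the bag in the arrays
`a`, `a + 1`, `a + 2`: its cell is filled with the last member. -/
def erase (a r : ℕ) : Cmd :=
  .seq (.put a (.reg r) (.sub (.get a (.reg r)) (.const 1)))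
  (.seq (.set 9 (.get (a + 1) (.add (.mul (.reg r) cap) (.get a (.reg r)))))
  (.seq (.put (a + 1) (.add (.mul (.reg r) cap) (.get (a + 2) (.reg 4))) (.reg 9))
  (.put (a + 2) (.reg 9) (.get (a + 2) (.reg 4)))))

/-- The identifier of the set of the in-edges of the vertex in register 2 on shortest paths. -/
def tight : Expr := bkId (.reg 2) (.get 6 (.reg 2))

/-- The parent of the vertex in register 2 is updated, or, if there is none, the vertex is put on
the stack. -/
def touch : Cmd :=
  .ite (.eq (.reg 2) src) .skip
  (.ite (.lt numD (.get 6 (.reg 2))) .skip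
  (.ite (.get 11 tight) (.put 7 (.reg 2) (.div (.get 12 (.mul tight cap)) numN))
  (.ite (.get 14 (.reg 2)) .skip
    (.seq (.put 15 (.reg 0) (.reg 2))
    (.seq (.set 0 (.add (.reg 0) (.const 1)))
    (.put 14 (.reg 2) (.const 1)))))))

def incr (r : ℕ) : Cmd := .set r (.add (.reg r) (.const 1))

/-- The edge with number `reg 10` from the list in array `a` is read into the registers 1, 2, 3,
and the registers 4, 5, 6 are set to its item and the sets that contain it. -/
def readEdge (a : ℕ) : Cmd :=
  .seq (.set 1 (.get a (.mul (.const 3) (.reg 10))))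
  (.seq (.set 2 (.get a (.add (.mul (.const 3) (.reg 10)) (.const 1))))
  (.seq (.set 3 (.get a (.add (.mul (.const 3) (.reg 10)) (.const 2))))
  (.seq (.set 4 (item (.reg 1) (.reg 2)))
  (.seq (.set 5 (outId (.reg 1) (.reg 3)))
  (.set 6 (bkId (.reg 2) (key (.reg 3) (.get 6 (.reg 1)))))))))

/-- Cell 4 of the header names the vertex that was split; its distance is inherited. A new vertex
has no in-edges yet, so `touch` puts it on the stack, except for the source or a distance above `D`.
-/
def newVertices : Cmd :=
  .loop (.lt (.reg 10) (.get 0 (.const 5)))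
    (.seq (.set 2 (.get 3 (.reg 10)))
    (.seq (.put 6 (.reg 2) (.get 6 (.get 0 (.const 4))))
    (.seq touch (incr 10))))

/-- The deleted edge may have been the parent edge of its head, so the head is touched. -/
def oldEdges : Cmd :=
  .loop (.lt (.reg 10) (.get 0 (.const 6)))
    (.seq (readEdge 4) (.seq (.seq (erase 8 5) (erase 11 6)) (.seq touch (incr 10))))

/-- An insertion never takes a parent away, so the head need not be touched. -/
def newEdges : Cmd :=
  .loop (.lt (.reg 10) (.get 0 (.const 7)))
    (.seq (readEdge 5) (.seq (.seq (insert 8 5) (insert 11 6)) (incr 10)))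

def update : Cmd :=
  .seq (.set 10 (.const 0)) (.seq newVertices
  (.seq (.set 10 (.const 0)) (.seq oldEdges
  (.seq (.set 10 (.const 0)) newEdges))))

/-- The item `reg 4`, which stands for an edge to `reg 2`, is moved from key `reg 8` to key
`reg 11`. -/
def move : Cmd :=
  .seq (.set 6 (bkId (.reg 2) (.reg 8)))
  (.seq (erase 11 6)
  (.seq (.set 6 (bkId (.reg 2) (.reg 11)))
  (insert 11 6)))

/-- The out-edges in the set `reg 5` are moved from key `reg 8` to key `reg 11`. -/
def scanList : Cmd :=
  .loop (.lt (.reg 10) (.get 8 (.reg 5)))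
    (.seq (.set 4 (.get 9 (.add (.mul (.reg 5) cap) (.reg 10))))
    (.seq (.set 2 (.mod (.reg 4) numN))
    (.seq move
    (.seq touch (incr 10)))))

/-- The out-edges of the vertex `reg 1` are adapted to the increase of its distance `reg 7`. -/
def scan : Cmd :=
  .loop (.lt (.reg 3) (.add numK (.const 1)))
    (.seq (.set 8 (key (.reg 3) (.reg 7)))
    (.seq (.set 11 (key (.reg 3) (.add (.reg 7) (.const 1))))
    (.seq (.ite (.eq (.reg 8) (.reg 11)) .skip
      (.seq (.set 5 (outId (.reg 1) (.reg 3))) (.seq (.set 10 (.const 0)) scanList)))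
    (incr 3))))

/-- At distance `D` no scan is needed: the out-edges already have the cut-off key `D + 1`. -/
def raise : Cmd :=
  .seq (.ite (.lt (.reg 7) numD) (.seq (.set 3 (.const 0)) scan) .skip)
  (.put 6 (.reg 1) (.add (.reg 7) (.const 1)))

/-- A popped vertex is raised by at most one. The final `touch` either finds a parent for it or puts
it back on the stack. -/
def updateDistances : Cmd :=
  .loop (.reg 0)
    (.seq (.set 0 (.sub (.reg 0) (.const 1)))
    (.seq (.set 1 (.get 15 (.reg 0)))
    (.seq (.put 14 (.reg 1) (.const 0))
    (.seq (.set 7 (.get 6 (.reg 1)))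
    (.seq (.ite (.lt numD (.reg 7)) .skip
      (.ite (.get 11 (bkId (.reg 1) (.reg 7))) .skip raise))
    (.seq (.set 2 (.reg 1)) touch))))))

end Code

/-- The data structure. -/
def program : Program := ⟨Code.update, Code.update, Code.updateDistances⟩

variable {P : Par}

/-! ### Bounds on addresses, and values of the expressions of the program -/

namespace Par

theorem n_pos (P : Par) : 0 < P.n := (Nat.zero_le _).trans_lt P.s_lt

theorem item_lt {u v : ℕ} (hu : u < P.n) (hv : v < P.n) : u * P.n + v < P.n * P.n := by
  nlinarith

/-- The product bounds the end of the block of this set, so that the addresses of all its cells are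
machine words; `bkId_lt` is the analogue for the in-edges. -/
theorem outId_lt {u i : ℕ} (hu : u < P.n) (hi : i ≤ P.k) :
    (u * (P.k + 1) + i + 1) * (P.n * P.n) < P.B :=
  (Nat.mul_le_mul_right _ (show u * (P.k + 1) + i + 1 ≤ P.n * (P.k + 1) by nlinarith)).trans_lt
    P.out_lt

theorem bkId_lt {v y : ℕ} (hv : v < P.n) (hy : y ≤ P.D + 1) :
    (v * (P.D + 2) + y + 1) * (P.n * P.n) < P.B :=
  (Nat.mul_le_mul_right _ (show v * (P.D + 2) + y + 1 ≤ P.n * (P.D + 2) by nlinarith)).trans_lt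
    P.bk_lt

theorem key_le (i x : ℕ) : P.key i x ≤ P.D + 1 := min_le_right _ _

theorem sq_lt (P : Par) : P.n * P.n < P.B := by
  have := bkId_lt (P := P) (v := 0) (y := 0) P.n_pos (Nat.zero_le _)
  simpa using this

theorem le_sq (P : Par) : P.n ≤ P.n * P.n := Nat.le_mul_self _

end Par

/-- The header of the report and the weight bounds are in the memory. -/
structure Hdr (P : Par) (σ : Store) : Prop where
  n : σ.arr 0 0 = P.n
  k : σ.arr 0 1 = P.k
  D : σ.arr 0 2 = P.D
  s : σ.arr 0 3 = P.s
  w : ∀ i ≤ P.k, σ.arr 1 i = P.w i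
  W : ∀ i ≤ P.k, σ.arr 2 i = P.W i

theorem Hdr.congr {σ σ' : Store} (h : Hdr P σ) (h' : ∀ a < 6, σ'.arr a = σ.arr a) : Hdr P σ' := by
  constructor
  · rw [h' 0 (by decide), h.n]
  · rw [h' 0 (by decide), h.k]
  · rw [h' 0 (by decide), h.D]
  · rw [h' 0 (by decide), h.s]
  · rw [h' 1 (by decide)]; exact h.w
  · rw [h' 2 (by decide)]; exact h.W

theorem Hdr.setReg {σ : Store} (h : Hdr P σ) (r x : ℕ) : Hdr P (σ.setReg r x) :=
  h.congr fun _ _ => rfl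

theorem Hdr.setArr {σ : Store} (h : Hdr P σ) {a : ℕ} (ha : 6 ≤ a) (j x : ℕ) :
    Hdr P (σ.setArr a j x) :=
  h.congr fun a' ha' => by rw [Store.arr_setArr, if_neg (by omega)]

namespace Hdr

variable {σ : Store} (h : Hdr P σ) {e f : Expr} {u v i x y : ℕ}
include h

theorem eval_numN : Code.numN.eval P.B σ = P.n :=
  Expr.eval_get' (Expr.eval_const' (by have := P.const_lt; omega)) h.n

theorem eval_numK : Code.numK.eval P.B σ = P.k :=
  Expr.eval_get' (Expr.eval_const' (by have := P.const_lt; omega)) h.k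

theorem eval_numD : Code.numD.eval P.B σ = P.D :=
  Expr.eval_get' (Expr.eval_const' (by have := P.const_lt; omega)) h.D

theorem eval_src : Code.src.eval P.B σ = P.s :=
  Expr.eval_get' (Expr.eval_const' (by have := P.const_lt; omega)) h.s

theorem eval_cap : Code.cap.eval P.B σ = P.n * P.n :=
  Expr.eval_mul' h.eval_numN h.eval_numN P.sq_lt

theorem eval_item (he : e.eval P.B σ = u) (hf : f.eval P.B σ = v) (hu : u < P.n) (hv : v < P.n) :
    (Code.item e f).eval P.B σ = u * P.n + v := by
  have := Par.item_lt hu hv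
  have := P.sq_lt
  exact Expr.eval_add' (Expr.eval_mul' he h.eval_numN (by omega)) hf (by omega)

theorem eval_outId (he : e.eval P.B σ = u) (hf : f.eval P.B σ = i) (hu : u < P.n) (hi : i ≤ P.k) :
    (Code.outId e f).eval P.B σ = u * (P.k + 1) + i := by
  have h₁ := Par.outId_lt hu hi
  have h₃ := Par.outId_lt P.n_pos (le_refl P.k)
  have h₂ : 0 < P.n * P.n := Nat.mul_pos P.n_pos P.n_pos
  have := P.const_lt
  exact Expr.eval_add' (Expr.eval_mul' he (Expr.eval_add' h.eval_numK
    (Expr.eval_const' (by omega)) (by nlinarith)) (by nlinarith)) hf (by nlinarith)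

theorem eval_bkId (he : e.eval P.B σ = v) (hf : f.eval P.B σ = y) (hv : v < P.n)
    (hy : y ≤ P.D + 1) :
    (Code.bkId e f).eval P.B σ = v * (P.D + 2) + y := by
  have h₁ := Par.bkId_lt hv hy
  have h₃ := Par.bkId_lt P.n_pos (le_refl (P.D + 1))
  have h₂ : 0 < P.n * P.n := Nat.mul_pos P.n_pos P.n_pos
  have := P.const_lt
  exact Expr.eval_add' (Expr.eval_mul' he (Expr.eval_add' h.eval_numD
    (Expr.eval_const' (by omega)) (by nlinarith)) (by nlinarith)) hf (by nlinarith)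

theorem eval_key (he : e.eval P.B σ = i) (hf : f.eval P.B σ = x) (hi : i ≤ P.k)
    (hx : x ≤ P.D + 1) : (Code.key e f).eval P.B σ = P.key i x := by
  have h₁ := P.W_lt i hi
  have h₂ := P.w_le i hi
  have h₃ := P.w_pos i hi
  have h₄ := P.const_lt
  have hW : (Expr.get 2 e).eval P.B σ = P.W i := Expr.eval_get' he (h.W i hi)
  have hg : (Code.gap e).eval P.B σ = 1 + (P.W i - P.w i) :=
    Expr.eval_add' (Expr.eval_const' (by omega))
      (Expr.eval_sub' hW (Expr.eval_get' he (h.w i hi))) (by omega)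
  have hc : (Code.ceil e f).eval P.B σ =
      (x + P.W i) / (1 + (P.W i - P.w i)) * (1 + (P.W i - P.w i)) :=
    Expr.eval_mul' (Expr.eval_div' (Expr.eval_add' hf hW (by omega)) hg) hg
      ((Nat.div_mul_le_self _ _).trans_lt (by omega))
  rw [Code.key, Expr.eval_sub' hc (Expr.eval_sub' hc (Expr.eval_add' h.eval_numD
    (Expr.eval_const' (by omega)) (by omega))), Par.key]
  omega

end Hdr

/-- The parts of the memory that the basic commands preserve: the arrays of the reports, and all
registers except for the stack pointer and the scratch register. -/
def Frame (σ σ' : Store) : Prop :=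
  (∀ r, r ≠ 0 → r ≠ 9 → σ'.reg r = σ.reg r) ∧ ∀ a < 6, σ'.arr a = σ.arr a

/-- The memory represents the bags `out` and `bk` and the stack `L`. -/
structure Core (P : Par) (out bk : ℕ → ℕ → Prop) (L : List ℕ) (σ : Store) : Prop where
  hdr : Hdr P σ
  outBag : IsBag (P.n * P.n) (σ.arr 8) (σ.arr 9) (σ.arr 10) out
  bkBag : IsBag (P.n * P.n) (σ.arr 11) (σ.arr 12) (σ.arr 13) bk
  sp : σ.reg 0 = L.length
  st : ∀ {j x}, L[j]? = some x → σ.arr 15 j = x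
  nodup : L.Nodup
  flag : ∀ v, σ.arr 14 v ≠ 0 ↔ v ∈ L
  stk_lt : ∀ v ∈ L, v < P.n
  dist_le : ∀ v, σ.arr 6 v ≤ P.D + 1

theorem Core.length_le {out bk : ℕ → ℕ → Prop} {L : List ℕ} {σ : Store} (h : Core P out bk L σ) :
    L.length ≤ P.n := by
  rw [← List.toFinset_card_of_nodup h.nodup, ← Finset.card_range P.n]
  exact Finset.card_le_card fun v hv => by simpa using h.stk_lt v (by simpa using hv)

theorem Core.congr {out bk : ℕ → ℕ → Prop} {L : List ℕ} {σ σ' : Store} (h : Core P out bk L σ)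
    (ha : σ'.arr = σ.arr) (hr : σ'.reg 0 = σ.reg 0) : Core P out bk L σ' where
  hdr := h.hdr.congr fun _ _ => by rw [ha]
  outBag := by rw [ha]; exact h.outBag
  bkBag := by rw [ha]; exact h.bkBag
  sp := by rw [hr, h.sp]
  st := by rw [ha]; exact fun e => h.st e
  nodup := h.nodup
  flag := by rw [ha]; exact h.flag
  stk_lt := h.stk_lt
  dist_le := by rw [ha]; exact h.dist_le

theorem Core.setDist {out bk : ℕ → ℕ → Prop} {L : List ℕ} {σ : Store} (h : Core P out bk L σ)
    (v : ℕ) {x : ℕ} (hx : x ≤ P.D + 1) : Core P out bk L (σ.setArr 6 v x) where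
  hdr := h.hdr.congr fun a ha => by simp; omega
  outBag := by simpa using h.outBag
  bkBag := by simpa using h.bkBag
  sp := h.sp
  st := fun e => by simpa using h.st e
  nodup := h.nodup
  flag := by simpa using h.flag
  stk_lt := h.stk_lt
  dist_le := fun v' => by
    simp only [Store.arr_setArr, if_true, Function.update_apply]
    split
    · exact hx
    · exact h.dist_le v'

/-! ### The bag operations on the machine -/

section Bag

variable {σ : Store} {mem : ℕ → ℕ → Prop} {a r l x : ℕ}

theorem WP.insert (hdr : Hdr P σ) (ha : 6 ≤ a)
    (h : IsBag (P.n * P.n) (σ.arr a) (σ.arr (a + 1)) (σ.arr (a + 2)) mem)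
    (hl : σ.reg r = l) (hx : σ.reg 4 = x) (hlB : (l + 1) * (P.n * P.n) < P.B)
    (hxn : x < P.n * P.n) (hn : ∀ L, ¬ mem L x) :
    WP P.B (Code.insert a r) σ fun σ' t =>
      IsBag (P.n * P.n) (σ'.arr a) (σ'.arr (a + 1)) (σ'.arr (a + 2))
        (fun L y => mem L y ∨ (L = l ∧ y = x)) ∧
      (∀ a', a' ≠ a → a' ≠ a + 1 → a' ≠ a + 2 → σ'.arr a' = σ.arr a') ∧
      σ'.reg = σ.reg ∧ t ≤ 30 := by
  have hlen := h.len_lt l hxn hn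
  have hB := P.const_lt
  have hlB' : l * (P.n * P.n) + P.n * P.n < P.B := by rwa [add_mul, one_mul] at hlB
  have hn0 : 0 < P.n * P.n := Nat.mul_pos P.n_pos P.n_pos
  refine .seq (.put x (σ.arr a l) hx (Expr.eval_get' hl rfl) ?_)
  refine .seq (.put (l * (P.n * P.n) + σ.arr a l) x ?_ hx ?_)
  · exact Expr.eval_add' (Expr.eval_mul' hl (hdr.setArr (by omega) _ _).eval_cap (by omega))
      (Expr.eval_get' hl (by simp)) (by omega)
  refine .put l (σ.arr a l + 1) hl (Expr.eval_add' (Expr.eval_get' hl (by simp))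
    (Expr.eval_const' (by omega)) (by omega)) ?_
  refine ⟨?_, ?_, rfl, ?_⟩
  · simpa using h.insert l hxn hn
  · intro a' h₁ h₂ h₃
    simp [h₁, h₂, h₃]
  · simp [Expr.cost, Code.cap, Code.numN]

theorem WP.erase (hdr : Hdr P σ) (ha : 6 ≤ a)
    (h : IsBag (P.n * P.n) (σ.arr a) (σ.arr (a + 1)) (σ.arr (a + 2)) mem)
    (hr : r ≠ 9) (hl : σ.reg r = l) (hx : σ.reg 4 = x) (hlB : (l + 1) * (P.n * P.n) < P.B)
    (hm : mem l x) :
    WP P.B (Code.erase a r) σ fun σ' t =>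
      IsBag (P.n * P.n) (σ'.arr a) (σ'.arr (a + 1)) (σ'.arr (a + 2))
        (fun L y => mem L y ∧ y ≠ x) ∧
      (∀ a', a' ≠ a → a' ≠ a + 1 → a' ≠ a + 2 → σ'.arr a' = σ.arr a') ∧
      (∀ r', r' ≠ 9 → σ'.reg r' = σ.reg r') ∧ t ≤ 40 := by
  have hlen := h.len_le l
  obtain ⟨hp, hc⟩ := h.of_mem hm
  have hB := P.const_lt
  have hlB' : l * (P.n * P.n) + P.n * P.n < P.B := by rwa [add_mul, one_mul] at hlB
  have hn0 : 0 < P.n * P.n := Nat.mul_pos P.n_pos P.n_pos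
  set y := σ.arr (a + 1) (l * (P.n * P.n) + (σ.arr a l - 1)) with hy
  refine .seq (.put l (σ.arr a l - 1) hl (Expr.eval_sub' (Expr.eval_get' hl rfl)
    (Expr.eval_const' (by omega))) ?_)
  have h₁ := hdr.setArr ha l (σ.arr a l - 1)
  -- The length has already been decreased, so it now addresses the last member.
  refine .seq (.set y ?_ ?_)
  · exact Expr.eval_get' (Expr.eval_add' (Expr.eval_mul' hl h₁.eval_cap (by omega))
      (Expr.eval_get' hl (by simp; rfl)) (by omega)) (by simp [hy])
  have h₂ := h₁.setReg 9 y
  have hl' : ((σ.setArr a l (σ.arr a l - 1)).setReg 9 y).reg r = l := by simp [hr, hl]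
  have hx' : ((σ.setArr a l (σ.arr a l - 1)).setReg 9 y).reg 4 = x := by simp [hx]
  refine .seq (.put (l * (P.n * P.n) + σ.arr (a + 2) x) y ?_ (by simp [Expr.eval]) ?_)
  · exact Expr.eval_add' (Expr.eval_mul' hl' h₂.eval_cap (by omega))
      (Expr.eval_get' hx' (by simp)) (by omega)
  refine .put y (σ.arr (a + 2) x) (by simp [Expr.eval])
    (Expr.eval_get' (a := x) (by simp [Expr.eval, hx]) (by simp)) ?_
  refine ⟨?_, ?_, ?_, ?_⟩
  · simpa using h.erase hm
  · intro a' h₁ h₂ h₃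
    simp [h₁, h₂, h₃]
  · intro r' hr'
    simp [hr']
  · simp [Expr.cost, Code.cap, Code.numN]

end Bag

/-! ### Bags, stack and the command `touch` in memory -/

section Core

variable {out bk : ℕ → ℕ → Prop} {L : List ℕ} {σ : Store} {l x v : ℕ}

/-- What the operations on the bags leave unchanged. -/
def BagFrame (σ σ' : Store) : Prop :=
  Frame σ σ' ∧ σ'.arr 6 = σ.arr 6 ∧ σ'.arr 7 = σ.arr 7

theorem Core.insertOut (h : Core P out bk L σ) (hl : σ.reg 5 = l) (hx : σ.reg 4 = x)
    (hlB : (l + 1) * (P.n * P.n) < P.B) (hxn : x < P.n * P.n) (hn : ∀ L, ¬ out L x) :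
    WP P.B (Code.insert 8 5) σ fun σ' t =>
      Core P (fun L y => out L y ∨ (L = l ∧ y = x)) bk L σ' ∧ BagFrame σ σ' ∧ t ≤ 30 := by
  refine (WP.insert h.hdr (by decide) h.outBag hl hx hlB hxn hn).mono ?_
  rintro σ' t ⟨h₁, h₂, h₃, ht⟩
  have h₄ : ∀ a < 6, σ'.arr a = σ.arr a := fun a ha => h₂ a (by omega) (by omega) (by omega)
  refine ⟨⟨h.hdr.congr h₄, h₁, ?_, ?_, ?_, h.nodup, ?_, h.stk_lt, ?_⟩,
    ⟨⟨fun _ _ _ => by rw [h₃], h₄⟩, h₂ 6 (by decide) (by decide) (by decide),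
      h₂ 7 (by decide) (by decide) (by decide)⟩, ht⟩
  · rw [h₂ 11 (by decide) (by decide) (by decide), h₂ 12 (by decide) (by decide) (by decide),
      h₂ 13 (by decide) (by decide) (by decide)]
    exact h.bkBag
  · rw [h₃, h.sp]
  · rw [h₂ 15 (by decide) (by decide) (by decide)]; exact fun e => h.st e
  · rw [h₂ 14 (by decide) (by decide) (by decide)]; exact h.flag
  · rw [h₂ 6 (by decide) (by decide) (by decide)]; exact h.dist_le

theorem Core.insertBk (h : Core P out bk L σ) (hl : σ.reg 6 = l) (hx : σ.reg 4 = x)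
    (hlB : (l + 1) * (P.n * P.n) < P.B) (hxn : x < P.n * P.n) (hn : ∀ L, ¬ bk L x) :
    WP P.B (Code.insert 11 6) σ fun σ' t =>
      Core P out (fun L y => bk L y ∨ (L = l ∧ y = x)) L σ' ∧ BagFrame σ σ' ∧
        σ'.arr 8 = σ.arr 8 ∧ σ'.arr 9 = σ.arr 9 ∧ σ'.arr 10 = σ.arr 10 ∧ t ≤ 30 := by
  refine (WP.insert h.hdr (by decide) h.bkBag hl hx hlB hxn hn).mono ?_
  rintro σ' t ⟨h₁, h₂, h₃, ht⟩
  have h₄ : ∀ a < 6, σ'.arr a = σ.arr a := fun a ha => h₂ a (by omega) (by omega) (by omega)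
  have h₈ := h₂ 8 (by decide) (by decide) (by decide)
  have h₉ := h₂ 9 (by decide) (by decide) (by decide)
  have h₁₀ := h₂ 10 (by decide) (by decide) (by decide)
  refine ⟨⟨h.hdr.congr h₄, ?_, h₁, ?_, ?_, h.nodup, ?_, h.stk_lt, ?_⟩,
    ⟨⟨fun _ _ _ => by rw [h₃], h₄⟩, h₂ 6 (by decide) (by decide) (by decide),
      h₂ 7 (by decide) (by decide) (by decide)⟩, h₈, h₉, h₁₀, ht⟩
  · rw [h₈, h₉, h₁₀]
    exact h.outBag
  · rw [h₃, h.sp]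
  · rw [h₂ 15 (by decide) (by decide) (by decide)]; exact fun e => h.st e
  · rw [h₂ 14 (by decide) (by decide) (by decide)]; exact h.flag
  · rw [h₂ 6 (by decide) (by decide) (by decide)]; exact h.dist_le

theorem Core.eraseOut (h : Core P out bk L σ) (hl : σ.reg 5 = l) (hx : σ.reg 4 = x)
    (hlB : (l + 1) * (P.n * P.n) < P.B) (hm : out l x) :
    WP P.B (Code.erase 8 5) σ fun σ' t =>
      Core P (fun L y => out L y ∧ y ≠ x) bk L σ' ∧ BagFrame σ σ' ∧ t ≤ 40 := by
  refine (WP.erase h.hdr (by decide) h.outBag (by decide) hl hx hlB hm).mono ?_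
  rintro σ' t ⟨h₁, h₂, h₃, ht⟩
  have h₄ : ∀ a < 6, σ'.arr a = σ.arr a := fun a ha => h₂ a (by omega) (by omega) (by omega)
  refine ⟨⟨h.hdr.congr h₄, h₁, ?_, ?_, ?_, h.nodup, ?_, h.stk_lt, ?_⟩,
    ⟨⟨fun r _ hr => h₃ r hr, h₄⟩, h₂ 6 (by decide) (by decide) (by decide),
      h₂ 7 (by decide) (by decide) (by decide)⟩, ht⟩
  · rw [h₂ 11 (by decide) (by decide) (by decide), h₂ 12 (by decide) (by decide) (by decide),
      h₂ 13 (by decide) (by decide) (by decide)]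
    exact h.bkBag
  · rw [h₃ 0 (by decide), h.sp]
  · rw [h₂ 15 (by decide) (by decide) (by decide)]; exact fun e => h.st e
  · rw [h₂ 14 (by decide) (by decide) (by decide)]; exact h.flag
  · rw [h₂ 6 (by decide) (by decide) (by decide)]; exact h.dist_le

theorem Core.eraseBk (h : Core P out bk L σ) (hl : σ.reg 6 = l) (hx : σ.reg 4 = x)
    (hlB : (l + 1) * (P.n * P.n) < P.B) (hm : bk l x) :
    WP P.B (Code.erase 11 6) σ fun σ' t =>
      Core P out (fun L y => bk L y ∧ y ≠ x) L σ' ∧ BagFrame σ σ' ∧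
        σ'.arr 8 = σ.arr 8 ∧ σ'.arr 9 = σ.arr 9 ∧ σ'.arr 10 = σ.arr 10 ∧ t ≤ 40 := by
  refine (WP.erase h.hdr (by decide) h.bkBag (by decide) hl hx hlB hm).mono ?_
  rintro σ' t ⟨h₁, h₂, h₃, ht⟩
  have h₄ : ∀ a < 6, σ'.arr a = σ.arr a := fun a ha => h₂ a (by omega) (by omega) (by omega)
  have h₈ := h₂ 8 (by decide) (by decide) (by decide)
  have h₉ := h₂ 9 (by decide) (by decide) (by decide)
  have h₁₀ := h₂ 10 (by decide) (by decide) (by decide)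
  refine ⟨⟨h.hdr.congr h₄, ?_, h₁, ?_, ?_, h.nodup, ?_, h.stk_lt, ?_⟩,
    ⟨⟨fun r _ hr => h₃ r hr, h₄⟩, h₂ 6 (by decide) (by decide) (by decide),
      h₂ 7 (by decide) (by decide) (by decide)⟩, h₈, h₉, h₁₀, ht⟩
  · rw [h₈, h₉, h₁₀]
    exact h.outBag
  · rw [h₃ 0 (by decide), h.sp]
  · rw [h₂ 15 (by decide) (by decide) (by decide)]; exact fun e => h.st e
  · rw [h₂ 14 (by decide) (by decide) (by decide)]; exact h.flag
  · rw [h₂ 6 (by decide) (by decide) (by decide)]; exact h.dist_le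

/-- The vertex `v` needs no attention: it has a parent, or it is on the stack, or it is too far
from the source. -/
def Settled (P : Par) (bk : ℕ → ℕ → Prop) (L : List ℕ) (σ : Store) (v : ℕ) : Prop :=
  v = P.s ∨ P.D < σ.arr 6 v ∨ v ∈ L ∨
    ∃ x, bk (v * (P.D + 2) + σ.arr 6 v) x ∧ σ.arr 7 v = x / P.n

/-- A push comes with its cause, the absence of a tight in-edge. The time analysis uses this to
exclude the push of a vertex that has a tight in-edge. -/
theorem Core.touch (h : Core P out bk L σ) (hv : σ.reg 2 = v) (hvn : v < P.n) :
    WP P.B Code.touch σ fun σ' t => ∃ L', Core P out bk L' σ' ∧ Frame σ σ' ∧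
      σ'.arr 6 = σ.arr 6 ∧ σ'.arr 8 = σ.arr 8 ∧ σ'.arr 9 = σ.arr 9 ∧ σ'.arr 10 = σ.arr 10 ∧
      Settled P bk L' σ' v ∧ (∀ v' ≠ v, σ'.arr 7 v' = σ.arr 7 v') ∧
      (L' = L ∨ L' = L ++ [v] ∧ v ≠ P.s ∧ σ.arr 6 v ≤ P.D ∧
        σ.arr 11 (v * (P.D + 2) + σ.arr 6 v) = 0) ∧ t ≤ 70 := by
  have hB := P.const_lt
  have hv' : (Expr.reg 2).eval P.B σ = v := hv
  have hd : (Expr.get 6 (.reg 2)).eval P.B σ = σ.arr 6 v := Expr.eval_get' hv rfl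
  have htight : Code.tight.eval P.B σ = v * (P.D + 2) + σ.arr 6 v :=
    h.hdr.eval_bkId hv' hd hvn (h.dist_le v)
  have hid := Par.bkId_lt (P := P) hvn (h.dist_le v)
  have hn0 : 0 < P.n * P.n := Nat.mul_pos P.n_pos P.n_pos
  set l := v * (P.D + 2) + σ.arr 6 v with hl_def
  refine .ite (fun he => ?_) fun he => ?_
  · rw [Expr.eval_eq' (by omega) hv' h.hdr.eval_src] at he
    refine .skip ⟨L, h, ⟨fun _ _ _ => rfl, fun _ _ => rfl⟩, rfl, rfl, rfl, rfl, .inl he,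
      fun _ _ => rfl, .inl rfl, by simp [Expr.cost, Code.src]⟩
  have hs : v ≠ P.s := by
    rwa [← not_ne_iff, Expr.eval_eq' (by omega) hv' h.hdr.eval_src] at he
  refine .ite (fun he => ?_) fun he => ?_
  · rw [Expr.eval_lt' (by omega) h.hdr.eval_numD hd] at he
    refine .skip ⟨L, h, ⟨fun _ _ _ => rfl, fun _ _ => rfl⟩, rfl, rfl, rfl, rfl, .inr (.inl he),
      fun _ _ => rfl, .inl rfl, by simp [Expr.cost, Code.src, Code.numD]⟩
  have hdD : σ.arr 6 v ≤ P.D := by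
    rwa [← not_ne_iff, Expr.eval_lt' (by omega) h.hdr.eval_numD hd, not_lt] at he
  refine .ite (fun he => ?_) fun he => ?_
  · rw [Expr.eval_get' htight rfl] at he
    -- The set of the tight in-edges is nonempty, so its cell 0 contains one of them; the quotient
    -- by `n` will be its tail.
    have hm := (h.bkBag.of_lt (Nat.pos_of_ne_zero he)).1
    refine .put v (σ.arr 12 (l * (P.n * P.n) + 0) / P.n) hv' (Expr.eval_div' (Expr.eval_get'
      (Expr.eval_mul' htight h.hdr.eval_cap (by nlinarith)) rfl) h.hdr.eval_numN) ?_
    refine ⟨L, ⟨h.hdr.setArr (by decide) _ _, by simpa using h.outBag, by simpa using h.bkBag,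
      h.sp, fun e => by simpa using h.st e, h.nodup, by simpa using h.flag, h.stk_lt,
      by simpa using h.dist_le⟩, ⟨fun _ _ _ => rfl, fun a ha => ?_⟩, by simp, by simp, by simp,
      by simp, .inr (.inr (.inr ⟨_, hm, by simp⟩)), ?_, .inl rfl, ?_⟩
    · simp; omega
    · intro v' hv'
      simp [hv']
    · simp [Expr.cost, Code.src, Code.numD, Code.tight, Code.bkId, Code.cap, Code.numN]
  rw [Expr.eval_get' htight rfl] at he
  have hempty := he
  refine .ite (fun he => ?_) fun he => ?_
  · rw [Expr.eval_get' hv' rfl, h.flag] at he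
    refine .skip ⟨L, h, ⟨fun _ _ _ => rfl, fun _ _ => rfl⟩, rfl, rfl, rfl, rfl,
      .inr (.inr (.inl he)), fun _ _ => rfl, .inl rfl, ?_⟩
    simp [Expr.cost, Code.src, Code.numD, Code.tight, Code.bkId]
  have hvL : v ∉ L := by
    rwa [← h.flag, not_ne_iff, ← Expr.eval_get' hv' rfl]
  have hlen := h.length_le
  have := P.sq_lt
  have := P.le_sq
  have hnB : P.n + 1 < P.B := by
    have := Par.outId_lt P.n_pos (Nat.zero_le P.k)
    have := P.len_lt
    nlinarith
  refine .seq (.put L.length v h.sp hv' ?_)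
  refine .seq (.set (L.length + 1) (Expr.eval_add' h.sp (Expr.eval_const' (by omega)) (by omega)) ?_)
  refine .put v 1 (by simpa [Expr.eval] using hv) (Expr.eval_const' (by omega)) ?_
  refine ⟨L ++ [v], ⟨((h.hdr.setArr (by decide) _ _).setReg _ _).setArr (by decide) _ _,
    by simpa using h.outBag, by simpa using h.bkBag, by simp, ?_, ?_, ?_, ?_,
    by simpa using h.dist_le⟩, ⟨?_, ?_⟩, by simp, by simp, by simp, by simp,
    .inr (.inr (.inl (by simp))), by simp, .inr ⟨rfl, hs, hdD, hempty⟩, ?_⟩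
  · intro j x e
    simp only [Store.arr_setArr, Store.arr_setReg, if_neg (show (15 : ℕ) ≠ 14 by decide), if_true]
    rcases lt_trichotomy j L.length with hj | rfl | hj
    · rw [List.getElem?_append_left hj] at e
      rw [Function.update_of_ne hj.ne, h.st e]
    · simpa using e
    · rw [List.getElem?_eq_none (by simp; omega)] at e
      cases e
  · exact List.nodup_append'.2 ⟨h.nodup, by simp, by simpa using hvL⟩
  · intro v'
    by_cases e : v' = v
    · subst e; simp
    · simpa [e] using h.flag v'
  · intro v' hv'
    rcases List.mem_append.1 hv' with e | e
    · exact h.stk_lt v' e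
    · obtain rfl := List.mem_singleton.1 e
      exact hvn
  · intro r h₀ _
    simp [h₀]
  · intro a ha
    simp; rw [if_neg (by omega), if_neg (by omega)]
  · simp [Expr.cost, Code.src, Code.numD, Code.tight, Code.bkId]

end Core

/-! ### The state of the data structure -/

/-- `R` is a set of edges with levels, as triples, on the vertex set `V`. -/
structure Edges (P : Par) (V : Finset ℕ) (R : Finset (ℕ × ℕ × ℕ)) : Prop where
  lt : ∀ {v}, v ∈ V → v < P.n
  fst_mem : ∀ {u v i}, (u, v, i) ∈ R → u ∈ V
  snd_mem : ∀ {u v i}, (u, v, i) ∈ R → v ∈ V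
  lev_le : ∀ {u v i}, (u, v, i) ∈ R → i ≤ P.k
  ne : ∀ {u v i}, (u, v, i) ∈ R → u ≠ v
  lev_unique : ∀ {u v i i'}, (u, v, i) ∈ R → (u, v, i') ∈ R → i = i'

theorem Edges.mono {P : Par} {V V' : Finset ℕ} {R R' : Finset (ℕ × ℕ × ℕ)} (h : Edges P V R)
    (hV : V ⊆ V') (hlt : ∀ v ∈ V', v < P.n) (hR : R' ⊆ R) : Edges P V' R' where
  lt := fun hv => hlt _ hv
  fst_mem := fun hr => hV (h.fst_mem (hR hr))
  snd_mem := fun hr => hV (h.snd_mem (hR hr))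
  lev_le := fun hr => h.lev_le (hR hr)
  ne := fun hr => h.ne (hR hr)
  lev_unique := fun hr hr' => h.lev_unique (hR hr) (hR hr')

/-- The bag of the out-edges: the set `u * (k + 1) + i` contains the items of the out-edges of `u`
of level `i`. -/
def outOf (P : Par) (R : Finset (ℕ × ℕ × ℕ)) (L x : ℕ) : Prop :=
  ∃ u v i, (u, v, i) ∈ R ∧ L = u * (P.k + 1) + i ∧ x = u * P.n + v

/-- The bag of the in-edges: the set `v * (D + 2) + y` contains the items of the in-edges of `v`
of key `y`. -/
def bkOf (P : Par) (R : Finset (ℕ × ℕ × ℕ)) (κ : ℕ → ℕ → ℕ → ℕ) (L x : ℕ) : Prop :=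
  ∃ u v i, (u, v, i) ∈ R ∧ L = v * (P.D + 2) + κ u v i ∧ x = u * P.n + v

/-- The state of the data structure for the edges `R` with keys `κ`: the vertices outside of `Z`
are settled. -/
structure State (P : Par) (V : Finset ℕ) (R : Finset (ℕ × ℕ × ℕ)) (κ : ℕ → ℕ → ℕ → ℕ)
    (Z : ℕ → Prop) (L : List ℕ) (σ : Store) : Prop where
  edges : Edges P V R
  key_le : ∀ {u v i}, (u, v, i) ∈ R → κ u v i ≤ P.D + 1
  core : Core P (outOf P R) (bkOf P R κ) L σ
  settled : ∀ v ∈ V, ¬ Z v → v ≠ P.s → σ.arr 6 v ≤ P.D →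
    v ∈ L ∨ ∃ u i, (u, v, i) ∈ R ∧ κ u v i = σ.arr 6 v ∧ σ.arr 7 v = u
  zero : ∀ v ∉ V, σ.arr 6 v = 0
  src : σ.arr 6 P.s = 0
  stk : ∀ v ∈ L, v ∈ V ∧ v ≠ P.s

/-! ### The bags of a set of edges -/

section Of

variable {P : Par} {V : Finset ℕ} {R : Finset (ℕ × ℕ × ℕ)} {κ : ℕ → ℕ → ℕ → ℕ} {u v i : ℕ}

theorem bkOf_iff (hκ : ∀ {u v i}, (u, v, i) ∈ R → κ u v i ≤ P.D + 1)
    {y x : ℕ} (hy : y ≤ P.D + 1) :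
    bkOf P R κ (v * (P.D + 2) + y) x ↔ ∃ u i, (u, v, i) ∈ R ∧ κ u v i = y ∧ x = u * P.n + v := by
  constructor
  · rintro ⟨u, v', i, hr, e, rfl⟩
    obtain ⟨rfl, rfl⟩ := mul_add_inj (by omega) (by have := hκ hr; omega) e
    exact ⟨u, i, hr, rfl, rfl⟩
  · rintro ⟨u, i, hr, rfl, rfl⟩
    exact ⟨u, v, i, hr, rfl, rfl⟩

/-- An item determines the pair of end vertices, and the pair determines the level, so items can
stand for edges. -/
theorem item_ne (h : Edges P V R) (hr : (u, v, i) ∈ R) {u' v' i' : ℕ} (hr' : (u', v', i') ∈ R)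
    (hne : (u', v', i') ≠ (u, v, i)) : u' * P.n + v' ≠ u * P.n + v := by
  intro e
  obtain ⟨rfl, rfl⟩ := mul_add_inj (h.lt (h.snd_mem hr')) (h.lt (h.snd_mem hr)) e
  exact hne (by rw [h.lev_unique hr' hr])

theorem outOf_erase (h : Edges P V R) (hr : (u, v, i) ∈ R) :
    (fun L y => outOf P R L y ∧ y ≠ u * P.n + v) = outOf P (R.erase (u, v, i)) := by
  ext L y
  constructor
  · rintro ⟨⟨u', v', i', hr', rfl, rfl⟩, hne⟩
    refine ⟨u', v', i', Finset.mem_erase.2 ⟨?_, hr'⟩, rfl, rfl⟩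
    rintro ⟨⟩
    exact hne rfl
  · rintro ⟨u', v', i', hr', rfl, rfl⟩
    obtain ⟨hne, hr'⟩ := Finset.mem_erase.1 hr'
    exact ⟨⟨u', v', i', hr', rfl, rfl⟩, item_ne h hr hr' hne⟩

theorem bkOf_erase (h : Edges P V R) (hr : (u, v, i) ∈ R) :
    (fun L y => bkOf P R κ L y ∧ y ≠ u * P.n + v) = bkOf P (R.erase (u, v, i)) κ := by
  ext L y
  constructor
  · rintro ⟨⟨u', v', i', hr', rfl, rfl⟩, hne⟩
    refine ⟨u', v', i', Finset.mem_erase.2 ⟨?_, hr'⟩, rfl, rfl⟩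
    rintro ⟨⟩
    exact hne rfl
  · rintro ⟨u', v', i', hr', rfl, rfl⟩
    obtain ⟨hne, hr'⟩ := Finset.mem_erase.1 hr'
    exact ⟨⟨u', v', i', hr', rfl, rfl⟩, item_ne h hr hr' hne⟩

theorem outOf_insert :
    (fun L y => outOf P R L y ∨ (L = u * (P.k + 1) + i ∧ y = u * P.n + v)) =
      outOf P (insert (u, v, i) R) := by
  ext L y
  constructor
  · rintro (⟨u', v', i', hr', rfl, rfl⟩ | ⟨rfl, rfl⟩)
    · exact ⟨u', v', i', Finset.mem_insert_of_mem hr', rfl, rfl⟩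
    · exact ⟨u, v, i, Finset.mem_insert_self _ _, rfl, rfl⟩
  · rintro ⟨u', v', i', hr', rfl, rfl⟩
    rcases Finset.mem_insert.1 hr' with e | hr'
    · cases e
      exact .inr ⟨rfl, rfl⟩
    · exact .inl ⟨u', v', i', hr', rfl, rfl⟩

theorem bkOf_insert :
    (fun L y => bkOf P R κ L y ∨ (L = v * (P.D + 2) + κ u v i ∧ y = u * P.n + v)) =
      bkOf P (insert (u, v, i) R) κ := by
  ext L y
  constructor
  · rintro (⟨u', v', i', hr', rfl, rfl⟩ | ⟨rfl, rfl⟩)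
    · exact ⟨u', v', i', Finset.mem_insert_of_mem hr', rfl, rfl⟩
    · exact ⟨u, v, i, Finset.mem_insert_self _ _, rfl, rfl⟩
  · rintro ⟨u', v', i', hr', rfl, rfl⟩
    rcases Finset.mem_insert.1 hr' with e | hr'
    · cases e
      exact .inr ⟨rfl, rfl⟩
    · exact .inl ⟨u', v', i', hr', rfl, rfl⟩

theorem bkOf_congr {κ' : ℕ → ℕ → ℕ → ℕ} (h : ∀ {u v i}, (u, v, i) ∈ R → κ u v i = κ' u v i) :
    bkOf P R κ = bkOf P R κ' := by
  ext L y
  constructor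
  · rintro ⟨u, v, i, hr, rfl, rfl⟩
    exact ⟨u, v, i, hr, by rw [h hr], rfl⟩
  · rintro ⟨u, v, i, hr, rfl, rfl⟩
    exact ⟨u, v, i, hr, by rw [h hr], rfl⟩

end Of

/-! ### Effect of the commands on the state -/

namespace State

variable {P : Par} {V : Finset ℕ} {R : Finset (ℕ × ℕ × ℕ)} {κ κ' : ℕ → ℕ → ℕ → ℕ}
  {Z Z' : ℕ → Prop} {L : List ℕ} {σ σ' : Store} {u v i : ℕ}

theorem congr (h : State P V R κ Z L σ) (ha : σ'.arr = σ.arr) (hr : σ'.reg 0 = σ.reg 0) :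
    State P V R κ Z L σ' where
  edges := h.edges
  key_le := h.key_le
  core := h.core.congr ha hr
  settled := by rw [ha]; exact h.settled
  zero := by rw [ha]; exact h.zero
  src := by rw [ha]; exact h.src
  stk := h.stk

theorem setReg (h : State P V R κ Z L σ) {r : ℕ} (hr : r ≠ 0) (x : ℕ) :
    State P V R κ Z L (σ.setReg r x) :=
  h.congr rfl (by simp [hr.symm])

theorem mono (h : State P V R κ Z L σ) (hZ : ∀ v, Z v → Z' v) : State P V R κ Z' L σ :=
  { h with settled := fun v hv hz => h.settled v hv fun hz' => hz (hZ v hz') }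

/-- During a scan the stored keys do not match the distances, so the keys are a parameter of the
state. Only their values on actual edges matter, which allows to change the formula that describes
them. -/
theorem congr_key (h : State P V R κ Z L σ) (hκ : ∀ {u v i}, (u, v, i) ∈ R → κ u v i = κ' u v i) :
    State P V R κ' Z L σ where
  edges := h.edges
  key_le := fun hr => hκ hr ▸ h.key_le hr
  core := bkOf_congr hκ ▸ h.core
  settled := fun v hv hz hs hd => by
    obtain h' | ⟨u, i, hr, h₁, h₂⟩ := h.settled v hv hz hs hd
    · exact .inl h'
    · exact .inr ⟨u, i, hr, hκ hr ▸ h₁, h₂⟩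
  zero := h.zero
  src := h.src
  stk := h.stk

/-- In every case `v` ends up settled, so its exemption is lifted. Other vertices keep their
parents, and the stack only grows. -/
theorem touch (h : State P V R κ Z L σ) (hv : σ.reg 2 = v) (hvV : v ∈ V) :
    WP P.B Code.touch σ fun σ' t => ∃ L', State P V R κ (fun x => Z x ∧ x ≠ v) L' σ' ∧
      Frame σ σ' ∧ σ'.arr 6 = σ.arr 6 ∧ σ'.arr 8 = σ.arr 8 ∧ σ'.arr 9 = σ.arr 9 ∧
      σ'.arr 10 = σ.arr 10 ∧ L'.length ≤ L.length + 1 ∧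
      (L' = L ∨ σ.arr 6 v ≤ P.D ∧ σ.arr 11 (v * (P.D + 2) + σ.arr 6 v) = 0) ∧ t ≤ 70 := by
  refine (h.core.touch hv (h.edges.lt hvV)).mono ?_
  rintro σ' t ⟨L', hc, hF, h₆, h₈, h₉, h₁₀, hset, h₇, hL, ht⟩
  have hsub : ∀ x ∈ L, x ∈ L' := by
    rcases hL with rfl | ⟨rfl, _⟩
    · exact fun _ h => h
    · exact fun _ h => List.mem_append_left _ h
  refine ⟨L', ⟨h.edges, h.key_le, hc, ?_, h₆ ▸ h.zero, h₆ ▸ h.src, ?_⟩, hF, h₆, h₈, h₉, h₁₀, ?_,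
    hL.imp_right fun h' => h'.2.2, ht⟩
  · intro v' hv' hz hs hd
    by_cases e : v' = v
    · subst e
      rcases hset with h' | h' | h' | ⟨x, hx, hp⟩
      · exact absurd h' hs
      · omega
      · exact .inl h'
      · rw [bkOf_iff h.key_le (by omega)] at hx
        obtain ⟨u, i, hr, hk, rfl⟩ := hx
        refine .inr ⟨u, i, hr, hk, ?_⟩
        rw [hp, mul_comm, Nat.mul_add_div P.n_pos, Nat.div_eq_of_lt (h.edges.lt hvV), add_zero]
    · rw [h₇ v' e, h₆]
      rw [h₆] at hd
      exact (h.settled v' hv' (fun hz' => hz ⟨hz', e⟩) hs hd).imp_left (hsub v')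
  · rcases hL with rfl | ⟨rfl, hs, -⟩
    · exact h.stk
    · intro x hx
      rcases List.mem_append.1 hx with hx | hx
      · exact h.stk x hx
      · obtain rfl := List.mem_singleton.1 hx
        exact ⟨hvV, hs⟩
  · rcases hL with rfl | ⟨rfl, hs, -⟩ <;> simp

/-- Only the head `v` can lose its parent edge, so `v` is the only new exemption. -/
theorem erase (h : State P V R κ Z L σ) (hr : (u, v, i) ∈ R) (h₄ : σ.reg 4 = u * P.n + v)
    (h₅ : σ.reg 5 = u * (P.k + 1) + i) (h₆ : σ.reg 6 = v * (P.D + 2) + κ u v i) :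
    WP P.B (.seq (Code.erase 8 5) (Code.erase 11 6)) σ fun σ' t =>
      State P V (R.erase (u, v, i)) κ (fun x => Z x ∨ x = v) L σ' ∧ BagFrame σ σ' ∧ t ≤ 80 := by
  have hu := h.edges.lt (h.edges.fst_mem hr)
  have hv := h.edges.lt (h.edges.snd_mem hr)
  refine .seq ((h.core.eraseOut h₅ h₄ (Par.outId_lt hu (h.edges.lev_le hr))
    ⟨u, v, i, hr, rfl, rfl⟩).mono ?_)
  rintro σ₁ t₁ ⟨c₁, ⟨F₁, d₁, p₁⟩, ht₁⟩
  refine (c₁.eraseBk (by rw [F₁.1 6 (by decide) (by decide), h₆])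
    (by rw [F₁.1 4 (by decide) (by decide), h₄]) (Par.bkId_lt hv (h.key_le hr))
    ⟨u, v, i, hr, rfl, rfl⟩).mono ?_
  rintro σ₂ t₂ ⟨c₂, ⟨F₂, d₂, p₂⟩, -, -, -, ht₂⟩
  rw [outOf_erase h.edges hr, bkOf_erase h.edges hr] at c₂
  rw [d₁] at d₂
  rw [p₁] at p₂
  refine ⟨⟨h.edges.mono subset_rfl (fun _ => h.edges.lt) (Finset.erase_subset _ _),
    fun hr' => h.key_le (Finset.mem_of_mem_erase hr'), c₂, ?_, d₂ ▸ h.zero, d₂ ▸ h.src, h.stk⟩,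
    ⟨⟨fun r h₀ h₉ => by rw [F₂.1 r h₀ h₉, F₁.1 r h₀ h₉], fun a ha => by rw [F₂.2 a ha, F₁.2 a ha]⟩,
      d₂, p₂⟩, by omega⟩
  rw [d₂, p₂]
  intro v' hv' hz hs hd
  rcases h.settled v' hv' (fun hz' => hz (.inl hz')) hs hd with h' | ⟨u', i', hr', h₁, h₂⟩
  · exact .inl h'
  · refine .inr ⟨u', i', Finset.mem_erase.2 ⟨?_, hr'⟩, h₁, h₂⟩
    rintro ⟨⟩
    exact hz (.inr rfl)

/-- Parents and stack are not changed and no edge disappears, so no exemption is added. -/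
theorem insert (h : State P V R κ Z L σ) (hE : Edges P V (insert (u, v, i) R))
    (hr : (u, v, i) ∉ R) (hκ : κ u v i ≤ P.D + 1) (h₄ : σ.reg 4 = u * P.n + v)
    (h₅ : σ.reg 5 = u * (P.k + 1) + i) (h₆ : σ.reg 6 = v * (P.D + 2) + κ u v i) :
    WP P.B (.seq (Code.insert 8 5) (Code.insert 11 6)) σ fun σ' t =>
      State P V (Insert.insert (u, v, i) R) κ Z L σ' ∧ BagFrame σ σ' ∧ t ≤ 60 := by
  have hu := h.edges.lt (hE.fst_mem (Finset.mem_insert_self _ _))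
  have hv := h.edges.lt (hE.snd_mem (Finset.mem_insert_self _ _))
  have hx : ∀ {u' v' i'}, (u', v', i') ∈ R → u * P.n + v ≠ u' * P.n + v' := by
    intro u' v' i' hr'
    refine (item_ne hE (Finset.mem_insert_self _ _) (Finset.mem_insert_of_mem hr') ?_).symm
    intro e
    exact hr (e ▸ hr')
  refine .seq ((h.core.insertOut h₅ h₄ (Par.outId_lt hu (hE.lev_le (Finset.mem_insert_self _ _)))
    (Par.item_lt hu hv) ?_).mono ?_)
  · rintro l ⟨u', v', i', hr', -, e⟩
    exact hx hr' e
  rintro σ₁ t₁ ⟨c₁, ⟨F₁, d₁, p₁⟩, ht₁⟩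
  refine (c₁.insertBk (by rw [F₁.1 6 (by decide) (by decide), h₆])
    (by rw [F₁.1 4 (by decide) (by decide), h₄]) (Par.bkId_lt hv hκ) (Par.item_lt hu hv) ?_).mono ?_
  · rintro l ⟨u', v', i', hr', -, e⟩
    exact hx hr' e
  rintro σ₂ t₂ ⟨c₂, ⟨F₂, d₂, p₂⟩, -, -, -, ht₂⟩
  rw [outOf_insert, bkOf_insert] at c₂
  rw [d₁] at d₂
  rw [p₁] at p₂
  refine ⟨⟨hE, ?_, c₂, ?_, d₂ ▸ h.zero, d₂ ▸ h.src, h.stk⟩,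
    ⟨⟨fun r h₀ h₉ => by rw [F₂.1 r h₀ h₉, F₁.1 r h₀ h₉], fun a ha => by rw [F₂.2 a ha, F₁.2 a ha]⟩,
      d₂, p₂⟩, by omega⟩
  · intro u' v' i' hr'
    rcases Finset.mem_insert.1 hr' with e | hr'
    · cases e
      exact hκ
    · exact h.key_le hr'
  rw [d₂, p₂]
  intro v' hv' hz hs hd
  rcases h.settled v' hv' hz hs hd with h' | ⟨u', i', hr', h₁, h₂⟩
  · exact .inl h'
  · exact .inr ⟨u', i', Finset.mem_insert_of_mem hr', h₁, h₂⟩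

/-- The edge keeps its place in the bag of the out-edges and changes its set in the bag of the
in-edges. Only its head can thereby lose a tight parent edge. -/
theorem move (h : State P V R κ Z L σ) (hr : (u, v, i) ∈ R)
    (hκ' : ∀ {u' v' i'}, (u', v', i') ∈ R → (u', v', i') ≠ (u, v, i) → κ' u' v' i' = κ u' v' i')
    (hκ : κ' u v i ≤ P.D + 1) (h₂ : σ.reg 2 = v) (h₄ : σ.reg 4 = u * P.n + v)
    (h₈ : σ.reg 8 = κ u v i) (h₁₁ : σ.reg 11 = κ' u v i) :
    WP P.B Code.move σ fun σ' t =>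
      State P V R κ' (fun x => Z x ∨ x = v) L σ' ∧ (∀ r, r ≠ 0 → r ≠ 6 → r ≠ 9 →
        σ'.reg r = σ.reg r) ∧ (∀ a < 6, σ'.arr a = σ.arr a) ∧ σ'.arr 6 = σ.arr 6 ∧
      σ'.arr 8 = σ.arr 8 ∧ σ'.arr 9 = σ.arr 9 ∧ σ'.arr 10 = σ.arr 10 ∧ t ≤ 110 := by
  have hu := h.edges.lt (h.edges.fst_mem hr)
  have hv := h.edges.lt (h.edges.snd_mem hr)
  refine .seq (.set _ (h.core.hdr.eval_bkId h₂ h₈ hv (h.key_le hr)) ?_)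
  refine .seq (((h.core.congr (σ' := σ.setReg 6 _) rfl (by simp)).eraseBk (by simp)
    (x := u * P.n + v) (by simp [h₄])
    (Par.bkId_lt hv (h.key_le hr)) ⟨u, v, i, hr, rfl, rfl⟩).mono ?_)
  rintro σ₁ t₁ ⟨c₁, ⟨F₁, d₁, p₁⟩, a₁, a₂, a₃, ht₁⟩
  refine .seq (.set _ (c₁.hdr.eval_bkId (v := v) (y := κ' u v i) ?_ ?_ hv hκ) ?_)
  · simpa [Expr.eval, h₂] using F₁.1 2 (by decide) (by decide)
  · simpa [Expr.eval, h₁₁] using F₁.1 11 (by decide) (by decide)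
  refine ((c₁.congr (σ' := σ₁.setReg 6 _) rfl (by simp)).insertBk (by simp)
    (x := u * P.n + v) (by simpa [h₄] using F₁.1 4 (by decide) (by decide))
    (Par.bkId_lt hv hκ) (Par.item_lt hu hv) fun _ h => h.2 rfl).mono ?_
  rintro σ₂ t₂ ⟨c₂, ⟨F₂, d₂, p₂⟩, b₁, b₂, b₃, ht₂⟩
  simp only [Store.arr_setReg] at d₁ d₂ p₁ p₂ a₁ a₂ a₃ b₁ b₂ b₃ c₂
  rw [d₁] at d₂
  rw [p₁] at p₂
  refine ⟨⟨h.edges, ?_, ?_, ?_, d₂ ▸ h.zero, d₂ ▸ h.src, h.stk⟩, ?_, ?_, d₂, by rw [b₁, a₁],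
    by rw [b₂, a₂], by rw [b₃, a₃], ?_⟩
  · intro u' v' i' hr'
    by_cases e : (u', v', i') = (u, v, i)
    · obtain ⟨rfl, rfl, rfl⟩ : u' = u ∧ v' = v ∧ i' = i := by simpa using e
      exact hκ
    · rw [hκ' hr' e]
      exact h.key_le hr'
  · convert c₂ using 1
    ext l y
    constructor
    · rintro ⟨u', v', i', hr', rfl, rfl⟩
      by_cases e : (u', v', i') = (u, v, i)
      · obtain ⟨rfl, rfl, rfl⟩ : u' = u ∧ v' = v ∧ i' = i := by simpa using e
        exact .inr ⟨rfl, rfl⟩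
      · exact .inl ⟨⟨u', v', i', hr', by rw [hκ' hr' e], rfl⟩, item_ne h.edges hr hr' e⟩
    · rintro (⟨⟨u', v', i', hr', rfl, rfl⟩, hne⟩ | ⟨rfl, rfl⟩)
      · refine ⟨u', v', i', hr', ?_, rfl⟩
        rw [hκ' hr']
        rintro ⟨⟩
        exact hne rfl
      · exact ⟨u, v, i, hr, rfl, rfl⟩
  · rw [d₂, p₂]
    intro v' hv' hz hs hd
    rcases h.settled v' hv' (fun hz' => hz (.inl hz')) hs hd with h' | ⟨u', i', hr', h₁, h₂⟩
    · exact .inl h'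
    · refine .inr ⟨u', i', hr', ?_, h₂⟩
      rw [hκ' hr', h₁]
      rintro ⟨⟩
      exact hz (.inr rfl)
  · intro r h₀ h₆ h₉
    rw [F₂.1 r h₀ h₉]
    simp only [Store.reg_setReg, if_neg h₆]
    rw [F₁.1 r h₀ h₉]
    simp only [Store.reg_setReg, if_neg h₆]
  · intro a ha
    rw [F₂.2 a ha]
    exact F₁.2 a ha
  · simp only [Code.bkId, Code.numD, Expr.cost]
    omega

end State

/-! ### The program for the updates of the multigraph -/

/-- The state between the operations. -/
def Good (P : Par) (V : Finset ℕ) (R : Finset (ℕ × ℕ × ℕ)) (L : List ℕ) (σ : Store) : Prop :=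
  State P V R (fun u _ i => P.key i (σ.arr 6 u)) (fun _ => False) L σ

/-- The cells of an array contain a list of triples. -/
def Listed (f : ℕ → ℕ) (l : List (ℕ × ℕ × ℕ)) : Prop :=
  ∀ {j r}, l[j]? = some r → f (3 * j) = r.1 ∧ f (3 * j + 1) = r.2.1 ∧ f (3 * j + 2) = r.2.2

section Update

variable {P : Par} {V V' : Finset ℕ} {R R' : Finset (ℕ × ℕ × ℕ)} {L : List ℕ} {σ : Store}
  {u v i j x y a : ℕ}

theorem Edges.length_le (h : Edges P V R) {l : List (ℕ × ℕ × ℕ)} (hl : l.Nodup)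
    (hR : ∀ r ∈ l, r ∈ R) : l.length ≤ P.n * P.n * (P.k + 1) := by
  rw [← List.toFinset_card_of_nodup hl]
  refine (Finset.card_le_card (t := Finset.range P.n ×ˢ Finset.range P.n ×ˢ Finset.range (P.k + 1))
    ?_).trans (by simp [mul_assoc])
  rintro ⟨u, v, i⟩ hr
  have hr := hR _ (List.mem_toFinset.1 hr)
  simp only [Finset.mem_product, Finset.mem_range]
  exact ⟨h.lt (h.fst_mem hr), h.lt (h.snd_mem hr), Nat.lt_succ_of_le (h.lev_le hr)⟩

theorem WP.incr {r : ℕ} (hr : σ.reg r = j) (hj : j + 1 < P.B) :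
    WP P.B (Code.incr r) σ fun σ' t => σ' = σ.setReg r (j + 1) ∧ t ≤ 4 :=
  .set _ (Expr.eval_add' hr (Expr.eval_const' (by omega)) hj)
    ⟨rfl, by simp [Expr.cost]⟩

theorem WP.readEdge (hdr : Hdr P σ) (h₁₀ : σ.reg 10 = j) (hj : 3 * j + 3 < P.B)
    (hu : σ.arr a (3 * j) = u) (hv : σ.arr a (3 * j + 1) = v) (hi : σ.arr a (3 * j + 2) = i)
    (hun : u < P.n) (hvn : v < P.n) (hik : i ≤ P.k) (hd : σ.arr 6 u ≤ P.D + 1) :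
    WP P.B (Code.readEdge a) σ fun σ' t => σ'.arr = σ.arr ∧ σ'.reg 0 = σ.reg 0 ∧ σ'.reg 10 = j ∧
      σ'.reg 2 = v ∧ σ'.reg 4 = u * P.n + v ∧ σ'.reg 5 = u * (P.k + 1) + i ∧
      σ'.reg 6 = v * (P.D + 2) + P.key i (σ.arr 6 u) ∧ t ≤ 120 := by
  have h3 : ∀ {σ' : Store}, σ'.reg 10 = j →
      (Expr.mul (.const 3) (.reg 10)).eval P.B σ' = 3 * j := fun h =>
    Expr.eval_mul' (Expr.eval_const' (by omega)) h (by omega)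
  refine .seq (.set u (Expr.eval_get' (h3 h₁₀) hu) ?_)
  refine .seq (.set v (Expr.eval_get' (Expr.eval_add' (h3 (by simpa)) (Expr.eval_const' (by omega))
    (by omega)) (by simpa)) ?_)
  refine .seq (.set i (Expr.eval_get' (Expr.eval_add' (h3 (by simpa)) (Expr.eval_const' (by omega))
    (by omega)) (by simpa)) ?_)
  have h₁ := ((hdr.setReg 1 u).setReg 2 v).setReg 3 i
  refine .seq (.set _ (h₁.eval_item (by simp [Expr.eval]) (by simp [Expr.eval]) hun hvn)
    ?_)
  have h₂ := h₁.setReg 4 (u * P.n + v)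
  refine .seq (.set _ (h₂.eval_outId (by simp [Expr.eval]) (by simp [Expr.eval]) hun hik)
    ?_)
  have h₃ := h₂.setReg 5 (u * (P.k + 1) + i)
  refine .set _ (h₃.eval_bkId (by simp [Expr.eval]) (h₃.eval_key (by simp [Expr.eval])
    (by simp [Expr.eval]) hik hd) hvn (Par.key_le _ _)) ?_
  refine ⟨rfl, by simp, by simpa, by simp, by simp, by simp, by simp, ?_⟩
  simp [Expr.cost, Code.item, Code.outId, Code.bkId, Code.key, Code.ceil, Code.gap, Code.numN,
    Code.numD, Code.numK]

theorem Good.setReg (h : Good P V R L σ) {r : ℕ} (hr : r ≠ 0) (x : ℕ) :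
    Good P V R L (σ.setReg r x) :=
  State.setReg h hr x

/-- A vertex outside of `V` has no out-edges, so writing its distance changes no key. The new vertex
itself is exempt until it is touched. The source can be new only at the initialization, with
distance 0. -/
theorem Good.addVertex (h : Good P V R L σ) (hx : x ∉ V) (hxn : x < P.n) (hy : y ≤ P.D + 1)
    (hs : x = P.s → y = 0) :
    State P (insert x V) R (fun u _ i => P.key i ((σ.setArr 6 x y).arr 6 u)) (fun v => v = x) L
      (σ.setArr 6 x y) := by
  have hd : ∀ v, v ≠ x → (σ.setArr 6 x y).arr 6 v = σ.arr 6 v := fun v hv => by simp [hv]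
  refine State.congr_key (κ := fun u _ i => P.key i (σ.arr 6 u)) ⟨?_, h.key_le,
    h.core.setDist x hy, ?_, ?_, ?_, ?_⟩ ?_
  · refine h.edges.mono (Finset.subset_insert _ _) ?_ subset_rfl
    intro v hv
    rcases Finset.mem_insert.1 hv with rfl | hv
    · exact hxn
    · exact h.edges.lt hv
  · intro v hv hvx hvs hdv
    rw [hd v hvx] at hdv ⊢
    simpa using h.settled v (Finset.mem_of_mem_insert_of_ne hv hvx) not_false hvs hdv
  · intro v hv
    rw [Finset.mem_insert, not_or] at hv
    rw [hd v hv.1, h.zero v hv.2]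
  · by_cases e : x = P.s
    · simp [e, hs e]
    · rw [hd _ (Ne.symm e), h.src]
  · exact fun v hv => ⟨Finset.mem_insert_of_mem (h.stk v hv).1, (h.stk v hv).2⟩
  · intro u v i hr
    rw [hd]
    rintro rfl
    exact hx (h.edges.fst_mem hr)

theorem Good.newVertices (h : Good P V R L σ) {l : List ℕ} (hl : l.Nodup)
    (hV : ∀ x ∈ l, x ∉ V ∧ x < P.n) (h₁₀ : σ.reg 10 = 0)
    (h₃ : ∀ {j x}, l[j]? = some x → σ.arr 3 j = x) (h₀ : σ.arr 0 5 = l.length)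
    (hs : P.s ∈ l → σ.arr 6 (σ.arr 0 4) = 0) :
    WP P.B Code.newVertices σ fun σ' t => ∃ L', Good P (V ∪ l.toFinset) R L' σ' ∧
      (∀ a < 6, σ'.arr a = σ.arr a) ∧
      (∀ v, σ'.arr 6 v = if v ∈ l then σ.arr 6 (σ.arr 0 4) else σ.arr 6 v) ∧
      L'.length ≤ L.length + l.length ∧ t ≤ 200 * (l.length + 1) := by
  have hB := P.const_lt
  set y := σ.arr 6 (σ.arr 0 4) with hy
  have hy' : y ≤ P.D + 1 := h.core.dist_le _
  have hlen : l.length ≤ P.n := by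
    rw [← List.toFinset_card_of_nodup hl, ← Finset.card_range P.n]
    exact Finset.card_le_card fun v hv => by simpa using (hV v (by simpa using hv)).2
  have hnB : P.n + 1 < P.B := by
    have := P.len_lt
    have := P.le_sq
    nlinarith
  refine (WP.for (fun j σ' => σ'.reg 10 = j ∧ ∃ L', Good P (V ∪ (l.take j).toFinset) R L' σ' ∧
      (∀ a < 6, σ'.arr a = σ.arr a) ∧
      (∀ v, σ'.arr 6 v = if v ∈ l.take j then y else σ.arr 6 v) ∧
      L'.length ≤ L.length + j) (fun _ => 120) l.length ?_ ?_ ?_).mono ?_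
  · rintro j σ' hj ⟨hr, L', hG, ha, -, -⟩
    exact Expr.eval_lt' (by omega) hr (Expr.eval_get' (Expr.eval_const' (by omega))
      (by rw [ha 0 (by decide), h₀]))
  · rintro j σ' hj ⟨hr, L', hG, ha, hd, hL⟩
    obtain ⟨x, hx⟩ : ∃ x, l[j]? = some x := ⟨_, List.getElem?_eq_getElem hj⟩
    have hxl : x ∈ l := List.mem_of_getElem? hx
    have htake : l.take (j + 1) = l.take j ++ [x] := by rw [List.take_add_one, hx]; rfl
    have hxj : x ∉ l.take j := by
      have := (List.take_sublist (j + 1) l).nodup hl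
      rw [htake, List.nodup_append'] at this
      simpa using this.2.2
    refine .seq (.set x (Expr.eval_get' hr (by rw [ha 3 (by decide), h₃ hx])) ?_)
    refine .seq (.put x y (by simp [Expr.eval]) ?_ ?_)
    · refine Expr.eval_get' (Expr.eval_get' (Expr.eval_const' (by omega)) rfl) ?_
      rw [Store.arr_setReg, ha 0 (by decide), hd]
      -- The cell may have been overwritten in an earlier round, namely at the initialization, where
      -- it belongs to vertex 0; it contains `y` in both cases.
      exact ite_eq_left_iff.2 fun _ => rfl
    have hG' := Good.addVertex (y := y) (Good.setReg hG (show (2 : ℕ) ≠ 0 by decide) x)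
      (x := x) (by simp [hxj, (hV x hxl).1]) (hV x hxl).2 hy' (fun e => hs (e ▸ hxl))
    refine .seq ((hG'.touch (by simp) (Finset.mem_insert_self _ _)).mono ?_)
    rintro σ₁ t₁ ⟨L₁, hG₁, F₁, d₁, -, -, -, hL₁, -, ht₁⟩
    refine (WP.incr (j := j) (by rw [F₁.1 10 (by decide) (by decide)]; simpa using hr) (by omega)).mono ?_
    rintro σ₂ t₂ ⟨rfl, ht₂⟩
    refine ⟨⟨by simp, L₁, ?_, ?_, ?_, by omega⟩, ?_⟩
    · have h₁ := (hG₁.setReg (show (10 : ℕ) ≠ 0 by decide) (j + 1)).mono (Z' := fun _ => False)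
        (fun v hv => hv.2 hv.1)
      have h₂ : V ∪ (l.take (j + 1)).toFinset = insert x (V ∪ (l.take j).toFinset) := by
        rw [htake]
        ext v
        simp
      rw [Good, h₂, Store.arr_setReg, d₁]
      exact h₁
    · intro a ha'
      rw [Store.arr_setReg, F₁.2 a ha', ← ha a ha']
      simp; omega
    · intro v
      rw [Store.arr_setReg, d₁, htake]
      by_cases e : v = x
      · simp [e]
      · simp [e, hd]
    · simp only [Expr.cost]
      omega
  · exact ⟨h₁₀, L, by simpa using h, fun _ _ => rfl, by simp, by simp⟩
  · rintro σ' t ⟨⟨-, L', hG, ha, hd, hL⟩, ht⟩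
    rw [List.take_length] at hG hd
    refine ⟨L', hG, ha, hd, hL, ht.trans ?_⟩
    simp only [Expr.cost, Finset.sum_const, Finset.card_range, smul_eq_mul]
    omega

theorem Good.oldEdges (h : Good P V R L σ) {l : List (ℕ × ℕ × ℕ)} (hl : l.Nodup)
    (hR : ∀ r ∈ l, r ∈ R) (h₁₀ : σ.reg 10 = 0) (h₄ : Listed (σ.arr 4) l)
    (h₀ : σ.arr 0 6 = l.length) :
    WP P.B Code.oldEdges σ fun σ' t => ∃ L', Good P V (R \ l.toFinset) L' σ' ∧
      (∀ a < 6, σ'.arr a = σ.arr a) ∧ σ'.arr 6 = σ.arr 6 ∧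
      L'.length ≤ L.length + l.length ∧ t ≤ 400 * (l.length + 1) := by
  have hB := P.const_lt
  have hlen := h.edges.length_le hl hR
  have hlB := P.len_lt
  refine (WP.for (fun j σ' => σ'.reg 10 = j ∧ ∃ L', Good P V (R \ (l.take j).toFinset) L' σ' ∧
      (∀ a < 6, σ'.arr a = σ.arr a) ∧ σ'.arr 6 = σ.arr 6 ∧
      L'.length ≤ L.length + j) (fun _ => 300) l.length ?_ ?_ ?_).mono ?_
  · rintro j σ' hj ⟨hr, L', hG, ha, -, -⟩
    exact Expr.eval_lt' (by omega) hr (Expr.eval_get' (Expr.eval_const' (by omega))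
      (by rw [ha 0 (by decide), h₀]))
  · rintro j σ' hj ⟨hr, L', hG, ha, hd, hL⟩
    obtain ⟨⟨u, v, i⟩, hx⟩ : ∃ x, l[j]? = some x := ⟨_, List.getElem?_eq_getElem hj⟩
    have hxl : (u, v, i) ∈ l := List.mem_of_getElem? hx
    have hxR := hR _ hxl
    have htake : l.take (j + 1) = l.take j ++ [(u, v, i)] := by rw [List.take_add_one, hx]; rfl
    have hxj : (u, v, i) ∉ l.take j := by
      have := (List.take_sublist (j + 1) l).nodup hl
      rw [htake, List.nodup_append'] at this
      simpa using this.2.2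
    obtain ⟨e₁, e₂, e₃⟩ := h₄ hx
    rw [← ha 4 (by decide)] at e₁ e₂ e₃
    refine .seq ((WP.readEdge hG.core.hdr hr (by omega) e₁ e₂ e₃ (h.edges.lt (h.edges.fst_mem hxR))
      (h.edges.lt (h.edges.snd_mem hxR)) (h.edges.lev_le hxR) (hG.core.dist_le _)).mono ?_)
    rintro σ₁ t₁ ⟨a₁, r₁, k₁, g₂, g₄, g₅, g₆, ht₁⟩
    refine .seq (((State.congr hG a₁ r₁).erase (Finset.mem_sdiff.2 ⟨hxR, by simpa using hxj⟩)
      g₄ g₅ g₆).mono ?_)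
    rintro σ₂ t₂ ⟨hG₂, ⟨F₂, d₂, -⟩, ht₂⟩
    refine .seq ((hG₂.touch (v := v) (by rw [F₂.1 2 (by decide) (by decide), g₂])
      (h.edges.snd_mem hxR)).mono ?_)
    rintro σ₃ t₃ ⟨L₃, hG₃, F₃, d₃, -, -, -, hL₃, -, ht₃⟩
    refine (WP.incr (j := j) (by rw [F₃.1 10 (by decide) (by decide),
      F₂.1 10 (by decide) (by decide), k₁]) (by omega)).mono ?_
    rintro σ₄ t₄ ⟨rfl, ht₄⟩
    have hd' : σ₃.arr 6 = σ'.arr 6 := by rw [d₃, d₂, a₁]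
    refine ⟨⟨by simp, L₃, ?_, ?_, ?_, by omega⟩, by omega⟩
    · have h₁ := (hG₃.setReg (show (10 : ℕ) ≠ 0 by decide) (j + 1)).mono (Z' := fun _ => False)
        (fun v hv => by simpa [hv.2] using hv.1)
      have h₂ : R \ (l.take (j + 1)).toFinset = (R \ (l.take j).toFinset).erase (u, v, i) := by
        rw [htake]
        ext v
        simp
        tauto
      rw [Good, h₂, Store.arr_setReg, hd']
      exact h₁
    · intro a ha'
      rw [Store.arr_setReg, F₃.2 a ha', F₂.2 a ha', a₁, ha a ha']
    · rw [Store.arr_setReg, hd', hd]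
  · exact ⟨h₁₀, L, by simpa using h, fun _ _ => rfl, rfl, by simp⟩
  · rintro σ' t ⟨⟨-, L', hG, ha, hd, hL⟩, ht⟩
    rw [List.take_length] at hG
    refine ⟨L', hG, ha, hd, hL, ht.trans ?_⟩
    simp only [Expr.cost, Finset.sum_const, Finset.card_range, smul_eq_mul]
    omega

theorem Good.newEdges (h : Good P V R L σ) {l : List (ℕ × ℕ × ℕ)} (hl : l.Nodup)
    (hE : Edges P V (R ∪ l.toFinset)) (hR : ∀ r ∈ l, r ∉ R) (h₁₀ : σ.reg 10 = 0)
    (h₅ : Listed (σ.arr 5) l) (h₀ : σ.arr 0 7 = l.length) :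
    WP P.B Code.newEdges σ fun σ' t => Good P V (R ∪ l.toFinset) L σ' ∧
      σ'.arr 6 = σ.arr 6 ∧ t ≤ 300 * (l.length + 1) := by
  have hB := P.const_lt
  have hlen := hE.length_le hl (by simp +contextual)
  have hlB := P.len_lt
  refine (WP.for (fun j σ' => σ'.reg 10 = j ∧ Good P V (R ∪ (l.take j).toFinset) L σ' ∧
      (∀ a < 6, σ'.arr a = σ.arr a) ∧ σ'.arr 6 = σ.arr 6) (fun _ => 200) l.length ?_ ?_ ?_).mono ?_
  · rintro j σ' hj ⟨hr, hG, ha, -⟩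
    exact Expr.eval_lt' (by omega) hr (Expr.eval_get' (Expr.eval_const' (by omega))
      (by rw [ha 0 (by decide), h₀]))
  · rintro j σ' hj ⟨hr, hG, ha, hd⟩
    obtain ⟨⟨u, v, i⟩, hx⟩ : ∃ x, l[j]? = some x := ⟨_, List.getElem?_eq_getElem hj⟩
    have hxl : (u, v, i) ∈ l := List.mem_of_getElem? hx
    have hxR : (u, v, i) ∈ R ∪ l.toFinset := by simp [hxl]
    have htake : l.take (j + 1) = l.take j ++ [(u, v, i)] := by rw [List.take_add_one, hx]; rfl
    have hxj : (u, v, i) ∉ l.take j := by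
      have := (List.take_sublist (j + 1) l).nodup hl
      rw [htake, List.nodup_append'] at this
      simpa using this.2.2
    have h₂ : R ∪ (l.take (j + 1)).toFinset = insert (u, v, i) (R ∪ (l.take j).toFinset) := by
      rw [htake]
      ext v
      simp
    obtain ⟨e₁, e₂, e₃⟩ := h₅ hx
    rw [← ha 5 (by decide)] at e₁ e₂ e₃
    refine .seq ((WP.readEdge hG.core.hdr hr (by omega) e₁ e₂ e₃ (hE.lt (hE.fst_mem hxR))
      (hE.lt (hE.snd_mem hxR)) (hE.lev_le hxR) (hG.core.dist_le _)).mono ?_)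
    rintro σ₁ t₁ ⟨a₁, r₁, k₁, g₂, g₄, g₅, g₆, ht₁⟩
    refine .seq (((State.congr hG a₁ r₁).insert ?_ ?_ (Par.key_le _ _) g₄ g₅ g₆).mono ?_)
    · refine hE.mono subset_rfl (fun _ => hE.lt) ?_
      rw [← h₂]
      intro r hr
      simp only [Finset.mem_union, List.mem_toFinset] at hr ⊢
      exact hr.imp_right List.mem_of_mem_take
    · simpa [hxj] using hR _ hxl
    rintro σ₂ t₂ ⟨hG₂, ⟨F₂, d₂, -⟩, ht₂⟩
    refine (WP.incr (j := j) (by rw [F₂.1 10 (by decide) (by decide), k₁]) (by omega)).mono ?_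
    rintro σ₄ t₄ ⟨rfl, ht₄⟩
    have hd' : σ₂.arr 6 = σ'.arr 6 := by rw [d₂, a₁]
    refine ⟨⟨by simp, ?_, ?_, ?_⟩, by omega⟩
    · rw [Good, h₂, Store.arr_setReg, hd']
      exact hG₂.setReg (show (10 : ℕ) ≠ 0 by decide) (j + 1)
    · intro a ha'
      rw [Store.arr_setReg, F₂.2 a ha', a₁, ha a ha']
    · rw [Store.arr_setReg, hd', hd]
  · exact ⟨h₁₀, by simpa using h, fun _ _ => rfl, rfl⟩
  · rintro σ' t ⟨⟨-, hG, ha, hd⟩, ht⟩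
    rw [List.take_length] at hG
    refine ⟨hG, hd, ht.trans ?_⟩
    simp only [Expr.cost, Finset.sum_const, Finset.card_range, smul_eq_mul]
    omega

/-- The program for the updates is correct. -/
theorem Good.update (h : Good P V R L σ) {new : List ℕ} {old new' : List (ℕ × ℕ × ℕ)}
    (hnew : new.Nodup) (hold : old.Nodup) (hnew' : new'.Nodup)
    (hE : Edges P V' R') (hV : ∀ x, x ∈ new ↔ x ∈ V' ∧ x ∉ V) (hVV : V ⊆ V')
    (hold' : ∀ r, r ∈ old ↔ r ∈ R ∧ r ∉ R') (hnew'' : ∀ r, r ∈ new' ↔ r ∈ R' ∧ r ∉ R)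
    (h₃ : ∀ {j x}, new[j]? = some x → σ.arr 3 j = x) (h₄ : Listed (σ.arr 4) old)
    (h₅ : Listed (σ.arr 5) new') (h₀₅ : σ.arr 0 5 = new.length) (h₀₆ : σ.arr 0 6 = old.length)
    (h₀₇ : σ.arr 0 7 = new'.length) (hs : P.s ∈ new → σ.arr 6 (σ.arr 0 4) = 0) :
    WP P.B Code.update σ fun σ' t => ∃ L', Good P V' R' L' σ' ∧
      (∀ v, σ'.arr 6 v = if v ∈ new then σ.arr 6 (σ.arr 0 4) else σ.arr 6 v) ∧
      L'.length ≤ L.length + new.length + old.length ∧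
      t ≤ 1000 + 400 * (new.length + old.length + new'.length) := by
  have hB := P.const_lt
  have hV' : V ∪ new.toFinset = V' := by
    ext v
    have := @hVV v
    simp [hV]
    tauto
  have hR' : R \ old.toFinset ∪ new'.toFinset = R' := by
    ext v
    simp [hold', hnew'']
    tauto
  refine .seq (.set 0 (Expr.eval_const' (by omega)) ?_)
  refine .seq ((Good.newVertices (Good.setReg h (show (10 : ℕ) ≠ 0 by decide) 0) hnew
    (fun x hx => ⟨((hV x).1 hx).2, hE.lt ((hV x).1 hx).1⟩) (by simp) h₃ h₀₅ hs).mono ?_)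
  rintro σ₁ t₁ ⟨L₁, h₁, a₁, d₁, hL₁, ht₁⟩
  rw [hV'] at h₁
  refine .seq (.set 0 (Expr.eval_const' (by omega)) ?_)
  refine .seq ((Good.oldEdges (Good.setReg h₁ (show (10 : ℕ) ≠ 0 by decide) 0) hold
    (fun r hr => ((hold' r).1 hr).1) (by simp) (by rw [Store.arr_setReg, a₁ 4 (by decide)]; exact h₄)
    (by rw [Store.arr_setReg, a₁ 0 (by decide)]; exact h₀₆)).mono ?_)
  rintro σ₂ t₂ ⟨L₂, h₂, a₂, d₂, hL₂, ht₂⟩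
  refine .seq (.set 0 (Expr.eval_const' (by omega)) ?_)
  refine (Good.newEdges (Good.setReg h₂ (show (10 : ℕ) ≠ 0 by decide) 0) hnew'
    (by rw [hR']; exact hE) (fun r hr hr' => ((hnew'' r).1 hr).2 (Finset.mem_sdiff.1 hr').1)
    (by simp) ?_ ?_).mono ?_
  · rw [Store.arr_setReg, a₂ 5 (by decide), Store.arr_setReg, a₁ 5 (by decide)]; exact h₅
  · rw [Store.arr_setReg, a₂ 0 (by decide), Store.arr_setReg, a₁ 0 (by decide)]; exact h₀₇
  rintro σ₃ t₃ ⟨h₃, d₃, ht₃⟩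
  rw [hR'] at h₃
  refine ⟨L₂, h₃, ?_, by omega, ?_⟩
  · intro v
    rw [d₃, Store.arr_setReg, d₂, Store.arr_setReg, d₁]
    rfl
  · simp only [Expr.cost]
    omega

end Update

/-! ### The program for `UpdateDistances` -/

/-- The edges with their cut-off keys do not lead to smaller distances. -/
def Feasible (P : Par) (R : Finset (ℕ × ℕ × ℕ)) (d : ℕ → ℕ) : Prop :=
  ∀ {u v i}, (u, v, i) ∈ R → d v ≤ P.key i (d u)

/-- The number of the edges that are scanned at the increase of a distance from `x` to `x + 1`,
for degree bounds `δ`. -/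
def Par.scanned (P : Par) (δ : ℕ → ℕ) (x i : ℕ) : ℕ :=
  if P.key i x = P.key i (x + 1) then 0 else δ i

/-- The time that is charged to the increase of a distance from `x` to `x + 1`. -/
def Par.charge (P : Par) (δ : ℕ → ℕ) (x : ℕ) : ℕ :=
  1000 + if x < P.D then ∑ i ∈ Finset.range (P.k + 1), (200 + 500 * P.scanned δ x i) else 0

/-- The time credits of a state with stack `L` and distances `d`. -/
def Par.potential (P : Par) (δ : ℕ → ℕ) (L : List ℕ) (d : ℕ → ℕ) : ℕ :=
  200 * L.length +
    ∑ v ∈ (Finset.range P.n).erase P.s, ∑ x ∈ Finset.Ico (d v) (P.D + 1), P.charge δ x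

section UpdateDistances

variable {P : Par} {V : Finset ℕ} {R : Finset (ℕ × ℕ × ℕ)} {κ : ℕ → ℕ → ℕ → ℕ} {Z : ℕ → Prop}
  {L : List ℕ} {σ : Store} {δ : ℕ → ℕ} {u v i j x y : ℕ}

/-- Positivity of the weights enters here; for `x = D` the key is forced to be `D + 1`. -/
theorem Par.lt_key (hi : i ≤ P.k) (hx : x ≤ P.D) : x < P.key i x := by
  have h₁ := P.w_pos i hi
  have h₂ := P.w_le i hi
  have h₃ := Nat.div_add_mod (x + P.W i) (1 + (P.W i - P.w i))
  have h₄ := Nat.mod_lt (x + P.W i) (show 0 < 1 + (P.W i - P.w i) by omega)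
  rw [mul_comm] at h₃
  rw [Par.key, lt_min_iff]
  omega

theorem Par.key_mono (i : ℕ) {x y : ℕ} (h : x ≤ y) : P.key i x ≤ P.key i y :=
  min_le_min_right _ (Nat.mul_le_mul_right _ (Nat.div_le_div_right (by omega)))

theorem outOf_iff (h : Edges P V R) (hi : i ≤ P.k) :
    outOf P R (u * (P.k + 1) + i) x ↔ ∃ v, (u, v, i) ∈ R ∧ x = u * P.n + v := by
  constructor
  · rintro ⟨u', v, i', hr, e, rfl⟩
    obtain ⟨rfl, rfl⟩ := mul_add_inj (by omega) (by have := h.lev_le hr; omega) e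
    exact ⟨v, hr, rfl⟩
  · rintro ⟨v, hr, rfl⟩
    exact ⟨u, v, i, hr, rfl, rfl⟩

/-- The keys of the edges when the out-edges of `u` of level below `i`, and those of level `i` at
the positions `pos` below `j`, have been adapted to the new distance `x + 1` of `u`. -/
def scanKey (P : Par) (d pos : ℕ → ℕ) (u x i j a b c : ℕ) : ℕ :=
  if a = u ∧ (c < i ∨ c = i ∧ pos (a * P.n + b) < j) then P.key c (x + 1) else P.key c (d a)

/-- The bag of the out-edges is fixed during the scan, so positions below `j` describe exactly the
edges moved so far. Each head is touched right after its move, and only `u` remains exempt. -/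
theorem State.scanList (h : State P V R (scanKey P (σ.arr 6) (σ.arr 10) u x i 0) (fun v => v = u)
    L σ) (hi : i ≤ P.k) (hx : σ.arr 6 u = x)
    (h₅ : σ.reg 5 = u * (P.k + 1) + i) (h₈ : σ.reg 8 = P.key i x)
    (h₁₁ : σ.reg 11 = P.key i (x + 1)) (h₁₀ : σ.reg 10 = 0)
    (hδ : σ.arr 8 (u * (P.k + 1) + i) ≤ δ i) :
    WP P.B Code.scanList σ fun σ' t => ∃ L',
      State P V R (scanKey P (σ.arr 6) (σ.arr 10) u x (i + 1) 0) (fun v => v = u) L' σ' ∧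
      (∀ r ∈ [1, 3, 7], σ'.reg r = σ.reg r) ∧
      (∀ a ∈ [6, 8, 10], σ'.arr a = σ.arr a) ∧ L'.length ≤ L.length + δ i ∧
      t ≤ 250 * δ i + 10 := by
  have hB := P.const_lt
  set l := u * (P.k + 1) + i with hl
  have hlen := h.core.outBag.len_le l
  have hsq := P.sq_lt
  have hmem : ∀ {j}, j < σ.arr 8 l → ∃ v, (u, v, i) ∈ R ∧
      σ.arr 9 (l * (P.n * P.n) + j) = u * P.n + v ∧ σ.arr 10 (u * P.n + v) = j := by
    intro j hj
    obtain ⟨h₁, h₂⟩ := h.core.outBag.of_lt hj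
    obtain ⟨v, hr, e⟩ := (outOf_iff h.edges hi).1 h₁
    exact ⟨v, hr, e, e ▸ h₂⟩
  refine (WP.for (fun j σ' => σ'.reg 10 = j ∧ ∃ L',
      State P V R (scanKey P (σ.arr 6) (σ.arr 10) u x i j) (fun v => v = u) L' σ' ∧
      (∀ r ∈ [1, 3, 5, 7, 8, 11], σ'.reg r = σ.reg r) ∧
      (∀ a ∈ [6, 8, 9, 10], σ'.arr a = σ.arr a) ∧ L'.length ≤ L.length + j)
      (fun _ => 240) (σ.arr 8 l) ?_ ?_ ?_).mono ?_
  · rintro j σ' hj ⟨hr, L', hS, hreg, harr, -⟩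
    refine Expr.eval_lt' (by omega) hr (Expr.eval_get' (a := l) ?_ ?_)
    · rw [Expr.eval, hreg 5 (by simp), h₅]
    · rw [harr 8 (by simp)]
  · rintro j σ' hj ⟨h₁₀', L', hS, hreg, harr, hL⟩
    obtain ⟨v, hr, hcell, hpos⟩ := hmem hj
    have hu := h.edges.lt (h.edges.fst_mem hr)
    have hv := h.edges.lt (h.edges.snd_mem hr)
    have hid := Par.outId_lt hu hi
    rw [← hl, add_mul, one_mul] at hid
    have hl5 : (Expr.reg 5).eval P.B σ' = l := by rw [Expr.eval, hreg 5 (by simp), h₅]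
    refine .seq (.set (u * P.n + v) (Expr.eval_get' (Expr.eval_add' (Expr.eval_mul' hl5
      hS.core.hdr.eval_cap (by omega)) h₁₀' (by omega)) (by rw [harr 9 (by simp), hcell])) ?_)
    refine .seq (.set v ?_ ?_)
    · rw [Expr.eval_mod' (a := u * P.n + v) (b := P.n) (by simp [Expr.eval])
        (hS.core.hdr.setReg _ _).eval_numN, Nat.mul_add_mod_self_right, Nat.mod_eq_of_lt hv]
    refine .seq ((((hS.setReg (show (4 : ℕ) ≠ 0 by decide) (u * P.n + v)).setReg
      (show (2 : ℕ) ≠ 0 by decide) v).move (κ' := scanKey P (σ.arr 6) (σ.arr 10) u x i (j + 1))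
      hr ?_ ?_ ?_ ?_ ?_ ?_).mono ?_)
    -- From `j` to `j + 1`, only the key of the item in cell `j` changes, because `cell` and `pos`
    -- are inverse to each other.
    · intro a b c hr' hne
      have hne' := item_ne h.edges hr hr' hne
      rw [scanKey, scanKey]
      refine if_congr ?_ rfl rfl
      refine and_congr_right fun ha => or_congr_right (and_congr_right fun hc => ?_)
      subst ha hc
      have hp := h.core.outBag.of_mem ⟨a, b, c, hr', rfl, rfl⟩
      constructor
      · intro hlt
        refine lt_of_le_of_ne (by omega) fun e => hne' ?_
        rw [← hp.2, e, ← hcell]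
      · exact fun hlt => by omega
    · rw [scanKey]
      split <;> exact Par.key_le _ _
    · simp
    · simp
    · rw [scanKey, if_neg (by simp [hpos]), hx]
      simpa [h₈] using hreg 8 (by simp)
    · rw [scanKey, if_pos (by simp [hpos])]
      simpa [h₁₁] using hreg 11 (by simp)
    rintro σ₁ t₁ ⟨hS₁, r₁, a₁, d₁, b₈, b₉, b₁₀, ht₁⟩
    refine .seq ((hS₁.touch (v := v) (by rw [r₁ 2 (by decide) (by decide) (by decide)]; simp)
      (h.edges.snd_mem hr)).mono ?_)
    rintro σ₂ t₂ ⟨L₂, hS₂, F₂, d₂, c₈, c₉, c₁₀, hL₂, -, ht₂⟩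
    have hreg₂ : ∀ r, r ≠ 0 → r ≠ 2 → r ≠ 4 → r ≠ 6 → r ≠ 9 → σ₂.reg r = σ'.reg r := by
      intro r e₀ e₂ e₄ e₆ e₉
      rw [F₂.1 r e₀ e₉, r₁ r e₀ e₆ e₉]
      simp [e₂, e₄]
    refine (WP.incr (j := j) (by rw [hreg₂ 10 (by decide) (by decide) (by decide) (by decide)
      (by decide), h₁₀']) (by omega)).mono ?_
    rintro σ₃ t₃ ⟨rfl, ht₃⟩
    refine ⟨⟨by simp, L₂, ?_, ?_, ?_, by omega⟩, ?_⟩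
    · refine (hS₂.mono ?_).setReg (by decide) _
      rintro v' ⟨h' | h', h''⟩
      · exact h'
      · exact absurd h' h''
    · intro r hr
      rw [← hreg r hr]
      fin_cases hr <;> simpa using hreg₂ _ (by decide) (by decide) (by decide) (by decide) (by decide)
    · intro a ha
      rw [← harr a ha]
      fin_cases ha
      · exact d₂.trans d₁
      · exact c₈.trans b₈
      · exact c₉.trans b₉
      · exact c₁₀.trans b₁₀
    · simp only [Expr.cost, Code.cap, Code.numN]
      omega
  · exact ⟨h₁₀, L, h, fun _ _ => rfl, fun _ _ => rfl, by simp⟩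
  · rintro σ' t ⟨⟨-, L', hS, hreg, harr, hL⟩, ht⟩
    refine ⟨L', hS.congr_key ?_, fun r hr => hreg r ?_, fun a ha => harr a ?_, by omega, ?_⟩
    · intro a b c hr
      rw [scanKey, scanKey]
      refine if_congr (and_congr_right fun ha => ?_) rfl rfl
      subst ha
      constructor
      · rintro (hc | ⟨rfl, -⟩) <;> exact .inl (by omega)
      · rintro (hc | ⟨-, hc⟩)
        · rcases Nat.lt_succ_iff_lt_or_eq.1 hc with hc | rfl
          · exact .inl hc
          · exact .inr ⟨rfl, (h.core.outBag.of_mem ⟨a, b, c, hr, rfl, rfl⟩).1⟩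
        · exact absurd hc (Nat.not_lt_zero _)
    · simp only [List.mem_cons, List.not_mem_nil, or_false] at hr ⊢
      tauto
    · simp only [List.mem_cons, List.not_mem_nil, or_false] at ha ⊢
      tauto
    · simp only [Expr.cost, Finset.sum_const, Finset.card_range, smul_eq_mul] at ht
      omega

/-- Levels whose key is the same at `x` and `x + 1` are skipped at constant cost. This is the saving
over an ordinary Even–Shiloach tree. -/
theorem State.scan (h : State P V R (fun u _ i => P.key i (σ.arr 6 u)) (fun v => v = u) L σ)
    (hu : u < P.n) (hx : σ.arr 6 u = x) (hxD : x ≤ P.D) (h₁ : σ.reg 1 = u) (h₃ : σ.reg 3 = 0)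
    (h₇ : σ.reg 7 = x)
    (hδ : ∀ i ≤ P.k, σ.arr 8 (u * (P.k + 1) + i) ≤ δ i) :
    WP P.B Code.scan σ fun σ' t => ∃ L',
      State P V R (fun a _ c => P.key c (if a = u then x + 1 else σ.arr 6 a)) (fun v => v = u)
        L' σ' ∧
      σ'.reg 1 = u ∧ σ'.reg 7 = x ∧ σ'.arr 6 = σ.arr 6 ∧
      200 * L'.length + t ≤ 200 * L.length +
        ∑ i ∈ Finset.range (P.k + 1), (200 + 500 * P.scanned δ x i) + 10 := by
  have hB := P.const_lt
  have hkB : P.k + 2 < P.B ∧ P.D + 3 < P.B := by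
    have h₁ := Par.outId_lt P.n_pos (le_refl P.k)
    have h₂ : 0 < P.n * P.n := Nat.mul_pos P.n_pos P.n_pos
    have := P.len_lt
    have := P.W_lt 0 (Nat.zero_le _)
    constructor
    · nlinarith
    · omega
  -- A scanned edge costs at most 300 units of time and creates at most one stack entry, which holds
  -- 200 credits; hence the 500 in `Par.charge`.
  refine (WP.for (fun j σ' => σ'.reg 3 = j ∧ ∃ L',
      State P V R (scanKey P (σ.arr 6) (σ.arr 10) u x j 0) (fun v => v = u) L' σ' ∧
      (∀ r ∈ [1, 7], σ'.reg r = σ.reg r) ∧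
      (∀ a ∈ [6, 8, 10], σ'.arr a = σ.arr a) ∧
      L'.length ≤ L.length + ∑ i ∈ Finset.range j, P.scanned δ x i)
      (fun i => 190 + 300 * P.scanned δ x i) (P.k + 1) ?_ ?_ ?_).mono ?_
  · rintro j σ' hj ⟨hr, L', hS, -, -, -⟩
    exact Expr.eval_lt' (by omega) hr (Expr.eval_add' hS.core.hdr.eval_numK
      (Expr.eval_const' (by omega)) (by omega))
  · rintro i σ' hi ⟨h₃', L', hS, hreg, harr, hL⟩
    have hi' : i ≤ P.k := by omega
    have h7 : σ'.reg 7 = x := by rw [hreg 7 (by simp), h₇]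
    refine .seq (.set _ (hS.core.hdr.eval_key h₃' h7 hi' (by omega)) ?_)
    refine .seq (.set (P.key i (x + 1)) ((hS.core.hdr.setReg _ _).eval_key (by simpa [Expr.eval])
      (Expr.eval_add' (a := x) (by simpa [Expr.eval]) (Expr.eval_const' (by omega)) (by omega))
      hi' (by omega)) ?_)
    have hS₁ := (hS.setReg (show (8 : ℕ) ≠ 0 by decide) (P.key i x)).setReg
      (show (11 : ℕ) ≠ 0 by decide) (P.key i (x + 1))
    set σ₁ := (σ'.setReg 8 (P.key i x)).setReg 11 (P.key i (x + 1)) with hσ₁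
    suffices H : WP P.B (.ite (.eq (.reg 8) (.reg 11)) .skip
        (.seq (.set 5 (Code.outId (.reg 1) (.reg 3))) (.seq (.set 10 (.const 0)) Code.scanList)))
        σ₁ fun σ₂ t => ∃ L₂,
          State P V R (scanKey P (σ.arr 6) (σ.arr 10) u x (i + 1) 0) (fun v => v = u) L₂ σ₂ ∧
          (∀ r ∈ [1, 3, 7], σ₂.reg r = σ₁.reg r) ∧
          (∀ a ∈ [6, 8, 10], σ₂.arr a = σ₁.arr a) ∧
          L₂.length ≤ L'.length + P.scanned δ x i ∧ t ≤ 50 + 250 * P.scanned δ x i by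
      refine .seq (H.mono ?_)
      rintro σ₂ t₂ ⟨L₂, hS₂, hreg₂, harr₂, hL₂, ht₂⟩
      refine (WP.incr (j := i) (by rw [hreg₂ 3 (by simp)]; simpa [hσ₁] using h₃')
        (by omega)).mono ?_
      rintro σ₃ t₃ ⟨rfl, ht₃⟩
      refine ⟨⟨by simp, L₂, hS₂.setReg (by decide) _, ?_, ?_, ?_⟩, ?_⟩
      · intro r hr
        rw [← hreg r hr]
        fin_cases hr
        · simpa [hσ₁] using hreg₂ 1 (by simp)
        · simpa [hσ₁] using hreg₂ 7 (by simp)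
      · intro a ha
        rw [← harr a ha]
        exact harr₂ a ha
      · rw [Finset.sum_range_succ]
        omega
      · simp only [Expr.cost, Code.key, Code.ceil, Code.gap, Code.numD]
        omega
    have e₈ : σ₁.reg 8 = P.key i x := by simp [hσ₁]
    have e₁₁ : σ₁.reg 11 = P.key i (x + 1) := by simp [hσ₁]
    have e₃ : σ₁.reg 3 = i := by simpa [hσ₁] using h₃'
    have e₁ : σ₁.reg 1 = u := by simpa [hσ₁, h₁] using hreg 1 (by simp)
    have earr : ∀ a ∈ [6, 8, 10], σ₁.arr a = σ.arr a := harr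
    clear_value σ₁
    have he' : (Expr.eq (.reg 8) (.reg 11)).eval P.B σ₁ ≠ 0 ↔ P.key i x = P.key i (x + 1) :=
      Expr.eval_eq' (by omega) e₈ e₁₁
    refine .ite (fun he => ?_) fun he => ?_
    · rw [he'] at he
      refine .skip ⟨L', hS₁.congr_key ?_, fun _ _ => rfl, fun _ _ => rfl, by omega, ?_⟩
      · intro a b c hr
        rw [scanKey, scanKey]
        by_cases hc : a = u ∧ c = i
        · obtain ⟨rfl, rfl⟩ := hc
          rw [if_neg (by simp), if_pos (by simp), hx, he]
        · refine if_congr (and_congr_right fun ha => ?_) rfl rfl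
          have : c ≠ i := fun e => hc ⟨ha, e⟩
          omega
      · simp only [Expr.cost]
        omega
    · have hne : P.key i x ≠ P.key i (x + 1) := by
        rwa [← not_ne_iff, he'] at he
      rw [Par.scanned, if_neg hne]
      refine .seq (.set _ (hS₁.core.hdr.eval_outId e₁ e₃ hu hi') ?_)
      refine .seq (.set 0 (Expr.eval_const' (by omega)) ?_)
      rw [← earr 6 (by simp), ← earr 10 (by simp)] at hS₁ ⊢
      refine (State.scanList (δ := δ) ((hS₁.setReg (show (5 : ℕ) ≠ 0 by decide) _).setReg
        (show (10 : ℕ) ≠ 0 by decide) 0) hi' (by simpa [earr 6 (by simp)] using hx) (by simp)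
        (by simpa using e₈) (by simpa using e₁₁) (by simp)
        (by simpa [earr 8 (by simp)] using hδ i hi')).mono ?_
      rintro σ₂ t₂ ⟨L₂, hS₂, hreg₂, harr₂, hL₂, ht₂⟩
      refine ⟨L₂, hS₂, ?_, harr₂, hL₂, ?_⟩
      · intro r hr
        rw [hreg₂ r hr]
        fin_cases hr <;> simp
      · simp only [Expr.cost, Code.outId, Code.numK]
        omega
  · refine ⟨h₃, L, h.congr_key ?_, fun _ _ => rfl, fun _ _ => rfl, by simp⟩
    intro a b c hr
    simp [scanKey]
  · rintro σ' t ⟨⟨-, L', hS, hreg, harr, hL⟩, ht⟩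
    refine ⟨L', hS.congr_key ?_, by rw [hreg 1 (by simp), h₁], by rw [hreg 7 (by simp), h₇],
      harr 6 (by simp), ?_⟩
    · intro a b c hr
      have := h.edges.lev_le hr
      rw [scanKey]
      split_ifs <;> first | rfl | omega
    · simp only [Expr.cost, Finset.sum_add_distrib, ← Finset.mul_sum, Finset.sum_const,
        Finset.card_range, smul_eq_mul, Code.numK] at ht ⊢
      omega

theorem State.setDist (h : State P V R κ (fun v => v = u) L σ) (hu : u ∈ V) (hs : u ≠ P.s)
    (hy : y ≤ P.D + 1) : State P V R κ (fun v => v = u) L (σ.setArr 6 u y) where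
  edges := h.edges
  key_le := h.key_le
  core := h.core.setDist u hy
  settled := fun v hv hz hvs => by
    simpa [Function.update_of_ne hz] using h.settled v hv hz hvs
  zero := fun v hv => by
    have : v ≠ u := by rintro rfl; exact hv hu
    simpa [this] using h.zero v hv
  src := by simpa [hs.symm] using h.src
  stk := h.stk

/-- The keys are moved first and the distance is written afterwards, while `u` is exempt. The 900
credits that are left pay for the rest of the round, including a push of `u`. -/
theorem State.raise (h : State P V R (fun u _ i => P.key i (σ.arr 6 u)) (fun v => v = u) L σ)
    (hu : u ∈ V) (hs : u ≠ P.s) (hx : σ.arr 6 u = x) (hxD : x ≤ P.D) (h₁ : σ.reg 1 = u)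
    (h₇ : σ.reg 7 = x) (hδ : ∀ i ≤ P.k, σ.arr 8 (u * (P.k + 1) + i) ≤ δ i) :
    WP P.B Code.raise σ fun σ' t => ∃ L',
      State P V R (fun u _ i => P.key i (σ'.arr 6 u)) (fun v => v = u) L' σ' ∧
      σ'.reg 1 = u ∧ σ'.arr 6 = Function.update (σ.arr 6) u (x + 1) ∧
      200 * L'.length + t + 900 ≤ 200 * L.length + P.charge δ x := by
  have hB := P.const_lt
  have hDB : P.D + 3 < P.B := by
    have := P.W_lt 0 (Nat.zero_le _)
    omega
  have hun := h.edges.lt hu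
  have htest : (Expr.lt (.reg 7) Code.numD).eval P.B σ ≠ 0 ↔ x < P.D :=
    Expr.eval_lt' (by omega) h₇ h.core.hdr.eval_numD
  suffices H : WP P.B (.ite (.lt (.reg 7) Code.numD) (.seq (.set 3 (.const 0)) Code.scan) .skip)
      σ fun σ₁ t => ∃ L',
        State P V R (fun a _ c => P.key c (if a = u then x + 1 else σ.arr 6 a)) (fun v => v = u)
          L' σ₁ ∧
        σ₁.reg 1 = u ∧ σ₁.reg 7 = x ∧ σ₁.arr 6 = σ.arr 6 ∧
        200 * L'.length + t + 920 ≤ 200 * L.length + P.charge δ x by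
    refine .seq (H.mono ?_)
    rintro σ₁ t₁ ⟨L', hS, e₁, e₇, hd, ht⟩
    refine .put u (x + 1) e₁ (Expr.eval_add' e₇ (Expr.eval_const' (by omega)) (by omega)) ?_
    have hd' : (σ₁.setArr 6 u (x + 1)).arr 6 = Function.update (σ.arr 6) u (x + 1) := by
      simp [hd]
    refine ⟨L', (hS.setDist hu hs (by omega)).congr_key ?_, e₁, hd', ?_⟩
    · intro a b c hr
      rw [hd', Function.update_apply]
    · simp only [Expr.cost]
      omega
  refine .ite (fun he => ?_) fun he => ?_
  · rw [htest] at he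
    refine .seq (.set 0 (Expr.eval_const' (by omega)) ?_)
    refine (State.scan (σ := σ.setReg 3 0) (δ := δ) (h.setReg (show (3 : ℕ) ≠ 0 by decide) 0) hun hx hxD
      (by simpa using h₁) (by simp) (by simpa using h₇) hδ).mono ?_
    rintro σ₁ t₁ ⟨L', hS, e₁, e₇, hd, ht⟩
    refine ⟨L', hS, e₁, e₇, hd, ?_⟩
    rw [Par.charge, if_pos he]
    simp only [Expr.cost, Code.numD]
    omega
  · have hxD' : x = P.D := by
      have := htest.not.1 (not_not.2 he)
      omega
    refine .skip ⟨L, h.congr_key ?_, h₁, h₇, rfl, ?_⟩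
    · intro a b c hr
      by_cases ha : a = u
      · subst ha
        have h₁ := Par.lt_key (h.edges.lev_le hr) hxD
        have h₂ := Par.key_mono (P := P) c (Nat.le_add_right x 1)
        have h₃ := Par.key_le (P := P) c (x + 1)
        rw [if_pos rfl, hx]
        omega
      · rw [if_neg ha]
    · rw [Par.charge, if_neg (by omega)]
      simp only [Expr.cost, Code.numD]
      omega

/-- Keys of in-edges of `u` are at least `x` by feasibility and differ from `x`, so they are at
least `x + 1`. Keys of out-edges can only grow. As there are no self-loops, no edge is of both
kinds. -/
theorem Feasible.update {d : ℕ → ℕ} (h : Feasible P R d) (hE : Edges P V R) (hx : d u = x)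
    (hu : ∀ {v i}, (v, u, i) ∈ R → P.key i (d v) ≠ x) :
    Feasible P R (Function.update d u (x + 1)) := by
  intro a b c hr
  have hab := hE.ne hr
  have h₁ := h hr
  rw [Function.update_apply, Function.update_apply]
  by_cases hb : b = u
  · subst hb
    have := hu hr
    rw [if_pos rfl, if_neg hab]
    omega
  · rw [if_neg hb]
    split_ifs with ha
    · subst ha
      rw [hx] at h₁
      exact h₁.trans (Par.key_mono _ (Nat.le_add_right x 1))
    · exact h₁

theorem Par.potential_update {d : ℕ → ℕ} (hu : u < P.n) (hs : u ≠ P.s) (hx : d u = x)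
    (hxD : x ≤ P.D) :
    P.potential δ L (Function.update d u (x + 1)) + P.charge δ x = P.potential δ L d := by
  have hm : u ∈ (Finset.range P.n).erase P.s := by simp [hs, hu]
  rw [potential, potential, ← Finset.add_sum_erase _ _ hm, ← Finset.add_sum_erase _ _ hm,
    Function.update_self, hx, Finset.sum_eq_sum_Ico_succ_bot (show x < P.D + 1 by omega)]
  have : ∑ v ∈ ((Finset.range P.n).erase P.s).erase u,
      ∑ y ∈ Finset.Ico (Function.update d u (x + 1) v) (P.D + 1), P.charge δ y =
      ∑ v ∈ ((Finset.range P.n).erase P.s).erase u,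
      ∑ y ∈ Finset.Ico (d v) (P.D + 1), P.charge δ y := by
    refine Finset.sum_congr rfl fun v hv => ?_
    rw [Function.update_of_ne (Finset.ne_of_mem_erase hv)]
  rw [this]
  omega

/-- The program for `UpdateDistances` is correct. -/
theorem Good.updateDistances (h : Good P V R L σ) (hf : Feasible P R (σ.arr 6))
    (hδ : ∀ u ∈ V, ∀ i ≤ P.k, (R.filter fun r => r.1 = u ∧ r.2.2 = i).card ≤ δ i) :
    WP P.B Code.updateDistances σ fun σ' t => Good P V R [] σ' ∧ Feasible P R (σ'.arr 6) ∧
      P.potential δ [] (σ'.arr 6) + t ≤ P.potential δ L (σ.arr 6) + 2 := by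
  have hB := P.const_lt
  have hlen : ∀ {κ Z L σ}, State P V R κ Z L σ → ∀ u ∈ V, ∀ i ≤ P.k,
      σ.arr 8 (u * (P.k + 1) + i) ≤ δ i := by
    intro κ Z L σ h u hu i hi
    refine (h.core.outBag.len_le_card (u * (P.k + 1) + i)
      ((R.filter fun r => r.1 = u ∧ r.2.2 = i).image fun r => r.1 * P.n + r.2.1) ?_).trans
      (Finset.card_image_le.trans (hδ u hu i hi))
    intro x hx
    obtain ⟨v, hr, rfl⟩ := (outOf_iff h.edges hi).1 hx
    exact Finset.mem_image.2 ⟨(u, v, i), by simpa using hr, rfl⟩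
  -- The credits of the loop are the potential of the memory.
  refine (WP.loop (fun m σ => ∃ L, Good P V R L σ ∧ Feasible P R (σ.arr 6) ∧
    P.potential δ L (σ.arr 6) = m) ?_ ⟨L, h, hf, rfl⟩).mono ?_
  · rintro m σ ⟨L, h, hf, rfl⟩ he
    obtain rfl | ⟨L, u, rfl⟩ := L.eq_nil_or_concat'
    · exact absurd h.core.sp he
    obtain ⟨huV, hus⟩ := h.stk u (by simp)
    have hun := h.edges.lt huV
    have hnd := List.nodup_append'.1 h.core.nodup
    have huL : u ∉ L := by simpa using hnd.2.2
    have hsp : (Expr.reg 0).eval P.B σ = L.length + 1 := by simpa [Expr.eval] using h.core.sp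
    set x := σ.arr 6 u with hx
    refine .seq (.set L.length ?_ ?_)
    · rw [Expr.eval_sub' hsp (b := 1) (Expr.eval_const' (by omega))]
      rfl
    refine .seq (.set u (Expr.eval_get' (a := L.length) (by simp [Expr.eval])
      (h.core.st (by simp))) ?_)
    refine .seq (.put u 0 (by simp [Expr.eval]) (Expr.eval_const' (by omega)) ?_)
    refine .seq (.set x (Expr.eval_get' (a := u) (by simp [Expr.eval]) (by simp [hx])) ?_)
    set σ₁ := (((σ.setReg 0 L.length).setReg 1 u).setArr 14 u 0).setReg 7 x with hσ₁
    have e₁ : σ₁.reg 1 = u := by simp [hσ₁]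
    have e₇ : σ₁.reg 7 = x := by simp [hσ₁]
    have hd₁ : σ₁.arr 6 = σ.arr 6 := by simp [hσ₁]
    have hS₁ : State P V R (fun u _ i => P.key i (σ₁.arr 6 u)) (fun v => v = u) L σ₁ := by
      rw [hd₁]
      refine ⟨h.edges, h.key_le, ⟨h.core.hdr.congr fun a ha => ?_, by simpa [hσ₁] using h.core.outBag,
        by simpa [hσ₁] using h.core.bkBag, by simp [hσ₁], fun {j y} e => ?_, hnd.1, fun v => ?_,
        fun v hv => h.core.stk_lt v (by simp [hv]), by simpa [hσ₁] using h.core.dist_le⟩,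
        fun v hv hvu hvs hvD => ?_, by simpa [hσ₁] using h.zero, by simpa [hσ₁] using h.src,
        fun v hv => h.stk v (by simp [hv])⟩
      · simp [hσ₁]; omega
      · have : (L ++ [u])[j]? = some y := by
          rw [List.getElem?_append_left, e]
          exact (List.getElem?_eq_some_iff.1 e).1
        simpa [hσ₁] using h.core.st this
      · by_cases e : v = u
        · subst e
          simp [hσ₁, huL]
        · simpa [hσ₁, e] using h.core.flag v
      · rw [hd₁] at hvD ⊢
        simpa [hσ₁, hvu] using h.settled v hv not_false hvs hvD
    clear_value σ₁
    have hx₁ : σ₁.arr 6 u = x := by rw [hd₁]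
    have hxD := hS₁.core.dist_le u
    rw [hx₁] at hxD
    have hid : (Code.bkId (.reg 1) (.reg 7)).eval P.B σ₁ = u * (P.D + 2) + x :=
      hS₁.core.hdr.eval_bkId e₁ e₇ hun hxD
    have htest : (Expr.lt Code.numD (.reg 7)).eval P.B σ₁ ≠ 0 ↔ P.D < x :=
      Expr.eval_lt' (by omega) hS₁.core.hdr.eval_numD e₇
    -- Either `u` is raised, and the charge leaves 800 credits for a new push; or `u` is too far
    -- away or has a tight in-edge, and then the final `touch` does not push and the 200 credits of
    -- the popped entry pay for the round.
    suffices H : WP P.B (.ite (.lt Code.numD (.reg 7)) .skip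
        (.ite (.get 11 (Code.bkId (.reg 1) (.reg 7))) .skip Code.raise)) σ₁ fun σ₂ t => ∃ L₂,
          State P V R (fun u _ i => P.key i (σ₂.arr 6 u)) (fun v => v = u) L₂ σ₂ ∧
          Feasible P R (σ₂.arr 6) ∧ σ₂.reg 1 = u ∧
          ((P.potential δ L₂ (σ₂.arr 6) + t + 800 ≤ P.potential δ L (σ.arr 6)) ∨
            (P.D < σ₂.arr 6 u ∨ σ₂.arr 11 (u * (P.D + 2) + σ₂.arr 6 u) ≠ 0) ∧
            (P.potential δ L₂ (σ₂.arr 6) + t ≤ P.potential δ L (σ.arr 6) + 50)) by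
      refine .seq (H.mono ?_)
      rintro σ₂ t₂ ⟨L₂, hS₂, hf₂, g₁, hpot⟩
      refine .seq (.set u g₁ ?_)
      refine ((hS₂.setReg (show (2 : ℕ) ≠ 0 by decide) u).touch (v := u) (by simp) huV).mono ?_
      rintro σ₃ t₃ ⟨L₃, hS₃, F₃, hd₃, -, -, -, hL₃, hL₃', ht₃⟩
      rw [Store.arr_setReg] at hd₃
      refine ⟨_, ?_, L₃, ?_, by rwa [hd₃], rfl⟩
      · have e : ∀ l : List ℕ, P.potential δ l (σ₂.arr 6) =
            P.potential δ [] (σ₂.arr 6) + 200 * l.length := by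
          intro l
          simp [Par.potential]
          omega
        have e' : P.potential δ (L ++ [u]) (σ.arr 6) = P.potential δ L (σ.arr 6) + 200 := by
          simp [Par.potential]
          omega
        rw [hd₃, e', e L₃]
        rw [e L₂] at hpot
        simp only [Expr.cost]
        rcases hpot with hpot | ⟨hu, hpot⟩
        · omega
        · have : L₃ = L₂ := by
            refine hL₃'.resolve_right ?_
            rintro ⟨h₁, h₂⟩
            rcases hu with hu | hu
            · exact absurd h₁ (not_le.2 hu)
            · exact hu h₂
          rw [this]
          omega
      · rw [Good, hd₃]
        exact hS₃.mono fun v hv => hv.2 hv.1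
    refine .ite (fun he => ?_) fun he => ?_
    · rw [htest] at he
      refine .skip ⟨L, hS₁, by rwa [hd₁], e₁, .inr ⟨.inl (hx₁ ▸ he), ?_⟩⟩
      rw [hd₁]
      simp [Expr.cost, Code.numD]
    have hxD' : x ≤ P.D := by
      have := htest.not.1 (not_not.2 he)
      omega
    refine .ite (fun he => ?_) fun he => ?_
    · rw [Expr.eval_get' hid rfl] at he
      refine .skip ⟨L, hS₁, by rwa [hd₁], e₁, .inr ⟨.inr (hx₁ ▸ he), ?_⟩⟩
      rw [hd₁]
      simp [Expr.cost, Code.numD, Code.bkId]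
    rw [Expr.eval_get' hid rfl] at he
    refine (State.raise (δ := δ) hS₁ huV hus hx₁ hxD' e₁ e₇ (hlen hS₁ u huV)).mono ?_
    rintro σ₂ t₂ ⟨L₂, hS₂, g₁, hd₂, ht₂⟩
    refine ⟨L₂, hS₂, ?_, g₁, .inl ?_⟩
    · rw [hd₂, hd₁]
      -- The test found the set of the in-edges with key `x` empty.
      refine hf.update h.edges rfl ?_
      intro v i hr hk
      have := (hS₁.core.bkBag.of_mem ((bkOf_iff hS₁.key_le hxD).2 ⟨v, i, hr, by rw [hd₁, hk], rfl⟩)).1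
      omega
    · rw [hd₂, hd₁]
      have h₁ := Par.potential_update (δ := δ) (L := L₂) (x := x) hun hus (d := σ.arr 6) rfl hxD'
      have e : ∀ l : List ℕ, P.potential δ l (σ.arr 6) =
          P.potential δ [] (σ.arr 6) + 200 * l.length := by
        intro l
        simp [Par.potential]
        omega
      rw [e L₂] at h₁
      rw [e L]
      simp only [Expr.cost, Code.numD, Code.bkId]
      omega
  · rintro σ' t ⟨m, hm, ⟨L', h', hf', rfl⟩, he⟩
    have : L' = [] := by
      rw [← List.length_eq_zero_iff, ← h'.core.sp]
      exact he
    subst this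
    exact ⟨h', hf', by simpa [Expr.cost] using hm⟩

end UpdateDistances

/-! ### Distances with respect to flexible weights -/

section FlexCeil

variable {k : ℕ} {w W : Fin (k + 1) → ℕ} {i : Fin (k + 1)}

/-- With `g = 1 + W i - w i` one has `x + W i = (x + w i) + (g - 1)`, so rounding `x + w i` up to a
multiple of `g` is rounding `x + W i` down. -/
theorem flexCeil_eq (hW : w i ≤ W i) (x : ℕ) :
    flexCeil w W i x = (x + W i) / (1 + (W i - w i)) * (1 + (W i - w i)) := by
  have hg : 1 + W i - w i = 1 + (W i - w i) := by omega
  have h₃ := Nat.div_add_mod (x + W i) (1 + (W i - w i))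
  have h₄ := Nat.mod_lt (x + W i) (show 0 < 1 + (W i - w i) by omega)
  rw [mul_comm] at h₃
  refine IsLeast.csInf_eq ⟨⟨by omega, hg ▸ Dvd.intro_left _ rfl⟩, ?_⟩
  rintro y ⟨h₁, h₂⟩
  rw [hg] at h₂
  obtain ⟨m, rfl⟩ := h₂
  rw [mul_comm _ m]
  refine Nat.mul_le_mul_right _ (Nat.lt_succ_iff.1 ?_)
  rw [Nat.div_lt_iff_lt_mul (by omega), Nat.succ_mul, mul_comm m]
  omega

theorem lt_flexCeil (hw : 1 ≤ w i) (hW : w i ≤ W i) (x : ℕ) : x < flexCeil w W i x := by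
  have h₃ := Nat.div_add_mod (x + W i) (1 + (W i - w i))
  have h₄ := Nat.mod_lt (x + W i) (show 0 < 1 + (W i - w i) by omega)
  rw [mul_comm] at h₃
  rw [flexCeil_eq hW]
  omega

theorem flexCeil_mono (hW : w i ≤ W i) {x y : ℕ} (h : x ≤ y) :
    flexCeil w W i x ≤ flexCeil w W i y := by
  rw [flexCeil_eq hW, flexCeil_eq hW]
  exact Nat.mul_le_mul_right _ (Nat.div_le_div_right (by omega))

end FlexCeil

/-! ### Walks and distances -/

namespace MState

variable {n k : ℕ} {M M' : MState n k} {ω : Fin n × Fin n → ℕ} {a b s v : Fin n}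
  {e : Fin n × Fin n} {q : List (Fin n × Fin n)}

theorem cls_mem_verts (x : Fin n) : M.cls x ∈ M.verts :=
  Finset.mem_image_of_mem _ (Finset.mem_univ _)

theorem mem_edges : e ∈ M.edges ↔ e ∈ M.E ∧ M.cls e.1 ≠ M.cls e.2 := Finset.mem_filter

theorem isWalk_concat :
    M.IsWalk a b (q ++ [e]) ↔ M.IsWalk a (M.cls e.1) q ∧ e ∈ M.edges ∧ M.cls e.2 = b := by
  induction q generalizing a with
  | nil =>
    simp only [List.nil_append, IsWalk]
    exact ⟨fun h => ⟨h.2.1.symm, h.1, h.2.2⟩, fun h => ⟨h.2.1, h.1.symm, h.2.2⟩⟩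
  | cons f q ih =>
    simp only [List.cons_append, IsWalk, ih]
    tauto

theorem dist_le (h : M.IsWalk a b q) : M.dist ω a b ≤ ((q.map ω).sum : ℕ) :=
  iInf₂_le q h

theorem exists_walk {x : ℕ} (h : M.dist ω a b = x) :
    ∃ q, M.IsWalk a b q ∧ (q.map ω).sum = x := by
  by_contra! hne
  have : ((x + 1 : ℕ) : ℕ∞) ≤ M.dist ω a b := by
    refine le_iInf₂ fun q hq => ?_
    have h₁ := M.dist_le (ω := ω) hq
    rw [h, Nat.cast_le] at h₁
    exact_mod_cast lt_of_le_of_ne h₁ (hne q hq).symm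
  rw [h, Nat.cast_le] at this
  omega

theorem exists_dist_of_le {x : ℕ} (h : M.dist ω a b ≤ x) : ∃ y : ℕ, M.dist ω a b = y ∧ y ≤ x := by
  obtain ⟨y, hy⟩ := ENat.ne_top_iff_exists.1 (ne_top_of_le_ne_top (ENat.natCast_ne_top x) h)
  exact ⟨y, hy.symm, by rw [← hy] at h; exact_mod_cast h⟩

end MState

/-! ### Feasible functions, shortest path trees, existence of the weights -/

section FlexWeight

variable {n k : ℕ} {M : MState n k} {w W : Fin (k + 1) → ℕ} {s : Fin n}
  {ω : Fin n × Fin n → ℕ}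

/-- `d` satisfies the triangle inequality for all edges of the multigraph. -/
def MState.Feasible (M : MState n k) (w W : Fin (k + 1) → ℕ) (d : Fin n → ℕ) : Prop :=
  ∀ e ∈ M.edges, d (M.cls e.2) ≤ flexCeil w W (M.lev e) (d (M.cls e.1))

/-- Let `e` be the last edge of a shortest walk and `y` the distance of its tail. Weights are
positive, so `y < x` and induction bounds `d` at the tail by `y`. Feasibility and monotone rounding
then give `d v ≤ ⌈y⌉ = y + ω e ≤ x`. -/
theorem le_dist_of_feasible (hw : ∀ i, 1 ≤ w i) (hW : ∀ i, w i ≤ W i) (hω : IsFlexWeight w W s M ω)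
    {d : Fin n → ℕ} (hs : d s = 0) (hd : M.Feasible w W d) {v : Fin n} {x : ℕ}
    (h : M.dist ω s v = x) : d v ≤ x := by
  induction x using Nat.strong_induction_on generalizing v with
  | _ x ih =>
    obtain ⟨q, hq, rfl⟩ := M.exists_walk h
    obtain rfl | ⟨q, e, rfl⟩ := q.eq_nil_or_concat'
    · obtain rfl : s = v := hq
      omega
    · obtain ⟨hq', he, rfl⟩ := MState.isWalk_concat.1 hq
      obtain ⟨y, hy, hyx⟩ := MState.exists_dist_of_le (MState.dist_le (ω := ω) hq')
      have h₁ := hω e he y hy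
      have h₂ := lt_flexCeil (hw (M.lev e)) (hW (M.lev e)) y
      simp only [List.map_append, List.sum_append, List.map_cons, List.map_nil, List.sum_cons,
        List.sum_nil] at ih ⊢
      have h₃ := flexCeil_mono (hW (M.lev e)) (ih y (by omega) hy)
      have h₄ := hd e he
      omega

/-- Along parent edges `d` drops strictly, because rounding exceeds its argument, so they lead back
to `s`. The walk obtained has weight `d v`, which meets the lower bound. This holds for every
solution `ω`, so uniqueness of the distances needs no separate proof. -/
theorem isSSSPTree_of_feasible (hw : ∀ i, 1 ≤ w i) (hW : ∀ i, w i ≤ W i)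
    (hω : IsFlexWeight w W s M ω) {d p : ℕ → ℕ} {D : ℕ} (hs : d s = 0)
    (hd : M.Feasible w W fun v => d v)
    (hp : ∀ v ∈ M.verts, v ≠ s → d v ≤ D → ∃ e, M.IsRep e ∧ M.cls e.2 = v ∧
      p v = M.cls e.1 ∧ flexCeil w W (M.lev e) (d (M.cls e.1)) = d v) :
    IsSSSPTree s D M ω d p := by
  have key : ∀ x : ℕ, ∀ v ∈ M.verts, d v = x → d v ≤ D → ∃ q, M.IsWalk s v q ∧
      (∀ e ∈ q, M.IsRep e ∧ p (M.cls e.2) = M.cls e.1) ∧ (q.map ω).sum = d v := by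
    intro x
    induction x using Nat.strong_induction_on with
    | _ x ih =>
      rintro v hv rfl hD
      by_cases hvs : v = s
      · subst hvs
        exact ⟨[], rfl, by simp, by simp [hs]⟩
      obtain ⟨e, he, rfl, hpe, hde⟩ := hp v hv hvs hD
      have hlt := lt_flexCeil (hw (M.lev e)) (hW (M.lev e)) (d (M.cls e.1))
      obtain ⟨q, hq, hqp, hqs⟩ := ih _ (hde ▸ hlt) _ (M.cls_mem_verts e.1) rfl (by omega)
      obtain ⟨y, hy, hyx⟩ := MState.exists_dist_of_le (MState.dist_le (ω := ω) hq)
      have h₁ := le_dist_of_feasible hw hW hω (d := fun v => d v) hs hd hy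
      have h₂ := hω e he.1 y hy
      -- The walk to the tail bounds `y` from above, feasibility bounds it from below.
      obtain rfl : y = d (M.cls e.1) := by omega
      refine ⟨q ++ [e], MState.isWalk_concat.2 ⟨hq, he.1, rfl⟩, ?_, ?_⟩
      · intro f hf
        rcases List.mem_append.1 hf with hf | hf
        · exact hqp f hf
        · obtain rfl := List.mem_singleton.1 hf
          exact ⟨he, hpe⟩
      · simp only [List.map_append, List.sum_append, List.map_cons, List.map_nil, List.sum_cons,
          List.sum_nil]
        omega
  have hdist : ∀ v ∈ M.verts, d v ≤ D → M.dist ω s v = d v := by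
    intro v hv hD
    obtain ⟨q, hq, -, hqs⟩ := key _ v hv rfl hD
    obtain ⟨y, hy, hyx⟩ := MState.exists_dist_of_le (MState.dist_le (ω := ω) hq)
    have := le_dist_of_feasible hw hW hω (d := fun v => d v) hs hd hy
    rw [hy, Nat.cast_inj]
    omega
  intro v hv
  constructor
  · intro hD
    obtain ⟨y, hy, hyD⟩ := MState.exists_dist_of_le hD
    have h₁ : d v ≤ D := (le_dist_of_feasible hw hW hω (d := fun v => d v) hs hd hy).trans hyD
    obtain ⟨q, hq, hqp, hqs⟩ := key _ v hv rfl h₁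
    rw [hdist v hv h₁]
    exact ⟨rfl, q, hq, hqp, by rw [hqs]⟩
  · intro hD
    by_contra! h₁
    rw [hdist v hv h₁, Nat.cast_lt] at hD
    omega

/-- The possible arrival times, when an edge of level `i` leads from time `x` to time `⌈x⌉_i`. -/
inductive MState.Arrival (M : MState n k) (w W : Fin (k + 1) → ℕ) (s : Fin n) : Fin n → ℕ → Prop
  | source : M.Arrival w W s s 0
  | edge {e : Fin n × Fin n} {t : ℕ} : M.Arrival w W s (M.cls e.1) t → e ∈ M.edges →
      M.Arrival w W s (M.cls e.2) (flexCeil w W (M.lev e) t)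

/-- Take the earliest arrival times and let `ω` be the delays at these times. No walk has smaller
weight than the earliest arrival, and some walk attains it since earlier departure never means later
arrival. So the distances for `ω` are the arrival times that define `ω`. -/
theorem exists_isFlexWeight (hw : ∀ i, 1 ≤ w i) (hW : ∀ i, w i ≤ W i) (s : Fin n)
    (M : MState n k) : ∃ ω, IsFlexWeight w W s M ω := by
  classical
  -- On unreachable vertices this is 0, the infimum of the empty set; the recursion does not concern
  -- edges that start there.
  set d : Fin n → ℕ := fun v => sInf {t | M.Arrival w W s v t} with hd
  have hmin : ∀ {v t}, M.Arrival w W s v t → d v ≤ t := fun h => Nat.sInf_le h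
  have hmem : ∀ {v t}, M.Arrival w W s v t → M.Arrival w W s v (d v) := fun h =>
    Nat.sInf_mem (s := {t | M.Arrival w W s _ t}) ⟨_, h⟩
  set ω : Fin n × Fin n → ℕ := fun e =>
    flexCeil w W (M.lev e) (d (M.cls e.1)) - d (M.cls e.1) with hω
  have hωe : ∀ e, d (M.cls e.1) + ω e = flexCeil w W (M.lev e) (d (M.cls e.1)) := fun e => by
    have := lt_flexCeil (hw (M.lev e)) (hW (M.lev e)) (d (M.cls e.1))
    simp only [hω]
    omega
  have lower : ∀ q : List (Fin n × Fin n), ∀ v, M.IsWalk s v q →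
      M.Arrival w W s v (d v) ∧ d v ≤ (q.map ω).sum := by
    intro q
    induction q using List.reverseRecOn with
    | nil =>
      rintro v (rfl : s = v)
      exact ⟨hmem .source, hmin .source⟩
    | append_singleton q e ih =>
      intro v hq
      obtain ⟨hq', he, rfl⟩ := MState.isWalk_concat.1 hq
      obtain ⟨h₁, h₂⟩ := ih _ hq'
      have h₃ := MState.Arrival.edge h₁ he
      refine ⟨hmem h₃, (hmin h₃).trans ?_⟩
      rw [← hωe]
      simpa using h₂
  have upper : ∀ x v, d v = x → M.Arrival w W s v x →
      ∃ q, M.IsWalk s v q ∧ (q.map ω).sum = x := by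
    intro x
    induction x using Nat.strong_induction_on with
    | _ x ih =>
      intro v hv hA
      cases hA with
      | source => exact ⟨[], rfl, rfl⟩
      | @edge e t hA he =>
        have h₁ := lt_flexCeil (hw (M.lev e)) (hW (M.lev e)) t
        -- By monotonicity, the tail of the last edge can be assumed to be reached at its earliest
        -- time.
        have h₂ := hmin hA
        have h₃ := flexCeil_mono (hW (M.lev e)) h₂
        have h₄ := hmin (.edge (hmem hA) he)
        obtain ⟨q, hq, hqs⟩ := ih _ (by omega) _ rfl (hmem hA)
        refine ⟨q ++ [e], MState.isWalk_concat.2 ⟨hq, he, rfl⟩, ?_⟩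
        have := hωe e
        simp only [List.map_append, List.sum_append, List.map_cons, List.map_nil, List.sum_cons,
          List.sum_nil]
        omega
  refine ⟨ω, fun e he x hx => ?_⟩
  obtain ⟨q, hq, rfl⟩ := M.exists_walk hx
  obtain ⟨h₁, h₂⟩ := lower q _ hq
  obtain ⟨q', hq', hqs⟩ := upper _ _ rfl h₁
  have h₃ := M.dist_le (ω := ω) hq'
  rw [hx, Nat.cast_le] at h₃
  rw [show (q.map ω).sum = d (M.cls e.1) by omega]

end FlexWeight

/-! ### The sizes of the reports -/

namespace MState

variable {n k : ℕ} {M M' : MState n k} {s : Fin n} {op : Op n k}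

theorem mem_reps {r : Fin n × Fin n × Fin (k + 1)} :
    r ∈ M.reps ↔ ∃ e, M.IsRep e ∧ M.cls e.1 = r.1 ∧ M.cls e.2 = r.2.1 ∧ M.lev e = r.2.2 := by
  obtain ⟨u, v, i⟩ := r
  simp only [reps, Finset.mem_image, Finset.mem_filter, Prod.mk.injEq]
  constructor
  · rintro ⟨e, ⟨-, he⟩, h⟩
    exact ⟨e, he, h⟩
  · rintro ⟨e, he, h⟩
    exact ⟨e, ⟨(Finset.mem_filter.1 he.1).1, he⟩, h⟩

theorem reps_unique {u v : Fin n} {i j : Fin (k + 1)} (h : (u, v, i) ∈ M.reps)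
    (h' : (u, v, j) ∈ M.reps) : i = j := by
  obtain ⟨e, he, h₁, h₂, rfl⟩ := mem_reps.1 h
  obtain ⟨f, hf, h₃, h₄, rfl⟩ := mem_reps.1 h'
  simp only at h₁ h₂ h₃ h₄
  exact le_antisymm (he.2 f hf.1 (h₃.trans h₁.symm) (h₄.trans h₂.symm))
    (hf.2 e he.1 (h₁.trans h₃.symm) (h₂.trans h₄.symm))

theorem exists_rep {e : Fin n × Fin n} (he : e ∈ M.edges) :
    ∃ i ≤ M.lev e, (M.cls e.1, M.cls e.2, i) ∈ M.reps := by
  obtain ⟨f, hf, hmin⟩ := Finset.exists_min_image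
    (M.edges.filter fun f => M.cls f.1 = M.cls e.1 ∧ M.cls f.2 = M.cls e.2) M.lev
    ⟨e, by simp [he]⟩
  simp only [Finset.mem_filter] at hf hmin
  refine ⟨M.lev f, hmin e ⟨he, rfl, rfl⟩, mem_reps.2 ⟨f, ⟨hf.1, ?_⟩, hf.2.1, hf.2.2, rfl⟩⟩
  intro g hg h₁ h₂
  exact hmin g ⟨hg, h₁.trans hf.2.1, h₂.trans hf.2.2⟩

theorem card_reps_le : M.reps.card ≤ M.E.card := by
  classical
  rw [reps]
  exact Finset.card_image_le.trans (Finset.card_filter_le _ _)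

/-- The edges of `M` that do not join one of the pairs in `S` are also edges of `M'`. -/
def AgreeOff (M M' : MState n k) (S : Finset (Fin n × Fin n)) : Prop :=
  ∀ e ∈ M.edges, (M.cls e.1, M.cls e.2) ∉ S →
    e ∈ M'.edges ∧ M'.cls e.1 = M.cls e.1 ∧ M'.cls e.2 = M.cls e.2 ∧ M'.lev e = M.lev e

/-- For a pair outside of `S` the parallel edges and their levels agree in both multigraphs, hence
so does the minimum level. A pair has only one representative, so the pairs in `S` count all those
that disappear. -/
theorem AgreeOff.card_reps_sdiff_le {S : Finset (Fin n × Fin n)} (h : M.AgreeOff M' S)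
    (h' : M'.AgreeOff M S) : (M.reps \ M'.reps).card ≤ S.card := by
  refine Finset.card_le_card_of_injOn (fun r => (r.1, r.2.1)) ?_ ?_
  · rintro ⟨u, v, i⟩ hr
    simp only [Finset.coe_sdiff, Set.mem_sdiff, Finset.mem_coe] at hr ⊢
    by_contra hS
    obtain ⟨e, he, rfl, rfl, rfl⟩ := mem_reps.1 hr.1
    obtain ⟨h₁, h₂, h₃, h₄⟩ := h e he.1 hS
    refine hr.2 (mem_reps.2 ⟨e, ⟨h₁, ?_⟩, h₂, h₃, h₄⟩)
    intro f hf h₅ h₆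
    rw [h₂] at h₅
    rw [h₃] at h₆
    obtain ⟨g₁, g₂, g₃, g₄⟩ := h' f hf (by rwa [h₅, h₆])
    rw [h₄, ← g₄]
    exact he.2 f g₁ (g₂.trans h₅) (g₃.trans h₆)
  · rintro ⟨u, v, i⟩ hr ⟨u', v', i'⟩ hr' e
    simp only [Finset.coe_sdiff, Set.mem_sdiff, Finset.mem_coe, Prod.mk.injEq] at hr hr' e
    obtain ⟨rfl, rfl⟩ := e
    rw [reps_unique hr.1 hr'.1]

/-- The size of the set of the partition that contains `x`. -/
def size (M : MState n k) (x : Fin n) : ℕ := (Finset.univ.filter fun y => M.cls y = M.cls x).card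

theorem size_pos (x : Fin n) : 0 < M.size x := Finset.card_pos.2 ⟨x, by simp⟩

/-- An upper bound on the number of the edges that can be affected by future splits. -/
def weight (M : MState n k) : ℕ := ∑ e ∈ M.E, (Nat.log 2 (M.size e.1) + Nat.log 2 (M.size e.2))

theorem weight_le : M.weight ≤ M.E.card * (2 * Nat.log 2 n) := by
  rw [weight, ← smul_eq_mul]
  refine Finset.sum_le_card_nsmul _ _ _ fun e _ => ?_
  have h : ∀ x, Nat.log 2 (M.size x) ≤ Nat.log 2 n := fun x => Nat.log_mono_right <| by
    simpa [size] using Finset.card_le_univ (Finset.univ.filter fun y => M.cls y = M.cls x)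
  linarith [h e.1, h e.2]

/-- A renamed vertex lies in a set of at most half the old size, which lowers the logarithm by one.
A vertex that keeps its name lies in a subset of its old set. -/
theorem IsSplit.log_size {a : Fin n} {f : Fin n → Fin n} (h : M.IsSplit a f) (x : Fin n) :
    Nat.log 2 (MState.size { M with cls := f } x) + (if f x = M.cls x then 0 else 1) ≤
      Nat.log 2 (M.size x) := by
  obtain ⟨ha, h₁, h₂, -, h₃⟩ := h
  have hsub : f x = M.cls x → MState.size { M with cls := f } x ≤ M.size x := by
    intro hx
    refine Finset.card_le_card fun y hy => ?_
    simp only [Finset.mem_filter, Finset.mem_univ, true_and] at hy ⊢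
    by_cases hya : M.cls y = a
    · rcases h₂ y hya with e | e
      · rw [hya, ← e, hy, hx]
      · rw [hy, hx] at e
        exact absurd (M.cls_mem_verts x) e
    · rw [← h₁ y hya, hy, hx]
  split_ifs with hx
  · rw [add_zero]
    exact Nat.log_mono_right (hsub hx)
  · have hxa : M.cls x = a := by
      by_contra hxa
      exact hx (h₁ x hxa)
    have := h₃ x hxa (by rwa [← hxa])
    rw [← hxa] at this
    rw [← Nat.log_mul_base (by decide) (size_pos x).ne', mul_comm]
    exact Nat.log_mono_right this

/-- The weight pays for the splits. An edge with a renamed endpoint affects two pairs, its old and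
its new one, and loses at least one unit of weight. The factor 4 arises because affected pairs count
for both lists of representative edges. A deletion or an increase affects one pair. -/
theorem Step.card_reps (h : M.Step s M' op) :
    (M.reps \ M'.reps).card + (M'.reps \ M.reps).card + 4 * M'.weight ≤ 2 + 4 * M.weight := by
  have aux : ∀ S : Finset (Fin n × Fin n), M.AgreeOff M' S → M'.AgreeOff M S →
      S.card + 2 * M'.weight ≤ 1 + 2 * M.weight →
      (M.reps \ M'.reps).card + (M'.reps \ M.reps).card + 4 * M'.weight ≤ 2 + 4 * M.weight := by
    intro S h₁ h₂ h₃
    have := h₁.card_reps_sdiff_le h₂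
    have := h₂.card_reps_sdiff_le h₁
    omega
  cases op with
  | delete e =>
    obtain ⟨he, rfl⟩ := h
    refine aux {(M.cls e.1, M.cls e.2)} ?_ ?_ ?_
    · intro f hf hS
      have hne : f ≠ e := by rintro rfl; simp at hS
      rw [mem_edges] at hf
      exact ⟨mem_edges.2 ⟨Finset.mem_erase.2 ⟨hne, hf.1⟩, hf.2⟩, rfl, rfl, rfl⟩
    · intro f hf _
      rw [mem_edges] at hf
      exact ⟨mem_edges.2 ⟨Finset.mem_of_mem_erase hf.1, hf.2⟩, rfl, rfl, rfl⟩
    · have : MState.weight { M with E := M.E.erase e } ≤ M.weight :=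
        Finset.sum_le_sum_of_subset (Finset.erase_subset _ _)
      simp only [Finset.card_singleton]
      omega
  | increase e i =>
    obtain ⟨he, -, rfl⟩ := h
    refine aux {(M.cls e.1, M.cls e.2)} ?_ ?_ ?_
    · intro f hf hS
      have hne : f ≠ e := by rintro rfl; simp at hS
      exact ⟨hf, rfl, rfl, Function.update_of_ne hne _ _⟩
    · intro f hf hS
      have hne : f ≠ e := by rintro rfl; simp at hS
      exact ⟨hf, rfl, rfl, (Function.update_of_ne hne _ _).symm⟩
    · exact le_of_eq (by simp [weight, size])
  | split a f =>
    obtain ⟨-, hsplit, rfl⟩ := h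
    set T := M.E.filter fun e => ¬ (f e.1 = M.cls e.1 ∧ f e.2 = M.cls e.2) with hT
    refine aux (T.image (fun e => (M.cls e.1, M.cls e.2)) ∪ T.image fun e => (f e.1, f e.2))
      ?_ ?_ ?_
    · intro e he hS
      have heT : e ∉ T := fun h =>
        hS (Finset.mem_union_left _ (Finset.mem_image_of_mem _ h))
      rw [mem_edges] at he
      obtain ⟨h₁, h₂⟩ : f e.1 = M.cls e.1 ∧ f e.2 = M.cls e.2 := by
        by_contra h
        exact heT (Finset.mem_filter.2 ⟨he.1, h⟩)
      exact ⟨mem_edges.2 ⟨he.1, by change f e.1 ≠ f e.2; rw [h₁, h₂]; exact he.2⟩, h₁, h₂, rfl⟩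
    · intro e he hS
      have heT : e ∉ T := fun h =>
        hS (Finset.mem_union_right _ (Finset.mem_image_of_mem (fun e => (f e.1, f e.2)) h))
      rw [mem_edges] at he
      obtain ⟨h₁, h₂⟩ : f e.1 = M.cls e.1 ∧ f e.2 = M.cls e.2 := by
        by_contra h
        exact heT (Finset.mem_filter.2 ⟨he.1, h⟩)
      exact ⟨mem_edges.2 ⟨he.1, by rw [← h₁, ← h₂]; exact he.2⟩, h₁.symm, h₂.symm, rfl⟩
    · have h₁ : T.card + MState.weight { M with cls := f } ≤ M.weight := by
        rw [hT, Finset.card_filter, weight, weight, ← Finset.sum_add_distrib]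
        refine Finset.sum_le_sum fun e _ => ?_
        have h₁ := hsplit.log_size e.1
        have h₂ := hsplit.log_size e.2
        by_cases g₁ : f e.1 = M.cls e.1 <;> by_cases g₂ : f e.2 = M.cls e.2 <;>
          simp only [g₁, g₂, and_true, and_false, not_true, not_false_eq_true, if_true,
            if_false] at h₁ h₂ ⊢ <;> omega
      have h₂ := Finset.card_union_le (T.image fun e => (M.cls e.1, M.cls e.2))
        (T.image fun e => (f e.1, f e.2))
      have h₃ := Finset.card_image_le (s := T) (f := fun e => (M.cls e.1, M.cls e.2))
      have h₄ := Finset.card_image_le (s := T) (f := fun e => (f e.1, f e.2))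
      omega
  | updateDistances =>
    obtain rfl := h
    exact aux ∅ (fun e he _ => ⟨he, rfl, rfl, rfl⟩) (fun e he _ => ⟨he, rfl, rfl, rfl⟩) (by simp)

/-- The vertex that is split by an operation. -/
def _root_.FlexES.Op.vertex (op : Op n k) : ℕ :=
  match op with
  | .split a _ => a
  | _ => 0

theorem Step.verts_subset (h : M.Step s M' op) : M.verts ⊆ M'.verts := by
  cases op with
  | delete e => obtain ⟨-, rfl⟩ := h; exact subset_rfl
  | increase e i => obtain ⟨-, -, rfl⟩ := h; exact subset_rfl
  | updateDistances => obtain rfl := h; exact subset_rfl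
  | split a f =>
    obtain ⟨-, ⟨ha, h₁, h₂, ⟨x, hx⟩, h₃⟩, rfl⟩ := h
    intro v hv
    by_cases hva : v = a
    · subst hva
      exact Finset.mem_image.2 ⟨x, Finset.mem_univ _, hx⟩
    · obtain ⟨y, -, rfl⟩ := Finset.mem_image.1 hv
      exact Finset.mem_image.2 ⟨y, Finset.mem_univ _, h₁ y hva⟩

/-- A deletion drops constraints, and a level increase weakens them by the monotonicity in the
level. In a split each part has the value of its old set; an edge that was inside this set joins
equal values, and rounding does not decrease. -/
theorem Step.feasible {w W : Fin (k + 1) → ℕ} (h : M.Step s M' op) (hw : ∀ i, 1 ≤ w i)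
    (hW : ∀ i, w i ≤ W i) (hmono : ∀ i j, i ≤ j → ∀ x, flexCeil w W i x ≤ flexCeil w W j x)
    {d d' : ℕ → ℕ} (hd : M.Feasible w W fun v => d v)
    (hd' : ∀ v : Fin n, d' v = if v ∈ M'.verts ∧ v ∉ M.verts then d op.vertex else d v) :
    M'.Feasible w W fun v => d' v := by
  have hold : ∀ v ∈ M.verts, d' v = d v := fun v hv => by rw [hd', if_neg fun h => h.2 hv]
  cases op with
  | delete e =>
    obtain ⟨-, rfl⟩ := h
    intro f hf
    have hf' : f ∈ M.edges := by
      simp only [edges, Finset.mem_filter] at hf ⊢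
      exact ⟨Finset.mem_of_mem_erase hf.1, hf.2⟩
    simpa only [hold _ (M.cls_mem_verts _)] using hd f hf'
  | increase e i =>
    obtain ⟨-, hi, rfl⟩ := h
    intro f hf
    simp only [hold _ (M.cls_mem_verts _)]
    refine (hd f hf).trans (hmono _ _ ?_ _)
    by_cases e' : f = e
    · subst e'
      simpa using hi.le
    · simp [e']
  | updateDistances =>
    obtain rfl := h
    intro f hf
    simpa only [hold _ (cls_mem_verts _)] using hd f hf
  | split a f =>
    obtain ⟨-, ⟨ha, h₁, h₂, -, -⟩, rfl⟩ := h
    have hf : ∀ x, d' (f x) = d (M.cls x) := by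
      intro x
      by_cases hx : M.cls x = a
      · rcases h₂ x hx with e | e
        · rw [e, hold a ha, hx]
        · rw [hd', if_pos ⟨Finset.mem_image_of_mem f (Finset.mem_univ _), e⟩, hx]
          rfl
      · rw [h₁ x hx, hold _ (M.cls_mem_verts x)]
    intro e he
    simp only [hf]
    by_cases hne : M.cls e.1 = M.cls e.2
    · rw [hne]
      exact (lt_flexCeil (hw _) (hW _) _).le
    · refine hd e ?_
      simp only [edges, Finset.mem_filter] at he ⊢
      exact ⟨he.1, hne⟩

end MState

/-! ### The data structure on a sequence of operations -/

section Input

variable {n k : ℕ}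

/-- A function on levels as a function on the natural numbers. -/
def extend (f : Fin (k + 1) → ℕ) (i : ℕ) : ℕ := (List.ofFn f).getD i 0

theorem extend_coe (f : Fin (k + 1) → ℕ) (i : Fin (k + 1)) : extend f i = f i := by
  simp [extend, List.getD_eq_getElem?_getD, -List.ofFn_succ, Nat.lt_succ_iff.1 i.2]

theorem extend_of_le (f : Fin (k + 1) → ℕ) {i : ℕ} (hi : i ≤ k) :
    extend f i = f ⟨i, Nat.lt_succ_of_le hi⟩ :=
  extend_coe f ⟨i, Nat.lt_succ_of_le hi⟩

/-- The parameters of an input. -/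
def parameters (n k D : ℕ) (s : Fin n) (w W : Fin (k + 1) → ℕ) (hw : ∀ i, 1 ≤ w i)
    (hW : ∀ i, w i ≤ W i) : Par where
  n := n
  k := k
  D := D
  s := s
  -- All addresses and values are below the fifth power of the base. The base is at least 3, so the
  -- eighth power also covers the constants.
  B := (n + k + D + ∑ i, W i + 2) ^ 8
  w := extend w
  W := extend W
  s_lt := s.2
  w_pos := fun i hi => by rw [extend_of_le _ hi]; exact hw _
  w_le := fun i hi => by rw [extend_of_le _ hi, extend_of_le _ hi]; exact hW _
  const_lt := by
    have := s.pos
    calc 100 < 3 ^ 8 := by norm_num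
      _ ≤ _ := Nat.pow_le_pow_left (by omega) 8
  out_lt := by
    have := s.pos
    set X := n + k + D + ∑ i, W i + 2 with hX
    calc n * (k + 1) * (n * n) ≤ X * X * (X * X) := by gcongr <;> omega
      _ = X ^ 4 := by ring
      _ < X ^ 8 := Nat.pow_lt_pow_right (by omega) (by norm_num)
  bk_lt := by
    have := s.pos
    set X := n + k + D + ∑ i, W i + 2 with hX
    calc n * (D + 2) * (n * n) ≤ X * X * (X * X) := by gcongr <;> omega
      _ = X ^ 4 := by ring
      _ < X ^ 8 := Nat.pow_lt_pow_right (by omega) (by norm_num)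
  W_lt := fun i hi => by
    have := s.pos
    rw [extend_of_le _ hi]
    have h := Finset.single_le_sum (f := W) (fun _ _ => Nat.zero_le _)
      (Finset.mem_univ ⟨i, Nat.lt_succ_of_le hi⟩)
    set X := n + k + D + ∑ i, W i + 2 with hX
    calc D + 3 + W ⟨i, Nat.lt_succ_of_le hi⟩ ≤ X ^ 1 := by rw [pow_one]; omega
      _ < X ^ 8 := Nat.pow_lt_pow_right (by omega) (by norm_num)
  len_lt := by
    have := s.pos
    set X := n + k + D + ∑ i, W i + 2 with hX
    have hX3 : 3 ≤ X := by omega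
    calc 3 * (n * n * (k + 1)) + 3 ≤ X * (X * X * X) + X * (X * X * X) := by
          gcongr
          · omega
          · omega
          · omega
          · calc 3 ≤ X * 1 := by omega
              _ ≤ X * (X * X * X) := by gcongr; exact Nat.one_le_iff_ne_zero.2 (by positivity)
      _ ≤ X * (X * (X * X * X)) := by nlinarith [Nat.zero_le (X * (X * X * X))]
      _ = X ^ 5 := by ring
      _ < X ^ 8 := Nat.pow_lt_pow_right (by omega) (by norm_num)

/-- An edge with its level as a triple of numbers. -/
def triple (r : Fin n × Fin n × Fin (k + 1)) : ℕ × ℕ × ℕ := (r.1, r.2.1, r.2.2)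

theorem triple_injective : Function.Injective (triple (n := n) (k := k)) := by
  rintro ⟨u, v, i⟩ ⟨u', v', i'⟩ h
  simp only [triple, Prod.mk.injEq, Fin.val_inj] at h
  obtain ⟨rfl, rfl, rfl⟩ := h
  rfl

theorem listed_flatten (l : List (Fin n × Fin n × Fin (k + 1))) :
    Listed (fun j => (flatten l).getD j 0) (l.map triple) := by
  induction l with
  | nil => intro j r h; simp at h
  | cons a l ih =>
    have e : flatten (a :: l) = (a.1 : ℕ) :: (a.2.1 : ℕ) :: (a.2.2 : ℕ) :: flatten l := rfl
    intro j r h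
    cases j with
    | zero =>
      obtain rfl : triple a = r := by simpa using h
      exact ⟨rfl, rfl, rfl⟩
    | succ j => exact ih (by simpa using h)

theorem loadOutput_arr (σ : Store) (D : ℕ) (s : Fin n) (a : ℕ) (o : Output n k) {b : ℕ}
    (h₀ : b ≠ 0) (h₃ : b ≠ 3) (h₄ : b ≠ 4) (h₅ : b ≠ 5) :
    (σ.loadOutput D s a o).arr b = σ.arr b := by
  simp [Store.loadOutput, Store.load, h₀, h₃, h₄, h₅]

theorem loadOutput_new (σ : Store) (D : ℕ) (s : Fin n) (a : ℕ) (o : Output n k) (j : ℕ) :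
    (σ.loadOutput D s a o).arr 3 j = (o.new.map Fin.val).getD j 0 := by
  have h : List.flatMap (fun v : Fin n => [(v : ℕ)]) o.new = List.map Fin.val o.new :=
    List.map_eq_flatMap.symm
  simp [Store.loadOutput, Store.load, h]
  rfl

end Input

/-- The edges of a multigraph as triples of numbers. -/
noncomputable def edgeSet {n k : ℕ} (M : MState n k) : Finset (ℕ × ℕ × ℕ) := M.reps.image triple

/-- The vertices of a multigraph as numbers. -/
def vertexSet {n k : ℕ} (M : MState n k) : Finset ℕ := M.verts.image Fin.val

/-! ### From multigraphs to states of the memory -/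

section Run

variable {n k D : ℕ} {s : Fin n} {w W : Fin (k + 1) → ℕ} {hw : ∀ i, 1 ≤ w i}
  {hW : ∀ i, w i ≤ W i} {M M' : MState n k} {op : Op n k} {o : Output n k} {σ : Store}
  {L : List ℕ} {δ : Fin (k + 1) → ℕ}

theorem mem_vertexSet {v : Fin n} : (v : ℕ) ∈ vertexSet M ↔ v ∈ M.verts := by
  simp [vertexSet, Fin.val_inj]

theorem mem_edgeSet {u v i : ℕ} : (u, v, i) ∈ edgeSet M ↔
    ∃ e, M.IsRep e ∧ (M.cls e.1 : ℕ) = u ∧ (M.cls e.2 : ℕ) = v ∧ (M.lev e : ℕ) = i := by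
  simp only [edgeSet, Finset.mem_image, triple, Prod.mk.injEq]
  constructor
  · rintro ⟨r, hr, rfl, rfl, rfl⟩
    obtain ⟨e, he, h₁, h₂, h₃⟩ := MState.mem_reps.1 hr
    exact ⟨e, he, by rw [h₁], by rw [h₂], by rw [h₃]⟩
  · rintro ⟨e, he, rfl, rfl, rfl⟩
    exact ⟨(M.cls e.1, M.cls e.2, M.lev e), MState.mem_reps.2 ⟨e, he, rfl, rfl, rfl⟩, rfl, rfl, rfl⟩

theorem edges_edgeSet (M : MState n k) :
    Edges (parameters n k D s w W hw hW) (vertexSet M) (edgeSet M) where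
  lt := fun hv => by
    obtain ⟨v, -, rfl⟩ := Finset.mem_image.1 hv
    exact v.2
  fst_mem := fun hr => by
    obtain ⟨e, -, rfl, -, -⟩ := mem_edgeSet.1 hr
    exact mem_vertexSet.2 (M.cls_mem_verts _)
  snd_mem := fun hr => by
    obtain ⟨e, -, -, rfl, -⟩ := mem_edgeSet.1 hr
    exact mem_vertexSet.2 (M.cls_mem_verts _)
  lev_le := fun hr => by
    obtain ⟨e, -, -, -, rfl⟩ := mem_edgeSet.1 hr
    exact Nat.lt_succ_iff.1 (M.lev e).2
  ne := fun hr => by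
    obtain ⟨e, he, rfl, rfl, -⟩ := mem_edgeSet.1 hr
    exact fun h => (MState.mem_edges.1 he.1).2 (Fin.ext h)
  lev_unique := fun hr hr' => by
    obtain ⟨e, he, rfl, rfl, rfl⟩ := mem_edgeSet.1 hr
    obtain ⟨f, hf, h₁, h₂, rfl⟩ := mem_edgeSet.1 hr'
    have h₁ := Fin.ext h₁
    have h₂ := Fin.ext h₂
    exact congrArg Fin.val (le_antisymm (he.2 f hf.1 h₁ h₂) (hf.2 e he.1 h₁.symm h₂.symm))

theorem key_eq_min (i : Fin (k + 1)) (x : ℕ) :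
    (parameters n k D s w W hw hW).key i x = min (flexCeil w W i x) (D + 1) := by
  rw [flexCeil_eq (hW i), Par.key]
  simp only [parameters, extend_coe]

/-- Representatives suffice, as a parallel edge of higher level is rounded no lower. The cut-off is
harmless since `d` is at most `D + 1`. -/
theorem feasible_iff (hmono : ∀ i j, i ≤ j → ∀ x, flexCeil w W i x ≤ flexCeil w W j x) {d : ℕ → ℕ}
    (hd : ∀ v, d v ≤ D + 1) :
    Feasible (parameters n k D s w W hw hW) (edgeSet M) d ↔ M.Feasible w W fun v => d v := by
  constructor
  · intro h e he
    obtain ⟨i, hi, hr⟩ := MState.exists_rep he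
    have := h (Finset.mem_image_of_mem triple hr)
    rw [key_eq_min] at this
    exact (this.trans (min_le_left _ _)).trans (hmono i _ hi _)
  · intro h u v i hr
    obtain ⟨e, he, rfl, rfl, rfl⟩ := mem_edgeSet.1 hr
    rw [key_eq_min]
    exact le_min (h e he.1) (hd _)

/-- On an empty stack every vertex within distance `D` has a tight parent edge, whose key is at most
`D` and therefore not affected by the cut-off. -/
theorem isSSSPTree_of_good
    (h : Good (parameters n k D s w W hw hW) (vertexSet M) (edgeSet M) [] σ)
    (hf : M.Feasible w W fun v => σ.arr 6 v) {ω : Fin n × Fin n → ℕ}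
    (hω : IsFlexWeight w W s M ω) : IsSSSPTree s D M ω σ.distArray σ.parentArray := by
  refine isSSSPTree_of_feasible hw hW hω h.src hf ?_
  intro v hv hvs hD
  obtain h' | ⟨u, i, hr, hk, hp⟩ := h.settled v (mem_vertexSet.2 hv) not_false
    (fun e => hvs (Fin.ext e)) hD
  · simp at h'
  · obtain ⟨e, he, rfl, h₂, rfl⟩ := mem_edgeSet.1 hr
    refine ⟨e, he, Fin.ext h₂, hp, ?_⟩
    rw [key_eq_min] at hk
    have : σ.arr 6 v ≤ D := hD
    have hk' : min (flexCeil w W (M.lev e) (σ.arr 6 (M.cls e.1))) (D + 1) = σ.arr 6 v := hk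
    change flexCeil w W (M.lev e) (σ.arr 6 (M.cls e.1)) = σ.arr 6 v
    omega

theorem Good.loadOutput {V : Finset ℕ} {R : Finset (ℕ × ℕ × ℕ)}
    (h : Good (parameters n k D s w W hw hW) V R L σ) (a : ℕ) (o : Output n k) :
    Good (parameters n k D s w W hw hW) V R L (σ.loadOutput D s a o) := by
  have e : ∀ b, 6 ≤ b → (σ.loadOutput D s a o).arr b = σ.arr b := fun b hb =>
    loadOutput_arr σ D s a o (by omega) (by omega) (by omega) (by omega)
  have e₁ := loadOutput_arr σ D s a o (b := 1) (by decide) (by decide) (by decide) (by decide)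
  have e₂ := loadOutput_arr σ D s a o (b := 2) (by decide) (by decide) (by decide) (by decide)
  obtain ⟨h₁, h₂, ⟨c₁, c₂, c₃, c₄, c₅, c₆, c₇, c₈, c₉⟩, h₄, h₅, h₆, h₇⟩ := h
  rw [Good, e 6 le_rfl]
  refine ⟨h₁, h₂, ⟨⟨rfl, rfl, rfl, rfl, ?_, ?_⟩, ?_, ?_, c₄, ?_, c₆, ?_, c₈, ?_⟩, ?_, ?_, ?_, h₇⟩
  · rw [e₁]; exact c₁.w
  · rw [e₂]; exact c₁.W
  · rw [e 8 (by decide), e 9 (by decide), e 10 (by decide)]; exact c₂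
  · rw [e 11 (by decide), e 12 (by decide), e 13 (by decide)]; exact c₃
  · rw [e 15 (by decide)]; exact c₅
  · rw [e 14 (by decide)]; exact c₇
  · rw [e 6 (by decide)]; exact c₉
  · rw [e 6 (by decide), e 7 (by decide)]; exact h₄
  · rw [e 6 (by decide)]; exact h₅
  · rw [e 6 (by decide)]; exact h₆

theorem isBag_empty {c : ℕ} {cell pos : ℕ → ℕ} : IsBag c (fun _ => 0) cell pos fun _ _ => False where
  of_lt := fun h => absurd h (Nat.not_lt_zero _)
  of_mem := fun h => h.elim
  uniq := fun h => h.elim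
  lt := fun h => h.elim

/-- The initial memory represents the graph without vertices, so the initialization is an update
that starts from this graph. -/
theorem good_initStore (o : Output n k) :
    Good (parameters n k D s w W hw hW) ∅ ∅ [] (initStore w W D s o) where
  edges := ⟨by simp, by simp, by simp, by simp, by simp, by simp⟩
  key_le := by simp
  core := {
    hdr := ⟨rfl, rfl, rfl, rfl, fun _ _ => rfl, fun _ _ => rfl⟩
    outBag := by
      have : outOf (parameters n k D s w W hw hW) ∅ = fun _ _ => False := by
        ext; simp [outOf]
      rw [this]
      exact isBag_empty
    bkBag := by
      have : ∀ κ, bkOf (parameters n k D s w W hw hW) ∅ κ = fun _ _ => False := by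
        intro κ; ext; simp [bkOf]
      rw [this]
      exact isBag_empty
    sp := rfl
    st := by simp
    nodup := List.nodup_nil
    flag := by
      intro v
      have : (initStore w W D s o).arr 14 v = 0 := rfl
      simp [this]
    stk_lt := by simp
    dist_le := fun _ => Nat.zero_le _ }
  settled := by simp
  zero := fun _ _ => rfl
  src := rfl
  stk := by simp

/-- The time credits of a state of the memory. -/
def credits (P : Par) (δ : ℕ → ℕ) (σ : Store) : ℕ :=
  200 * σ.reg 0 +
    ∑ v ∈ (Finset.range P.n).erase P.s, ∑ x ∈ Finset.Ico (σ.arr 6 v) (P.D + 1), P.charge δ x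

theorem Good.potential_eq {P : Par} {V : Finset ℕ} {R : Finset (ℕ × ℕ × ℕ)} {δ : ℕ → ℕ}
    (h : Good P V R L σ) : P.potential δ L (σ.arr 6) = credits P δ σ := by
  rw [Par.potential, credits, h.core.sp]

/-- The size of a report. -/
def Output.size (o : Output n k) : ℕ := o.new.length + o.Eold.length + o.Enew.length

/-- The old state is given by sets of numbers instead of a multigraph, so that the initialization
from the graph without vertices is covered. -/
theorem run_update {V : Finset ℕ} {R : Finset (ℕ × ℕ × ℕ)}
    (h : Good (parameters n k D s w W hw hW) V R L σ) {a : ℕ}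
    (hnew : o.new.Nodup ∧ ∀ v : Fin n, v ∈ o.new ↔ v ∈ M'.verts ∧ (v : ℕ) ∉ V)
    (hold : o.Eold.Nodup ∧ ∀ r, triple r ∈ o.Eold.map triple ↔ triple r ∈ R ∧ r ∉ M'.reps)
    (hR : ∀ r ∈ R, ∃ r', triple (n := n) (k := k) r' = r)
    (hnew' : o.Enew.Nodup ∧ ∀ r, r ∈ o.Enew ↔ r ∈ M'.reps ∧ triple r ∉ R)
    (hV : V ⊆ vertexSet M') (hs : s ∈ o.new → σ.arr 6 a = 0) :
    ∃ σ' t, Exec ((n + k + D + ∑ i, W i + 2) ^ 8) Code.update (σ.loadOutput D s a o) σ' t ∧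
      (∃ L', Good (parameters n k D s w W hw hW) (vertexSet M') (edgeSet M') L' σ') ∧
      (∀ v : Fin n, σ'.arr 6 v = if v ∈ o.new then σ.arr 6 a else σ.arr 6 v) ∧
      credits (parameters n k D s w W hw hW) (extend δ) σ' + t ≤
        credits (parameters n k D s w W hw hW) (extend δ) σ + 1000 + 600 * o.size := by
  have e₆ : (σ.loadOutput D s a o).arr 6 = σ.arr 6 := rfl
  have hreps : ∀ r, triple r ∈ edgeSet M' ↔ r ∈ M'.reps := fun r => by
    rw [edgeSet, Finset.mem_image]
    exact ⟨fun ⟨r', h, e⟩ => triple_injective e ▸ h, fun h => ⟨r, h, rfl⟩⟩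
  have hmap : ∀ x : ℕ, x ∈ o.new.map Fin.val ↔ ∃ v ∈ o.new, (v : ℕ) = x := fun x => List.mem_map
  have hmem : ∀ v : Fin n, (v : ℕ) ∈ o.new.map Fin.val ↔ v ∈ o.new := fun v => by
    rw [hmap]
    exact ⟨fun ⟨v', h, e⟩ => Fin.ext e ▸ h, fun h => ⟨v, h, rfl⟩⟩
  have h₁ : ∀ x, x ∈ o.new.map Fin.val ↔ x ∈ vertexSet M' ∧ x ∉ V := by
    intro x
    rw [hmap]
    constructor
    · rintro ⟨v, hv, rfl⟩
      exact ⟨mem_vertexSet.2 ((hnew.2 v).1 hv).1, ((hnew.2 v).1 hv).2⟩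
    · rintro ⟨hx, hxV⟩
      obtain ⟨v, hv, rfl⟩ := Finset.mem_image.1 hx
      exact ⟨v, (hnew.2 v).2 ⟨hv, hxV⟩, rfl⟩
  have h₂ : ∀ r, r ∈ o.Eold.map triple ↔ r ∈ R ∧ r ∉ edgeSet M' := by
    intro r
    constructor
    · intro hr
      obtain ⟨r, -, rfl⟩ := List.mem_map.1 hr
      rw [hreps]
      exact (hold.2 r).1 hr
    · rintro ⟨hr, hr'⟩
      obtain ⟨r, rfl⟩ := hR r hr
      exact (hold.2 r).2 ⟨hr, by rwa [← hreps]⟩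
  have h₃ : ∀ r, r ∈ o.Enew.map triple ↔ r ∈ edgeSet M' ∧ r ∉ R := by
    intro r
    constructor
    · intro hr
      obtain ⟨r, hr', rfl⟩ := List.mem_map.1 hr
      rw [hreps]
      exact (hnew'.2 r).1 hr'
    · rintro ⟨hr, hr'⟩
      obtain ⟨r, hr'', rfl⟩ := Finset.mem_image.1 hr
      exact List.mem_map_of_mem ((hnew'.2 r).2 ⟨hr'', hr'⟩)
  have h₄ : ∀ {j x}, (o.new.map Fin.val)[j]? = some x → (σ.loadOutput D s a o).arr 3 j = x := by
    intro j x hx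
    rw [loadOutput_new, List.getD_eq_getElem?_getD]
    exact congrArg (Option.getD · 0) hx
  obtain ⟨σ', t, hex, L', hG, hd, hL, ht⟩ := (h.loadOutput a o).update (V' := vertexSet M')
    (R' := edgeSet M') (new := o.new.map Fin.val) (old := o.Eold.map triple)
    (new' := o.Enew.map triple) (hnew.1.map Fin.val_injective) (hold.1.map triple_injective)
    (hnew'.1.map triple_injective) (edges_edgeSet M') h₁ hV h₂ h₃ h₄ (listed_flatten _)
    (listed_flatten _) (by rw [List.length_map]; rfl) (by rw [List.length_map]; rfl)
    (by rw [List.length_map]; rfl) fun hs' => hs ((hmem s).1 hs')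
  refine ⟨σ', t, hex, ⟨L', hG⟩, ?_, ?_⟩
  · intro v
    rw [hd, e₆]
    exact if_congr (hmem v) rfl rfl
  · rw [credits, credits, hG.core.sp, h.core.sp]
    simp only [List.length_map] at hL ht
    -- The entry of a new vertex was 0 before, so no distance decreases, and the credits grow only
    -- by the pushes.
    have hle : ∀ v, σ.arr 6 v ≤ σ'.arr 6 v := by
      intro v
      rw [hd, e₆]
      split_ifs with hv
      · obtain ⟨v, hv', rfl⟩ := (hmap v).1 hv
        rw [h.zero _ ((hnew.2 v).1 hv').2]
        exact Nat.zero_le _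
      · exact le_rfl
    have : ∑ v ∈ (Finset.range (parameters n k D s w W hw hW).n).erase
          (parameters n k D s w W hw hW).s,
          ∑ x ∈ Finset.Ico (σ'.arr 6 v) ((parameters n k D s w W hw hW).D + 1),
          (parameters n k D s w W hw hW).charge (extend δ) x ≤
        ∑ v ∈ (Finset.range (parameters n k D s w W hw hW).n).erase
          (parameters n k D s w W hw hW).s,
          ∑ x ∈ Finset.Ico (σ.arr 6 v) ((parameters n k D s w W hw hW).D + 1),
          (parameters n k D s w W hw hW).charge (extend δ) x :=
      Finset.sum_le_sum fun v _ => Finset.sum_le_sum_of_subset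
        (Finset.Ico_subset_Ico_left (hle v))
    simp only [Output.size]
    omega

end Run

section Total

variable {n k D : ℕ} {s : Fin n} {w W : Fin (k + 1) → ℕ}

/-! ### The total time -/

/-- Each change of the key increases the quotient by `g`, so changes at different `x` have different
quotients. Before a change the quotient is at least 1, and its multiple of `g` is at most `D` as the
cut-off is not yet reached. -/
theorem card_filter_key_le (P : Par) {i : ℕ} (hi : i ≤ P.k) :
    ((Finset.range P.D).filter fun x => P.key i x ≠ P.key i (x + 1)).card ≤
      P.D / (1 + (P.W i - P.w i)) := by
  have hw := P.w_pos i hi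
  have hW := P.w_le i hi
  set g := 1 + (P.W i - P.w i) with hg
  have hg0 : 0 < g := by omega
  have hkey : ∀ x, P.key i x = min ((x + P.W i) / g * g) (P.D + 1) := fun x => rfl
  have hmono : ∀ {x y}, x ≤ y → (x + P.W i) / g ≤ (y + P.W i) / g := fun h =>
    Nat.div_le_div_right (by omega)
  have hlt : ∀ {x}, P.key i x ≠ P.key i (x + 1) →
      (x + P.W i) / g < (x + 1 + P.W i) / g ∧ (x + P.W i) / g * g ≤ P.D := by
    intro x hx
    rw [hkey, hkey] at hx
    have h₁ := hmono (Nat.le_succ x)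
    have h₂ := Nat.mul_le_mul_right g h₁
    refine ⟨lt_of_le_of_ne h₁ fun e => hx (by rw [e]), ?_⟩
    simp only [Nat.succ_eq_add_one] at h₂
    omega
  have hcard : (Finset.Icc 1 (P.D / g)).card = P.D / g := by simp
  rw [← hcard]
  refine Finset.card_le_card_of_injOn (fun x => (x + P.W i) / g) ?_ ?_
  · intro x hx
    simp only [Finset.coe_filter, Finset.mem_range, Set.mem_ofPred_eq, Finset.coe_Icc,
      Set.mem_Icc] at hx ⊢
    exact ⟨(Nat.one_le_div_iff hg0).2 (by omega), (Nat.le_div_iff_mul_le hg0).2 (hlt hx.2).2⟩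
  · intro x hx y hy e
    simp only [Finset.coe_filter, Finset.mem_range, Set.mem_ofPred_eq] at hx hy e
    by_contra hne
    rcases Nat.lt_or_gt_of_ne hne with h | h
    · have h₁ := (hlt hx.2).1
      have h₂ := hmono (show x + 1 ≤ y from h)
      omega
    · have h₁ := (hlt hy.2).1
      have h₂ := hmono (show y + 1 ≤ x from h)
      omega

theorem sum_charge_le (P : Par) (δ : ℕ → ℕ) :
    ∑ x ∈ Finset.range (P.D + 1), P.charge δ x ≤ 1000 * (P.D + 1) + 200 * (P.D * (P.k + 1)) +
      500 * ∑ i ∈ Finset.range (P.k + 1), P.D / (1 + (P.W i - P.w i)) * δ i := by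
  have h₁ : ∑ x ∈ Finset.range P.D, ∑ i ∈ Finset.range (P.k + 1), (200 + 500 * P.scanned δ x i) ≤
      200 * (P.D * (P.k + 1)) +
        500 * ∑ i ∈ Finset.range (P.k + 1), P.D / (1 + (P.W i - P.w i)) * δ i := by
    rw [Finset.sum_comm, Finset.mul_sum]
    have : 200 * (P.D * (P.k + 1)) = ∑ i ∈ Finset.range (P.k + 1), 200 * P.D := by
      simp only [Finset.sum_const, Finset.card_range, smul_eq_mul]
      ring
    rw [this, ← Finset.sum_add_distrib]
    refine Finset.sum_le_sum fun i hi => ?_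
    have hi' : i ≤ P.k := Nat.lt_succ_iff.1 (Finset.mem_range.1 hi)
    have h₂ : ∑ x ∈ Finset.range P.D, P.scanned δ x i =
        ((Finset.range P.D).filter fun x => P.key i x ≠ P.key i (x + 1)).card * δ i := by
      rw [← smul_eq_mul, ← Finset.sum_const, Finset.sum_filter]
      exact Finset.sum_congr rfl fun x _ => by rw [Par.scanned, ite_not]
    have h₃ := Nat.mul_le_mul_right (δ i) (card_filter_key_le P hi')
    rw [Finset.sum_add_distrib, ← Finset.mul_sum, h₂]
    simp only [Finset.sum_const, Finset.card_range, smul_eq_mul]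
    linarith
  have h₂ : ∀ x ∈ Finset.range P.D, P.charge δ x =
      1000 + ∑ i ∈ Finset.range (P.k + 1), (200 + 500 * P.scanned δ x i) := fun x hx => by
    rw [Par.charge, if_pos (Finset.mem_range.1 hx)]
  rw [Finset.sum_range_succ, Finset.sum_congr rfl h₂, Finset.sum_add_distrib, Par.charge,
    if_neg (lt_irrefl _)]
  simp only [Finset.sum_const, Finset.card_range, smul_eq_mul]
  linarith

theorem Output.IsInit.size_le {M : MState n k} {o : Output n k} (h : o.IsInit M) :
    o.size ≤ M.verts.card + M.reps.card := by
  classical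
  obtain ⟨⟨h₁, h₂⟩, h₃, h₄, h₅⟩ := h
  rw [Output.size, h₃, ← List.toFinset_card_of_nodup h₁, ← List.toFinset_card_of_nodup h₄,
    show o.new.toFinset = M.verts by ext; simp [h₂], show o.Enew.toFinset = M.reps by ext; simp [h₅]]
  simp

theorem Output.IsUpdate.size_le {M M' : MState n k} {o : Output n k} {op : Op n k}
    (h : o.IsUpdate M M') (hop : M.Step s M' op) :
    o.size + (M.verts.card + 4 * M'.weight) ≤ 2 + (M'.verts.card + 4 * M.weight) := by
  classical
  obtain ⟨⟨h₁, h₂⟩, ⟨h₃, h₄⟩, h₅, h₆⟩ := h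
  have e₁ : o.new.length = M'.verts.card - M.verts.card := by
    rw [← List.toFinset_card_of_nodup h₁, ← Finset.card_sdiff_of_subset hop.verts_subset]
    congr 1
    ext; simp [h₂]
  have e₂ : o.Eold.length = (M.reps \ M'.reps).card := by
    rw [← List.toFinset_card_of_nodup h₃]
    congr 1
    ext; simp [h₄]
  have e₃ : o.Enew.length = (M'.reps \ M.reps).card := by
    rw [← List.toFinset_card_of_nodup h₅]
    congr 1
    ext; simp [h₆]
  have h₇ := Finset.card_le_card hop.verts_subset
  have h₈ := hop.card_reps
  rw [Output.size]
  omega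

/-- Telescoping: new vertices are paid for by the growing number of vertices, changed
representatives by the falling weight. -/
theorem sum_size_le {M : ℕ → MState n k} {op : ℕ → Op n k} {o : ℕ → Output n k} {N : ℕ}
    (hM : ∀ j < N, (M j).Step s (M (j + 1)) (op j))
    (ho : ∀ j < N, (o j).IsUpdate (M j) (M (j + 1))) :
    ∑ j ∈ Finset.range N, (o j).size ≤ 2 * N + n + 4 * (M 0).weight := by
  suffices H : ∀ j ≤ N, ∑ i ∈ Finset.range j, (o i).size + 4 * (M j).weight ≤
      2 * j + (M j).verts.card + 4 * (M 0).weight by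
    have h₁ := H N le_rfl
    have h₂ : (M N).verts.card ≤ n := by simpa using Finset.card_le_univ (M N).verts
    omega
  intro j
  induction j with
  | zero => simp
  | succ j ih =>
    intro hj
    have h₁ := ih (by omega)
    have h₂ := (ho j hj).size_le (hM j hj)
    rw [Finset.sum_range_succ]
    omega

/-- The natural logarithm of 2 exceeds 1/2. -/
theorem natLog_le (hn : 1 ≤ n) : (Nat.log 2 n : ℝ) ≤ 2 * Real.log n := by
  have h₁ : ((2 ^ Nat.log 2 n : ℕ) : ℝ) ≤ n := by
    exact_mod_cast Nat.pow_log_le_self 2 (by omega)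
  have h₂ := Real.log_le_log (by positivity) h₁
  rw [Nat.cast_pow, Real.log_pow] at h₂
  have h₃ := Real.log_two_gt_d9
  push_cast at h₂
  nlinarith [Nat.cast_nonneg (α := ℝ) (Nat.log 2 n)]

theorem one_le_two_mul_log (hn : 2 ≤ n) : 1 ≤ 2 * Real.log n := by
  have h₂ : Real.log 2 ≤ Real.log n := Real.log_le_log (by norm_num) (by exact_mod_cast hn)
  linarith [Real.log_two_gt_d9]

/-- The bound on the total time in terms of logarithms. -/
theorem total_le {m N T F Z : ℕ} {ρ : ℝ} (hn : 1 ≤ n) (hρ : 0 ≤ ρ) {r : ℕ} (hr : r ≤ m)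
    (hr' : n = 1 → r = 0) (hZ : (Z : ℝ) ≤ D * ρ)
    (hF : F ≤ 1000 * (D + 1) + 200 * (D * (k + 1)) + 500 * Z)
    (hT : T ≤ (n - 1) * F + 1000 * (N + 1) + 600 * (n + r) +
      600 * (2 * N + n + 4 * (m * (2 * Nat.log 2 n)))) :
    (T : ℝ) ≤ (20000 : ℕ) * ((N + 1) + (m + n) * Real.log n + D * n * (k + Real.log n) +
      D * n * ρ) := by
  have hlog : 0 ≤ Real.log n := Real.log_nonneg (by exact_mod_cast hn)
  -- For `n = 1` both sides vanish. The source is never raised, so the number of raised vertices is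
  -- `n - 1` and this case costs nothing.
  have h₁ : (n : ℝ) - 1 ≤ 2 * (n * Real.log n) := by
    rcases hn.eq_or_lt with rfl | hn
    · simp
    · have := one_le_two_mul_log (n := n) hn
      nlinarith [Nat.cast_nonneg (α := ℝ) n]
  have h₂ : (r : ℝ) ≤ 2 * (m * Real.log n) := by
    rcases hn.eq_or_lt with rfl | hn
    · simp [hr' rfl]
    · have := one_le_two_mul_log (n := n) hn
      have : (r : ℝ) ≤ m := by exact_mod_cast hr
      nlinarith [Nat.cast_nonneg (α := ℝ) m]
  have h₃ : (m : ℝ) * (2 * Nat.log 2 n) ≤ 4 * (m * Real.log n) := by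
    have := natLog_le hn
    nlinarith [Nat.cast_nonneg (α := ℝ) m]
  have h₄ : (T : ℝ) ≤ (n - 1) * F + 1000 * (N + 1) + 600 * (n + r) +
      600 * (2 * N + n + 4 * (m * (2 * Nat.log 2 n))) := by
    have := (Nat.cast_le (α := ℝ)).2 hT
    push_cast [Nat.cast_sub hn] at this
    exact this
  have h₅ : (F : ℝ) ≤ 1000 * (D + 1) + 200 * (D * (k + 1)) + 500 * Z := by exact_mod_cast hF
  have hn0 : (0 : ℝ) ≤ n - 1 := by
    rw [sub_nonneg]
    exact_mod_cast hn
  have h₆ : ((n : ℝ) - 1) * F ≤ (n - 1) * (1000 + 1200 * D + 200 * (D * k) + 500 * (D * ρ)) := by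
    refine mul_le_mul_of_nonneg_left ?_ hn0
    linarith
  have h₇ : ((n : ℝ) - 1) * (D * k) ≤ n * (D * k) := by
    refine mul_le_mul_of_nonneg_right (by linarith) (by positivity)
  have h₈ : ((n : ℝ) - 1) * (D * ρ) ≤ n * (D * ρ) := by
    refine mul_le_mul_of_nonneg_right (by linarith) (by positivity)
  have h₉ : ((n : ℝ) - 1) * D ≤ 2 * (n * Real.log n) * D :=
    mul_le_mul_of_nonneg_right h₁ (Nat.cast_nonneg _)
  have p₁ : 0 ≤ (n : ℝ) * (D * k) := by positivity
  have p₂ : 0 ≤ (n : ℝ) * (D * ρ) := by positivity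
  have p₃ : 0 ≤ (n : ℝ) * Real.log n := by positivity
  have p₄ : 0 ≤ (m : ℝ) * Real.log n := by positivity
  have p₅ : 0 ≤ (n : ℝ) * Real.log n * D := by positivity
  have p₆ : (0 : ℝ) ≤ N := Nat.cast_nonneg _
  push_cast
  linarith

end Total

/-- A sequence of states can be built step by step. -/
theorem exists_run {α : Type*} {N : ℕ} {I : ℕ → α → Prop} {H : ℕ → α → α → ℕ → Prop}
    (step : ∀ j < N, ∀ x, I j x → ∃ y t, I (j + 1) y ∧ H j x y t) {x₀ : α} (h₀ : I 0 x₀) (t₀ : ℕ) :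
    ∃ (x : ℕ → α) (t : ℕ → ℕ), x 0 = x₀ ∧ t 0 = t₀ ∧ ∀ j < N, H j (x j) (x (j + 1)) (t (j + 1)) := by
  -- Dummy values outside of the invariant make the choice total.
  have : ∀ j x, ∃ y t, j < N → I j x → I (j + 1) y ∧ H j x y t := by
    intro j x
    by_cases h : j < N ∧ I j x
    · obtain ⟨y, t, h'⟩ := step j h.1 x h.2
      exact ⟨y, t, fun _ _ => h'⟩
    · exact ⟨x, 0, fun h₁ h₂ => absurd ⟨h₁, h₂⟩ h⟩
  choose F T hFT using this
  let x : ℕ → α := fun j => Nat.rec x₀ (fun j y => F j y) j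
  have hI : ∀ j ≤ N, I j (x j) := by
    intro j
    induction j with
    | zero => exact fun _ => h₀
    | succ j ih => exact fun hj => (hFT j (x j) hj (ih (by omega))).1
  exact ⟨x, fun j => Nat.casesOn j t₀ fun j => T j (x j), rfl, rfl,
    fun j hj => (hFT j (x j) hj (hI j hj.le)).2⟩

/-! ### The initialization and a single operation -/

section Run

variable {n k D : ℕ} {s : Fin n} {w W : Fin (k + 1) → ℕ} {hw : ∀ i, 1 ≤ w i}
  {hW : ∀ i, w i ≤ W i} {M M' : MState n k} {op : Op n k} {o : Output n k} {σ : Store}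
  {δ : Fin (k + 1) → ℕ}

/-- The invariant between the operations. -/
def Valid (P : Par) (s : Fin n) (w W : Fin (k + 1) → ℕ) (M : MState n k) (σ : Store) : Prop :=
  s ∈ M.verts ∧ (∃ L, Good P (vertexSet M) (edgeSet M) L σ) ∧ M.Feasible w W fun v => σ.arr 6 v

theorem loadOutput_initStore (o : Output n k) :
    (initStore w W D s o).loadOutput D s 0 o = initStore w W D s o := by
  simp only [initStore, Store.loadOutput, Store.load]
  congr 1
  funext a
  simp only [Function.update_apply]
  split_ifs <;> rfl

/-- All distances are 0, which is feasible. The credits are then the full charge of every vertex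
other than the source. -/
theorem run_init (hs : s ∈ M.verts) (ho : o.IsInit M) :
    ∃ σ t, Exec ((n + k + D + ∑ i, W i + 2) ^ 8) Code.update (initStore w W D s o) σ t ∧
      Valid (parameters n k D s w W hw hW) s w W M σ ∧
      credits (parameters n k D s w W hw hW) (extend δ) σ + t ≤
        (n - 1) * (∑ x ∈ Finset.range (D + 1),
          (parameters n k D s w W hw hW).charge (extend δ) x) + 1000 + 600 * o.size := by
  obtain ⟨⟨h₁, h₂⟩, h₃, h₄, h₅⟩ := ho
  obtain ⟨σ, t, hex, hG, hd, ht⟩ := run_update (M' := M) (δ := δ)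
    (good_initStore (hw := hw) (hW := hW) (D := D) (s := s) o) (a := 0) (o := o)
    ⟨h₁, by simpa using h₂⟩ (by simp [h₃]) (by simp) ⟨h₄, by simpa using h₅⟩ (by simp)
    (fun _ => rfl)
  rw [loadOutput_initStore] at hex
  refine ⟨σ, t, hex, ⟨hs, hG, ?_⟩, ht.trans_eq ?_⟩
  · have hd0 : ∀ v : Fin n, σ.arr 6 v = 0 := fun v => by
      rw [hd]
      exact ite_self _
    intro e _
    change σ.arr 6 _ ≤ _
    rw [hd0]
    exact Nat.zero_le _
  · have e : credits (parameters n k D s w W hw hW) (extend δ) (initStore w W D s o) =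
        (n - 1) * ∑ x ∈ Finset.range (D + 1),
          (parameters n k D s w W hw hW).charge (extend δ) x := by
      have h₀ : ∀ v, (initStore w W D s o).arr 6 v = 0 := fun _ => rfl
      have h₀' : (initStore w W D s o).reg 0 = 0 := rfl
      simp only [credits, h₀, h₀', Finset.sum_const, smul_eq_mul, ← Finset.range_eq_Ico]
      rw [Finset.card_erase_of_mem (Finset.mem_range.2 (Par.s_lt _)), Finset.card_range]
      simp [parameters]
    rw [e]

theorem run_step (hmono : ∀ i j, i ≤ j → ∀ x, flexCeil w W i x ≤ flexCeil w W j x)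
    (hop : M.Step s M' op) (ho : o.IsUpdate M M')
    (hδ : op = .updateDistances → ∀ v ∈ M.verts, ∀ i,
      (M.reps.filter fun r => r.2.2 = i ∧ (r.1 = v ∨ r.2.1 = v)).card ≤ δ i)
    (h : Valid (parameters n k D s w W hw hW) s w W M σ) :
    ∃ σ' t, Valid (parameters n k D s w W hw hW) s w W M' σ' ∧
      program.Handles ((n + k + D + ∑ i, W i + 2) ^ 8) D s o σ σ' t op ∧
      (op = .updateDistances → ∀ ω, IsFlexWeight w W s M' ω →
        IsSSSPTree s D M' ω σ'.distArray σ'.parentArray) ∧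
      credits (parameters n k D s w W hw hW) (extend δ) σ' + t ≤
        credits (parameters n k D s w W hw hW) (extend δ) σ + 1000 + 600 * o.size := by
  obtain ⟨hs, ⟨L, hG⟩, hf⟩ := h
  by_cases hupd : op = .updateDistances
  · subst hupd
    obtain rfl : M' = M := hop
    have hdeg : ∀ u ∈ vertexSet M', ∀ i ≤ k,
        ((edgeSet M').filter fun r => r.1 = u ∧ r.2.2 = i).card ≤ extend δ i := by
      intro u hu i hi
      obtain ⟨u, hu', rfl⟩ := Finset.mem_image.1 hu
      rw [extend_of_le _ hi]
      refine le_trans ?_ (hδ rfl u hu' ⟨i, Nat.lt_succ_of_le hi⟩)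
      rw [edgeSet, Finset.filter_image]
      refine Finset.card_image_le.trans (Finset.card_le_card fun r hr => ?_)
      obtain ⟨h₁, h₂, h₃⟩ := Finset.mem_filter.1 hr
      exact Finset.mem_filter.2 ⟨h₁, Fin.ext h₃, .inl (Fin.ext h₂)⟩
    obtain ⟨σ', t, hex, hG', hf', ht⟩ := hG.updateDistances (δ := extend δ)
      ((feasible_iff hmono hG.core.dist_le).2 hf) hdeg
    have hf'' := (feasible_iff hmono hG'.core.dist_le).1 hf'
    refine ⟨σ', t, ⟨hs, ⟨_, hG'⟩, hf''⟩, hex, fun _ ω hω => isSSSPTree_of_good hG' hf'' hω, ?_⟩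
    rw [hG.potential_eq, hG'.potential_eq] at ht
    omega
  · obtain ⟨⟨h₁, h₂⟩, ⟨h₃, h₄⟩, h₅, h₆⟩ := ho
    have hreps : ∀ r, triple r ∈ edgeSet M ↔ r ∈ M.reps := fun r => by
      rw [edgeSet, Finset.mem_image]
      exact ⟨fun ⟨r', h, e⟩ => triple_injective e ▸ h, fun h => ⟨r, h, rfl⟩⟩
    obtain ⟨σ', t, hex, hG', hd, ht⟩ := run_update (M' := M') (δ := δ) hG (a := op.vertex) (o := o)
      ⟨h₁, fun v => by rw [h₂, mem_vertexSet]⟩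
      ⟨h₃, fun r => by
        rw [List.mem_map_of_injective triple_injective, h₄, hreps]⟩
      (fun r hr => by
        obtain ⟨r, -, rfl⟩ := Finset.mem_image.1 hr
        exact ⟨r, rfl⟩)
      ⟨h₅, fun r => by rw [h₆, hreps]⟩
      (Finset.image_subset_image hop.verts_subset)
      (fun h => absurd hs ((h₂ s).1 h).2)
    refine ⟨σ', t, ⟨hop.verts_subset hs, hG', hop.feasible hw hW hmono hf ?_⟩, ?_,
      fun h => absurd h hupd, ht⟩
    · intro v
      rw [hd]
      exact if_congr (h₂ v) rfl rfl
    · cases op with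
      | delete e => exact hex
      | increase e i => exact hex
      | split a f => exact hex
      | updateDistances => exact absurd rfl hupd

end Run

end FlexES

/-! ### The main theorem -/

theorem mainTheorem8 :
    ∃ (A : FlexES.Program) (c C : ℕ),
      ∀ (n k D N : ℕ) (s : Fin n) (w W : Fin (k + 1) → ℕ)
        (M : ℕ → FlexES.MState n k) (op : ℕ → FlexES.Op n k)
        (o₀ : FlexES.Output n k) (o : ℕ → FlexES.Output n k) (δ : Fin (k + 1) → ℕ),
        -- the weight bounds
        (∀ i, 1 ≤ w i) → (∀ i, w i ≤ W i) →
        (∀ i j, i ≤ j → ∀ x, FlexES.flexCeil w W i x ≤ FlexES.flexCeil w W j x) →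
        -- the sequence of operations
        s ∈ (M 0).verts → o₀.IsInit (M 0) →
        (∀ j < N, (M j).Step s (M (j + 1)) (op j)) →
        (∀ j < N, (o j).IsUpdate (M j) (M (j + 1))) →
        -- the degree bounds during the executions of `UpdateDistances`
        (∀ j < N, op j = .updateDistances → ∀ v ∈ (M j).verts, ∀ i,
          ((M j).reps.filter fun r => r.2.2 = i ∧ (r.1 = v ∨ r.2.1 = v)).card ≤ δ i) →
        ∃ (σ : ℕ → FlexES.Store) (t : ℕ → ℕ),
          -- the run of the data structure, on machine words of `O(log (n + k + D + ∑ W))` bits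
          FlexES.Exec ((n + k + D + ∑ i, W i + 2) ^ c) A.init
            (FlexES.initStore w W D s o₀) (σ 0) (t 0) ∧
          (∀ j < N, A.Handles ((n + k + D + ∑ i, W i + 2) ^ c) D s (o j)
            (σ j) (σ (j + 1)) (t (j + 1)) (op j)) ∧
          -- correctness
          (∀ j < N, op j = .updateDistances →
            (∃ ω, FlexES.IsFlexWeight w W s (M (j + 1)) ω) ∧
            ∀ ω, FlexES.IsFlexWeight w W s (M (j + 1)) ω →
              FlexES.IsSSSPTree s D (M (j + 1)) ω (σ (j + 1)).distArray (σ (j + 1)).parentArray) ∧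
          -- total time
          ((∑ j ∈ Finset.range (N + 1), t j : ℕ) : ℝ) ≤
            C * ((N + 1) + ((M 0).E.card + n) * Real.log n
              + D * n * (k + Real.log n)
              + D * n * ∑ i, (δ i : ℝ) / (1 + (W i : ℝ) - w i)) := by
  open FlexES in
  refine ⟨program, 8, 20000, ?_⟩
  intro n k D N s w W M op o₀ o δ hw hW hmono hs ho₀ hM ho hδ
  set P := parameters n k D s w W hw hW with hP
  obtain ⟨σ₀, t₀, hex, hV₀, ht₀⟩ := run_init (D := D) (w := w) (W := W) (hw := hw) (hW := hW)
    (δ := δ) hs ho₀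
  obtain ⟨σ, t, rfl, rfl, hrun⟩ := exists_run (N := N) (I := fun j => Valid P s w W (M j))
    (fun j hj σ h => run_step hmono (hM j hj) (ho j hj) (hδ j hj) h) hV₀ t₀
  refine ⟨σ, t, hex, fun j hj => (hrun j hj).1,
    fun j hj hop => ⟨exists_isFlexWeight hw hW s _, (hrun j hj).2.1 hop⟩, ?_⟩
  -- Amortization: time plus remaining credits is at most the initial credits plus what the reports
  -- and the operations add.
  have htotal : ∀ j ≤ N, credits P (extend δ) (σ j) + ∑ i ∈ Finset.range (j + 1), t i ≤
      (n - 1) * (∑ x ∈ Finset.range (D + 1), P.charge (extend δ) x) + 1000 * (j + 1) +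
        600 * o₀.size + 600 * ∑ i ∈ Finset.range j, (o i).size := by
    intro j
    induction j with
    | zero =>
      intro _
      simp only [zero_add, Finset.sum_range_one, Finset.sum_range_zero]
      exact ht₀
    | succ j ih =>
      intro hj
      have h₁ := ih (by omega)
      have h₂ : credits P (extend δ) (σ (j + 1)) + t (j + 1) ≤
          credits P (extend δ) (σ j) + 1000 + 600 * (o j).size := (hrun j hj).2.2
      rw [Finset.sum_range_succ t (j + 1), Finset.sum_range_succ (fun i => (o i).size) j]
      omega
  have h₁ := htotal N le_rfl
  have h₂ := ho₀.size_le
  have h₃ := sum_size_le hM ho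
  have h₄ := (M 0).weight_le
  have h₅ : (M 0).verts.card ≤ n := by simpa using Finset.card_le_univ (M 0).verts
  have hρ : ∀ i, 0 ≤ (δ i : ℝ) / (1 + (W i : ℝ) - w i) := fun i => by
    have : (w i : ℝ) ≤ W i := by exact_mod_cast hW i
    exact div_nonneg (Nat.cast_nonneg _) (by linarith)
  refine total_le (r := (M 0).reps.card)
    (Z := ∑ i ∈ Finset.range (k + 1), D / (1 + (P.W i - P.w i)) * extend δ i)
    s.pos (Finset.sum_nonneg fun i _ => hρ i) MState.card_reps_le ?_ ?_
    (sum_charge_le P (extend δ)) ?_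
  -- On a single vertex all edges are self-loops, so there are no representatives.
  · rintro rfl
    rw [Finset.card_eq_zero, Finset.eq_empty_iff_forall_notMem]
    intro r hr
    obtain ⟨e, he, -⟩ := MState.mem_reps.1 hr
    exact (MState.mem_edges.1 he.1).2 (Subsingleton.elim _ _)
  -- The integer quotient `D / g` is at most the real one, and `w i ≤ W i` identifies the two forms
  -- of `g`.
  · rw [Finset.sum_range, Nat.cast_sum, Finset.mul_sum]
    refine Finset.sum_le_sum fun i _ => ?_
    simp only [hP, parameters, extend_coe]
    have hg : (1 + (W i : ℝ) - w i) = ((1 + (W i - w i) : ℕ) : ℝ) := by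
      push_cast [Nat.cast_sub (hW i)]
      ring
    rw [hg, mul_div_left_comm, mul_comm, Nat.cast_mul]
    exact mul_le_mul_of_nonneg_left Nat.cast_div_le (Nat.cast_nonneg _)
  · change _ ≤ (n - 1) * (∑ x ∈ Finset.range (D + 1), P.charge (extend δ) x) + _ + _ + _
    omega
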